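/- Let $0<r<\infty$ and let $f\in C^2[0,r)$ satisfy $f(u)>0$ for $0\le u<r$, $f'(u)>0$ and $f''(u)>0$ for $0<u<r$, and $0<\liminf_{u\to r^-}(r-u)f(u)\le\infty$. For $\lambda>0$ consider $$u''''(x)=\lambda f(u(x)),\quad x\in(0,1),\qquad u(0)=u(1)=u'(0)=u'(1)=0, \tag{1}$$ and call $u\in C^4[0,1]$ with values in $[0,r)$ a positive solution if it satisfies (1) and $u\not\equiv 0$ (so $u\ge 0$). Then all positive solutions lie on one smooth curve. More precisely, there is a $C^2$ curve $[0,r)\to\mathbb R\times C^4[0,1]$, $p\mapsto(\lambda(p),u_p)$, with $(\lambda(0),u_0)=(0,0)$ and $u_p(\tfrac12)=p$ for all $p$, such that $$\{(\lambda,u):\lambda>0,\ u\text{ is a positive solution of (1)}\}=\{(\lambda(p),u_p):0<p<r\};$$ in particular $u(\tfrac12)$ is strictly monotone along the curve. There is $p_0\in(0,r)$ such that $\lambda(\cdot)$ is strictly increasing on $[0,p_0]$ and strictly decreasing on $[p_0,r)$, that is, the curve turns exactly once, at $\lambda_0:=\lambda(p_0)$. Problem (1) has exactly two positive solutions for $0<\lambda<\lambda_0$,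 exactly one for $\lambda=\lambda_0$ and none for $\lambda>\lambda_0$. Every positive solution is symmetric about $x=\tfrac12$ and attains its maximum at $x=\tfrac12$. Along the upper branch $p\to r^-$ one has $\lambda(p)\to0$ and $u_p\to w$ in $C^{2+\alpha}[0,1]$ for every $\alpha\in(0,1)$, where $$w(x)=\begin{cases}-16rx^3+12rx^2,&0\le x\le\frac12,\\-16r(1-x)^3+12r(1-x)^2,&\frac12\le x\le1.\end{cases}$$ The function $w$ is symmetric about $x=\frac12$, has the maximum value $w(\frac12)=r$, and belongs to $\bigl(C^{2+\alpha}[0,1]\setminus C^3[0,1]\bigr)\cap C^4\bigl([0,1]\setminus\{\tfrac12\}\bigr)$ for every $\alpha\in(0,1)$. -/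

import Mathlib

/-- The space `C^k[0,1]` of real functions, realised as the closed subspace of `C([0,1])^(k+1)`
that consists of the tuples `(u, u', …, u^(k))` (derivatives relative to `[0,1]`, so one-sided at
the endpoints). Such a tuple is determined by its first entry. The norm inherited from the product
is `max_{j ≤ k} sup |u^(j)|`, so a curve in this space is `C^n` exactly when it is `C^n` for the
usual `C^k[0,1]` norm. -/
def ckSubmodule (k : ℕ) : Submodule ℝ (Fin (k + 1) → C(unitInterval, ℝ)) where
  carrier := {g | ∀ (i : Fin k) (x : unitInterval),
    HasDerivWithinAt (Set.IccExtend zero_le_one (g i.castSucc)) (g i.succ x)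
      (Set.Icc (0 : ℝ) 1) (x : ℝ)}
  add_mem' := by
    intro a b ha hb i x
    exact (ha i x).add (hb i x)
  zero_mem' := by
    intro i x
    exact hasDerivWithinAt_const _ _ (0 : ℝ)
  smul_mem' := by
    intro c a ha i x
    exact (ha i x).const_smul c

/-- The normed space `C^k[0,1]`. -/
abbrev CkFun (k : ℕ) : Type := ckSubmodule k

/-- The `j`-th derivative of `u ∈ C^k[0,1]`, for `0 ≤ j ≤ k`; `u.der 0` is the function itself. -/
def CkFun.der {k : ℕ} (u : CkFun k) (j : Fin (k + 1)) : C(unitInterval, ℝ) := u.1 j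

/-- The inclusion `C^k[0,1] ⊆ C^m[0,1]` for `m ≤ k`. -/
def CkFun.incl {k m : ℕ} (h : m ≤ k) (u : CkFun k) : CkFun m :=
  ⟨fun j => u.der (Fin.castLE (Nat.succ_le_succ h) j), fun i x => u.2 (Fin.castLE h i) x⟩

/-- The midpoint `1/2` of `[0,1]`. -/
noncomputable def midpt : unitInterval := ⟨1 / 2, by norm_num, by norm_num⟩

/-- The norm of `C^{2+α}[0,1]`, with value `∞` on the functions of `C^2[0,1]` whose second
derivative is not Hölder continuous with exponent `α`. -/
noncomputable def holderNorm (α : NNReal) (v : CkFun 2) : ENNReal :=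
  ‖v‖ₑ + eHolderNorm α (v.der 2)

/-- `u ∈ C^4[0,1]` is a positive solution of `u'''' = lam * f u` on `(0,1)`,
`u(0) = u(1) = u'(0) = u'(1) = 0`, where `f` is a function on `[0,r)`
(so that the values of `u` have to lie there). -/
structure IsPositiveSolution (f : ℝ → ℝ) (r lam : ℝ) (u : CkFun 4) : Prop where
  nonneg : ∀ x : unitInterval, 0 ≤ u.der 0 x
  lt : ∀ x : unitInterval, u.der 0 x < r
  nontrivial : ∃ x : unitInterval, u.der 0 x ≠ 0
  eqn : ∀ x : unitInterval, 0 < x → x < 1 → u.der 4 x = lam * f (u.der 0 x)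
  left : u.der 0 0 = 0
  right : u.der 0 1 = 0
  left' : u.der 1 0 = 0
  right' : u.der 1 1 = 0

/-- The set `S` of all pairs `(lam, u)` with `lam > 0` and `u` a positive solution for `lam`. -/
def solutionSet (f : ℝ → ℝ) (r : ℝ) : Set (ℝ × CkFun 4) :=
  {q | 0 < q.1 ∧ IsPositiveSolution f r q.1 q.2}

/-- The function `-16 r x^3 + 12 r x^2` on `[0,1/2]`, reflected about `x = 1/2`. -/
noncomputable def limitProfile (r : ℝ) (x : ℝ) : ℝ :=
  if x ≤ 1 / 2 then -16 * r * x ^ 3 + 12 * r * x ^ 2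
  else -16 * r * (1 - x) ^ 3 + 12 * r * (1 - x) ^ 2

/-! Everything rests on one feature of v'''' = f(v) with f positive and increasing: solutions of the
initial value problem are ordered by their data. Call a solution followed from its maximum p to a
clamped end a profile. If two profiles with the same p have ordered second and third derivatives at
the start, their difference grows strictly unless the data agree, and this is incompatible with both
ends being clamped (`IsProfile.unique`). The two halves of a positive solution, seen from its
maximum point, have the same second and opposite third derivatives there, so they coincide and the
solution is symmetric (`clamped_solution_symmetric`). The third derivative then vanishes at 1/2;
once λ is scaled away a single datum is left, so the maximum determines both λ and u.

Existence and smoothness come from u = λ G(f(u)), with G the clamped Green operator and λ = p /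
G(f(u))(1/2). Up to a factor its linearization in u is the identity minus a compact operator. It is
injective: a multiple of t v', the generator of scaling, reduces a kernel element to a homogeneous
linear problem to which comparison applies (`IsProfile.linearized_eq_zero`). The implicit function
theorem and compactness continue the solution through all p in [0, r) (`exists_local_branch`,
`exists_isBranchPoint`).

The single turn needs no second-order computation. Symmetric solutions with the same λ are ordered
by their maxima, by a sliding argument (`IsProfile.le_of_max_lt`). For three of them, v ≤ w ≤ x,
Lagrange's identity for w - v and x - w has no boundary terms, whereas strict convexity gives its
integrand a sign (`IsProfile.not_three`). So λ(p) takes no value three times; positive inside and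
tending to 0 at both ends, it is unimodal (`exists_unimodal`).

As p → r, the solution stays a fixed distance below r away from the midpoint, which makes v'''' of
order λ there, and v''' is bounded. Near the midpoint f(v) ≥ c / (r - v) is so large that a bounded
v''' forces λ → 0 (`IsProfile.lam_le_sqrt`). Hence v''' is nearly constant on each half away from
the midpoint and v is close to a clamped cubic (`DerivChain.near_cubic`). Interpolation with a
Lipschitz bound for u'' upgrades the uniform convergence of u'' to Hölder convergence. -/

open Set Filter Topology

/-! ### Chains of derivatives and comparison principles -/

/-- `v 0, …, v 4` are successive derivatives of `v 0` relative to `[a, b]`. -/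
def DerivChain (a b : ℝ) (v : ℕ → ℝ → ℝ) : Prop :=
  ∀ i < 4, ∀ t ∈ Icc a b, HasDerivWithinAt (v i) (v (i + 1) t) (Icc a b) t

theorem monotoneOn_of_hasDerivWithinAt_Icc {a b : ℝ} {g g' : ℝ → ℝ}
    (h : ∀ t ∈ Icc a b, HasDerivWithinAt g (g' t) (Icc a b) t)
    (h0 : ∀ t ∈ Icc a b, 0 ≤ g' t) : MonotoneOn g (Icc a b) := by
  refine monotoneOn_of_hasDerivWithinAt_nonneg (f' := g') (convex_Icc a b)
    (fun t ht => (h t ht).continuousWithinAt) (fun t ht => ?_) (fun t ht => h0 t (interior_subset ht))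
  exact (h t (interior_subset ht)).mono interior_subset

theorem antitoneOn_of_hasDerivWithinAt_Icc {a b : ℝ} {g g' : ℝ → ℝ}
    (h : ∀ t ∈ Icc a b, HasDerivWithinAt g (g' t) (Icc a b) t)
    (h0 : ∀ t ∈ Icc a b, g' t ≤ 0) : AntitoneOn g (Icc a b) := by
  refine antitoneOn_of_hasDerivWithinAt_nonpos (f' := g') (convex_Icc a b)
    (fun t ht => (h t ht).continuousWithinAt) (fun t ht => ?_) (fun t ht => h0 t (interior_subset ht))
  exact (h t (interior_subset ht)).mono interior_subset

theorem deriv_eq_zero_of_const_Icc {a b c : ℝ} {g g' : ℝ → ℝ} (hab : a < b)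
    (h : ∀ t ∈ Icc a b, HasDerivWithinAt g (g' t) (Icc a b) t)
    (hc : ∀ t ∈ Icc a b, g t = c) : ∀ t ∈ Icc a b, g' t = 0 := by
  intro t ht
  have h1 : HasDerivWithinAt g 0 (Icc a b) t :=
    (hasDerivWithinAt_const t (Icc a b) c).congr hc (hc t ht)
  exact ((h t ht).derivWithin (uniqueDiffOn_Icc hab t ht)).symm.trans
    (h1.derivWithin (uniqueDiffOn_Icc hab t ht))

/-- A function with convex graph on `[a, b]` that is nonpositive at the ends is nonpositive. -/
theorem nonpos_of_second_deriv_nonneg {a b : ℝ} {g g' g'' : ℝ → ℝ}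
    (h : ∀ t ∈ Icc a b, HasDerivWithinAt g (g' t) (Icc a b) t)
    (h' : ∀ t ∈ Icc a b, HasDerivWithinAt g' (g'' t) (Icc a b) t)
    (h0 : ∀ t ∈ Icc a b, 0 ≤ g'' t) (ha : g a ≤ 0) (hb : g b ≤ 0) :
    ∀ t ∈ Icc a b, g t ≤ 0 := by
  intro t ht
  have hc : ConvexOn ℝ (Icc a b) g := by
    refine convexOn_of_hasDerivWithinAt2_nonneg (f' := g') (f'' := g'') (convex_Icc a b)
      (fun t ht => (h t ht).continuousWithinAt) (fun t ht => ?_) (fun t ht => ?_) (fun t ht => ?_)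
    · exact (h t (interior_subset ht)).mono interior_subset
    · exact (h' t (interior_subset ht)).mono interior_subset
    · exact h0 t (interior_subset ht)
  have hab : a ≤ b := ht.1.trans ht.2
  exact (hc.le_max_of_mem_Icc (left_mem_Icc.2 hab) (right_mem_Icc.2 hab) ht).trans (max_le ha hb)

namespace DerivChain

variable {a b : ℝ} {v w : ℕ → ℝ → ℝ}

theorem mono (h : DerivChain a b v) {a' b' : ℝ} (ha : a ≤ a') (hb : b' ≤ b) :
    DerivChain a' b' v := fun i hi t ht =>
  (h i hi t ⟨ha.trans ht.1, ht.2.trans hb⟩).mono (Icc_subset_Icc ha hb)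

theorem sub (h : DerivChain a b v) (h' : DerivChain a b w) :
    DerivChain a b (fun i t => v i t - w i t) := fun i hi t ht => (h i hi t ht).sub (h' i hi t ht)

theorem neg (h : DerivChain a b v) :
    DerivChain a b (fun i t => -v i t) := fun i hi t ht => (h i hi t ht).neg

/-- This one substitution serves for shifting the centre to 0, for reflection (c = -1) and for
scaling the parameter away. -/
theorem affine (h : DerivChain a b v) {a' b' x c : ℝ}
    (hm : ∀ t ∈ Icc a' b', x + c * t ∈ Icc a b) :
    DerivChain a' b' (fun i t => c ^ i * v i (x + c * t)) := by
  intro i hi t ht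
  have h1 : HasDerivWithinAt (fun t => x + c * t) c (Icc a' b') t := by
    simpa using ((hasDerivWithinAt_id t (Icc a' b')).const_mul c).const_add x
  have h2 := ((h i hi _ (hm t ht)).comp t h1 hm).const_mul (c ^ i)
  beta_reduce
  rw [show c ^ (i + 1) * v (i + 1) (x + c * t) = c ^ i * (v (i + 1) (x + c * t) * c) by ring]
  exact h2

theorem continuousOn (h : DerivChain a b v) {i : ℕ} (hi : i < 4) : ContinuousOn (v i) (Icc a b) :=
  fun t ht => (h i hi t ht).continuousWithinAt

theorem monotoneOn (h : DerivChain a b v) {i : ℕ} (hi : i < 4)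
    (h0 : ∀ t ∈ Icc a b, 0 ≤ v (i + 1) t) : MonotoneOn (v i) (Icc a b) :=
  monotoneOn_of_hasDerivWithinAt_Icc (h i hi) h0

theorem antitoneOn (h : DerivChain a b v) {i : ℕ} (hi : i < 4)
    (h0 : ∀ t ∈ Icc a b, v (i + 1) t ≤ 0) : AntitoneOn (v i) (Icc a b) :=
  antitoneOn_of_hasDerivWithinAt_Icc (h i hi) h0

theorem le_of_nonneg (h : DerivChain a b v) {i : ℕ} (hi : i < 4)
    (h0 : ∀ t ∈ Icc a b, 0 ≤ v (i + 1) t) {t : ℝ} (ht : t ∈ Icc a b) : v i a ≤ v i t :=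
  h.monotoneOn hi h0 (left_mem_Icc.2 (ht.1.trans ht.2)) ht ht.1

/-- Nonnegative data at `a` and a nonnegative fourth derivative propagate. -/
theorem nonneg (h : DerivChain a b v) (h4 : ∀ t ∈ Icc a b, 0 ≤ v 4 t)
    (h1 : 0 ≤ v 1 a) (h2 : 0 ≤ v 2 a) (h3 : 0 ≤ v 3 a) :
    ∀ t ∈ Icc a b, 0 ≤ v 1 t ∧ 0 ≤ v 2 t ∧ 0 ≤ v 3 t := by
  have e3 : ∀ t ∈ Icc a b, 0 ≤ v 3 t := fun t ht => h3.trans (h.le_of_nonneg (by norm_num) h4 ht)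
  have e2 : ∀ t ∈ Icc a b, 0 ≤ v 2 t := fun t ht => h2.trans (h.le_of_nonneg (by norm_num) e3 ht)
  have e1 : ∀ t ∈ Icc a b, 0 ≤ v 1 t := fun t ht => h1.trans (h.le_of_nonneg (by norm_num) e2 ht)
  exact fun t ht => ⟨e1 t ht, e2 t ht, e3 t ht⟩

theorem eq_zero_of_const (h : DerivChain a b v) (hab : a < b) {i : ℕ} (hi : i < 4) {c : ℝ}
    (hc : ∀ t ∈ Icc a b, v i t = c) : ∀ t ∈ Icc a b, v (i + 1) t = 0 :=
  deriv_eq_zero_of_const_Icc hab (h i hi) hc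

/-- Strict growth from nonnegative, nontrivial data. -/
theorem growth (h : DerivChain a b v) (hab : a < b) (h4 : ∀ t ∈ Icc a b, 0 ≤ v 4 t)
    (h1 : 0 ≤ v 1 a) (h2 : 0 ≤ v 2 a) (h3 : 0 ≤ v 3 a) (hne : v 1 a ≠ 0 ∨ v 2 a ≠ 0 ∨ v 3 a ≠ 0) :
    v 0 a < v 0 b ∧ 0 < v 1 b := by
  have e := h.nonneg h4 h1 h2 h3
  have ha := left_mem_Icc.2 hab.le
  have hb := right_mem_Icc.2 hab.le
  have key : ¬ ∀ t ∈ Icc a b, v 1 t = 0 := fun c1 => by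
    have c2 := h.eq_zero_of_const hab (by norm_num) c1
    have c3 := h.eq_zero_of_const hab (by norm_num) c2
    rcases hne with hn | hn | hn
    · exact hn (c1 a ha)
    · exact hn (c2 a ha)
    · exact hn (c3 a ha)
  have m0 := h.monotoneOn (i := 0) (by norm_num) (fun t ht => (e t ht).1)
  have m1 := h.monotoneOn (i := 1) (by norm_num) (fun t ht => (e t ht).2.1)
  constructor
  · by_contra hc
    push Not at hc
    refine key (h.eq_zero_of_const (c := v 0 a) hab (by norm_num) fun t ht => ?_)
    exact le_antisymm ((m0 ht hb ht.2).trans hc) (m0 ha ht ht.1)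
  · by_contra hc
    push Not at hc
    exact key fun t ht => le_antisymm ((m1 ht hb ht.2).trans hc) (e t ht).1

/-- One integration of an exponential lower bound. The constant of integration g(0) - c/K is
nonnegative because c ≤ 0, so it can be dropped and the step iterated. -/
theorem exp_lower_bound {T K c : ℝ} (hK : 0 < K) (hc : c ≤ 0) {g g' : ℝ → ℝ}
    (h : ∀ t ∈ Icc 0 T, HasDerivWithinAt g (g' t) (Icc 0 T) t) (hg : 0 ≤ g 0)
    (h' : ∀ t ∈ Icc 0 T, c * Real.exp (K * t) ≤ g' t) :
    ∀ t ∈ Icc 0 T, c / K * Real.exp (K * t) ≤ g t := by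
  intro t ht
  have hd : ∀ t ∈ Icc 0 T, HasDerivWithinAt (fun t => g t - c / K * Real.exp (K * t))
      (g' t - c * Real.exp (K * t)) (Icc 0 T) t := by
    intro t ht
    have h1 : HasDerivAt (fun t : ℝ => Real.exp (K * t)) (Real.exp (K * t) * K) t := by
      simpa using ((hasDerivAt_id t).const_mul K).exp
    rw [show c * Real.exp (K * t) = c / K * (Real.exp (K * t) * K) by field_simp]
    exact (h t ht).sub ((h1.const_mul (c / K)).hasDerivWithinAt)
  have hm := monotoneOn_of_hasDerivWithinAt_Icc hd (fun t ht => sub_nonneg.2 (h' t ht))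
  have h2 := hm (left_mem_Icc.2 (ht.1.trans ht.2)) ht ht.1
  have h3 : c / K ≤ 0 := div_nonpos_of_nonpos_of_nonneg hc hK.le
  simp only [mul_zero, Real.exp_zero, mul_one] at h2
  linarith

/-- Comparison principle for the initial value problem. -/
theorem ivp_nonneg {T L : ℝ} (hL : 0 ≤ L) (h : DerivChain 0 T v) (h0 : ∀ i < 4, 0 ≤ v i 0)
    (h4 : ∀ t ∈ Icc 0 T, L * min (v 0 t) 0 ≤ v 4 t) : ∀ t ∈ Icc 0 T, 0 ≤ v 0 t := by
  by_contra! hneg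
  obtain ⟨s, hs, hsn⟩ := hneg
  -- Any K > 0 with K⁴ > L would do. With m < 0 the minimum of v e^{-Kt}, four integrations of v''''
  -- ≥ L m e^{Kt} give m ≥ (L / K⁴) m at the minimum point, which is impossible.
  set K := L + 1 with hKdef
  have hK : 0 < K := by linarith
  obtain ⟨t₁, ht₁, hmin⟩ := isCompact_Icc.exists_isMinOn ⟨s, hs⟩
    (f := fun t => v 0 t * Real.exp (-(K * t)))
    ((h.continuousOn (by norm_num)).mul (by fun_prop))
  set m := v 0 t₁ * Real.exp (-(K * t₁)) with hm
  have hmn : m < 0 := lt_of_le_of_lt (hmin hs) (mul_neg_of_neg_of_pos hsn (Real.exp_pos _))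
  have hlow : ∀ t ∈ Icc 0 T, m * Real.exp (K * t) ≤ v 0 t := by
    intro t ht
    have := mul_le_mul_of_nonneg_right (hmin ht) (Real.exp_pos (K * t)).le
    rwa [mul_assoc (v 0 t), ← Real.exp_add, neg_add_cancel, Real.exp_zero, mul_one] at this
  have b4 : ∀ t ∈ Icc 0 T, L * m * Real.exp (K * t) ≤ v 4 t := by
    intro t ht
    refine le_trans ?_ (h4 t ht)
    rw [mul_assoc]
    exact mul_le_mul_of_nonneg_left (le_min (hlow t ht)
      (mul_nonpos_of_nonpos_of_nonneg hmn.le (Real.exp_pos _).le)) hL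
  have hc4 : L * m ≤ 0 := mul_nonpos_of_nonneg_of_nonpos hL hmn.le
  have b3 := exp_lower_bound hK hc4 (h 3 (by norm_num)) (h0 3 (by norm_num)) b4
  have hc3 : L * m / K ≤ 0 := div_nonpos_of_nonpos_of_nonneg hc4 hK.le
  have b2 := exp_lower_bound hK hc3 (h 2 (by norm_num)) (h0 2 (by norm_num)) b3
  have hc2 : L * m / K / K ≤ 0 := div_nonpos_of_nonpos_of_nonneg hc3 hK.le
  have b1 := exp_lower_bound hK hc2 (h 1 (by norm_num)) (h0 1 (by norm_num)) b2
  have hc1 : L * m / K / K / K ≤ 0 := div_nonpos_of_nonpos_of_nonneg hc2 hK.le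
  have b0 := exp_lower_bound hK hc1 (h 0 (by norm_num)) (h0 0 (by norm_num)) b1 t₁ ht₁
  have hv : v 0 t₁ = m * Real.exp (K * t₁) := by
    rw [hm, mul_assoc, ← Real.exp_add]; simp
  rw [hv] at b0
  have h5 := le_of_mul_le_mul_right b0 (Real.exp_pos _)
  have h6 : L * m / K / K / K / K = (L / K ^ 4) * m := by field_simp
  rw [h6] at h5
  have h7 : L / K ^ 4 < 1 := by
    rw [div_lt_one (by positivity)]
    have : K ^ 1 ≤ K ^ 4 := pow_le_pow_right₀ (by linarith) (by norm_num)
    rw [pow_one] at this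
    linarith
  nlinarith

end DerivChain

/-! ### Profiles: uniqueness for ordered data -/

/-- One side of a clamped solution of `v'''' = f v`, followed from its maximum `p` at `t = 0` to the
clamped end `t = T`. -/
structure IsProfile (f : ℝ → ℝ) (p T : ℝ) (v : ℕ → ℝ → ℝ) : Prop where
  T_pos : 0 < T
  p_pos : 0 < p
  chain : DerivChain 0 T v
  init : v 0 0 = p
  init' : v 1 0 = 0
  fin : v 0 T = 0
  fin' : v 1 T = 0
  nonneg : ∀ t ∈ Icc 0 T, 0 ≤ v 0 t
  le : ∀ t ∈ Icc 0 T, v 0 t ≤ p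
  eqn : ∀ t ∈ Icc 0 T, v 4 t = f (v 0 t)

namespace IsProfile

variable {f : ℝ → ℝ} {p T T₁ T₂ L : ℝ} {v w : ℕ → ℝ → ℝ}

/-- As v''' increases, v'''(T) ≤ 0 would make v''' ≤ 0 throughout. Then v' is concave with zero end
values, hence nonnegative, and v could not fall from p to 0. -/
theorem third_deriv_pos (h : IsProfile f p T v) (hf : ∀ x ∈ Icc 0 p, 0 < f x) : 0 < v 3 T := by
  have h4 : ∀ t ∈ Icc 0 T, 0 ≤ v 4 t := fun t ht => by
    rw [h.eqn t ht]; exact (hf _ ⟨h.nonneg t ht, h.le t ht⟩).le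
  have m3 := h.chain.monotoneOn (i := 3) (by norm_num) h4
  by_contra! hc
  have e3 : ∀ t ∈ Icc 0 T, v 3 t ≤ 0 := fun t ht =>
    (m3 ht (right_mem_Icc.2 h.T_pos.le) ht.2).trans hc
  have e1 := nonpos_of_second_deriv_nonneg (h.chain.neg 1 (by norm_num)) (h.chain.neg 2 (by norm_num))
    (fun t ht => neg_nonneg.2 (e3 t ht)) (by simp [h.init']) (by simp [h.fin'])
  have m0 := h.chain.monotoneOn (i := 0) (by norm_num) (fun t ht => neg_nonpos.1 (e1 t ht))
  have := m0 (left_mem_Icc.2 h.T_pos.le) (right_mem_Icc.2 h.T_pos.le) h.T_pos.le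
  rw [h.init, h.fin] at this
  exact absurd h.p_pos (not_lt.2 this)

/-- With a double zero at T, v'' < 0 near T would force v ≤ 0 there. Since v ≥ 0, v would vanish
near T, and v'' with it. -/
theorem second_deriv_nonneg (h : IsProfile f p T v) : 0 ≤ v 2 T := by
  by_contra! hc
  have hT := right_mem_Icc.2 h.T_pos.le
  have hcont := h.chain.continuousOn (i := 2) (by norm_num) T hT
  obtain ⟨δ, hδ, hb⟩ := Metric.mem_nhdsWithin_iff.1 (hcont.eventually_lt continuousWithinAt_const hc)
  set a := max 0 (T - δ / 2) with ha
  have ha0 : 0 ≤ a := le_max_left _ _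
  have haT : a < T := max_lt h.T_pos (by linarith)
  have hsub : ∀ t ∈ Icc a T, v 2 t < 0 := fun t ht => by
    refine hb ⟨?_, ha0.trans ht.1, ht.2⟩
    have := (le_max_right 0 (T - δ / 2)).trans ht.1
    rw [Metric.mem_ball, Real.dist_eq, abs_lt]
    constructor <;> linarith [ht.2]
  have ch := h.chain.mono ha0 le_rfl
  have m1 := ch.antitoneOn (i := 1) (by norm_num) (fun t ht => (hsub t ht).le)
  have e1 : ∀ t ∈ Icc a T, 0 ≤ v 1 t := fun t ht => by
    simpa [h.fin'] using m1 ht (right_mem_Icc.2 haT.le) ht.2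
  have m0 := ch.monotoneOn (i := 0) (by norm_num) e1
  have c0 : ∀ t ∈ Icc a T, v 0 t = 0 := fun t ht => le_antisymm
    (by simpa [h.fin] using m0 ht (right_mem_Icc.2 haT.le) ht.2) (h.nonneg t ⟨ha0.trans ht.1, ht.2⟩)
  have c1 := ch.eq_zero_of_const haT (i := 0) (by norm_num) c0
  have c2 := ch.eq_zero_of_const haT (i := 1) (by norm_num) c1
  exact hc.ne (c2 T (right_mem_Icc.2 haT.le))

/-- Solutions on a common interval with ordered data remain ordered. -/
theorem sub_nonneg (hv : IsProfile f p T₁ v) (hw : IsProfile f p T₂ w)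
    (hmono : MonotoneOn f (Icc 0 p)) (hL : 0 ≤ L)
    (hlip : ∀ x ∈ Icc 0 p, ∀ y ∈ Icc 0 p, x ≤ y → f y - f x ≤ L * (y - x))
    (h2 : w 2 0 ≤ v 2 0) (h3 : w 3 0 ≤ v 3 0) {T : ℝ} (hT₁ : T ≤ T₁) (hT₂ : T ≤ T₂) :
    ∀ t ∈ Icc 0 T, 0 ≤ v 0 t - w 0 t ∧ 0 ≤ v 4 t - w 4 t := by
  have ch := (hv.chain.mono le_rfl hT₁).sub (hw.chain.mono le_rfl hT₂)
  have mv : ∀ t ∈ Icc 0 T, v 0 t ∈ Icc 0 p ∧ v 4 t = f (v 0 t) := fun t ht =>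
    have ht' : t ∈ Icc 0 T₁ := ⟨ht.1, ht.2.trans hT₁⟩
    ⟨⟨hv.nonneg t ht', hv.le t ht'⟩, hv.eqn t ht'⟩
  have mw : ∀ t ∈ Icc 0 T, w 0 t ∈ Icc 0 p ∧ w 4 t = f (w 0 t) := fun t ht =>
    have ht' : t ∈ Icc 0 T₂ := ⟨ht.1, ht.2.trans hT₂⟩
    ⟨⟨hw.nonneg t ht', hw.le t ht'⟩, hw.eqn t ht'⟩
  have e0 := ch.ivp_nonneg hL (by
      intro i hi
      interval_cases i
      · simp [hv.init, hw.init]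
      · simp [hv.init', hw.init']
      · simpa using h2
      · simpa using h3) (by
      intro t ht
      rw [(mv t ht).2, (mw t ht).2]
      -- Monotonicity of f settles the points where v ≥ w; the Lipschitz bound is needed only where
      -- v < w.
      rcases le_total (v 0 t) (w 0 t) with hc | hc
      · have := hlip _ (mv t ht).1 _ (mw t ht).1 hc
        rw [min_eq_left (by linarith)]
        linarith
      · have := hmono (mw t ht).1 (mv t ht).1 hc
        rw [min_eq_right (by linarith)]
        linarith)
  intro t ht
  refine ⟨e0 t ht, ?_⟩
  rw [(mv t ht).2, (mw t ht).2]
  have := hmono (mw t ht).1 (mv t ht).1 (by linarith [e0 t ht])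
  linarith

/-- Two profiles with the same maximum have the same data if the data are ordered. -/
theorem data_eq_of_le (hv : IsProfile f p T₁ v) (hw : IsProfile f p T₂ w)
    (hf : ∀ x ∈ Icc 0 p, 0 < f x)
    (hmono : MonotoneOn f (Icc 0 p)) (hL : 0 ≤ L)
    (hlip : ∀ x ∈ Icc 0 p, ∀ y ∈ Icc 0 p, x ≤ y → f y - f x ≤ L * (y - x))
    (h2 : w 2 0 ≤ v 2 0) (h3 : w 3 0 ≤ v 3 0) : w 2 0 = v 2 0 ∧ w 3 0 = v 3 0 := by
  by_contra hne
  set T := min T₁ T₂ with hT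
  have hT0 : 0 < T := lt_min hv.T_pos hw.T_pos
  have h0 := hv.sub_nonneg hw hmono hL hlip h2 h3 (min_le_left T₁ T₂) (min_le_right T₁ T₂)
  have ch := (hv.chain.mono le_rfl (min_le_left T₁ T₂)).sub
    (hw.chain.mono le_rfl (min_le_right T₁ T₂))
  have e4 : ∀ t ∈ Icc 0 T, 0 ≤ v 4 t - w 4 t := fun t ht => (h0 t ht).2
  have hg := ch.growth hT0 e4 (by simp [hv.init', hw.init'])
    (by simpa using h2) (by simpa using h3) (by
      by_contra! hc
      exact hne ⟨(sub_eq_zero.1 hc.2.1).symm, (sub_eq_zero.1 hc.2.2).symm⟩)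
  have hn := ch.nonneg e4 (by simp [hv.init', hw.init'])
    (by simpa using h2) (by simpa using h3) T (right_mem_Icc.2 hT0.le)
  simp only [hv.init, hw.init, sub_self] at hg
  -- By growth, v > w and v' > w' at the first clamped end. If v ends first, 0 = v > w ≥ 0. If w
  -- ends first, v leaves that point with v' > 0, v'' ≥ 0 and v''' > 0, so it keeps growing and
  -- cannot be clamped at T₁.
  rcases le_or_gt T₁ T₂ with hc | hc
  · have hTe : T = T₁ := min_eq_left hc
    rw [← hT, hTe] at hg
    have := hw.nonneg T₁ ⟨hv.T_pos.le, hc⟩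
    rw [hv.fin] at hg
    linarith [hg.1]
  · have hTe : T = T₂ := min_eq_right hc.le
    rw [← hT] at hg
    rw [hTe] at hg hn
    have chv := hv.chain.mono (a' := T₂) hw.T_pos.le le_rfl
    have := chv.growth hc (fun t ht => by
      have ht' : t ∈ Icc 0 T₁ := ⟨hw.T_pos.le.trans ht.1, ht.2⟩
      rw [hv.eqn t ht']
      exact (hf _ ⟨hv.nonneg t ht', hv.le t ht'⟩).le)
      (by linarith [hg.2, hw.fin']) (by linarith [hn.2.1, hw.second_deriv_nonneg])
      (by linarith [hn.2.2, hw.third_deriv_pos hf]) (Or.inl (by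
        have := hg.2
        rw [hw.fin'] at this
        linarith))
    linarith [this.2, hv.fin']

theorem deriv_eq_of_eq (hv : IsProfile f p T₁ v) (hw : IsProfile f p T₂ w) {T : ℝ} (hT : 0 < T)
    (hT₁ : T ≤ T₁) (hT₂ : T ≤ T₂) (h : ∀ t ∈ Icc 0 T, v 0 t = w 0 t) {i : ℕ} (hi : i ≤ 4) :
    ∀ t ∈ Icc 0 T, v i t = w i t := by
  have ch := (hv.chain.mono le_rfl hT₁).sub (hw.chain.mono le_rfl hT₂)
  have c0 : ∀ t ∈ Icc 0 T, v 0 t - w 0 t = 0 := fun t ht => sub_eq_zero.2 (h t ht)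
  have c1 := ch.eq_zero_of_const hT (i := 0) (by norm_num) c0
  have c2 := ch.eq_zero_of_const hT (i := 1) (by norm_num) c1
  have c3 := ch.eq_zero_of_const hT (i := 2) (by norm_num) c2
  have c4 := ch.eq_zero_of_const hT (i := 3) (by norm_num) c3
  intro t ht
  interval_cases i
  exacts [h t ht, sub_eq_zero.1 (c1 t ht), sub_eq_zero.1 (c2 t ht), sub_eq_zero.1 (c3 t ht),
    sub_eq_zero.1 (c4 t ht)]

/-- A longer profile would continue past the clamped end T₁ with v''' > 0 and nonnegative lower
derivatives, so its slope would be positive ever after. -/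
theorem length_le (hv : IsProfile f p T₁ v) (hw : IsProfile f p T₂ w)
    (hf : ∀ x ∈ Icc 0 p, 0 < f x) (h : ∀ t ∈ Icc 0 (min T₁ T₂), v 0 t = w 0 t) : T₂ ≤ T₁ := by
  by_contra! hc
  rw [min_eq_left hc.le] at h
  have hT := right_mem_Icc.2 hv.T_pos.le
  have e := fun i (hi : i ≤ 4) => hv.deriv_eq_of_eq hw hv.T_pos le_rfl hc.le h hi T₁ hT
  have chw := hw.chain.mono (a' := T₁) hv.T_pos.le le_rfl
  have := chw.growth hc (fun t ht => by
      have ht' : t ∈ Icc 0 T₂ := ⟨hv.T_pos.le.trans ht.1, ht.2⟩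
      rw [hw.eqn t ht']
      exact (hf _ ⟨hw.nonneg t ht', hw.le t ht'⟩).le)
      (by rw [← e 1 (by norm_num), hv.fin']) (by rw [← e 2 (by norm_num)]; exact hv.second_deriv_nonneg)
      (by rw [← e 3 (by norm_num)]; exact (hv.third_deriv_pos hf).le)
      (Or.inr (Or.inr (by rw [← e 3 (by norm_num)]; exact (hv.third_deriv_pos hf).ne')))
  linarith [this.2, hw.fin']

/-- Profiles with the same maximum and comparable data coincide. -/
theorem unique (hv : IsProfile f p T₁ v) (hw : IsProfile f p T₂ w)
    (hf : ∀ x ∈ Icc 0 p, 0 < f x)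
    (hmono : MonotoneOn f (Icc 0 p)) (hL : 0 ≤ L)
    (hlip : ∀ x ∈ Icc 0 p, ∀ y ∈ Icc 0 p, x ≤ y → f y - f x ≤ L * (y - x))
    (h2 : w 2 0 ≤ v 2 0) (h3 : w 3 0 ≤ v 3 0) :
    T₁ = T₂ ∧ ∀ t ∈ Icc 0 T₁, ∀ i ≤ 4, v i t = w i t := by
  obtain ⟨e2, e3⟩ := hv.data_eq_of_le hw hf hmono hL hlip h2 h3
  have a1 := hv.sub_nonneg hw hmono hL hlip e2.le e3.le (min_le_left T₁ T₂) (min_le_right T₁ T₂)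
  have a2 := hw.sub_nonneg hv hmono hL hlip e2.ge e3.ge (min_le_right T₁ T₂) (min_le_left T₁ T₂)
  have e : ∀ t ∈ Icc 0 (min T₁ T₂), v 0 t = w 0 t := fun t ht => by
    linarith [(a1 t ht).1, (a2 t ht).1]
  have hT : T₁ = T₂ := le_antisymm
    (hw.length_le hv hf fun t ht => (e t (by rwa [min_comm])).symm) (hv.length_le hw hf e)
  subst hT
  rw [min_self] at e
  exact ⟨rfl, fun t ht i hi => hv.deriv_eq_of_eq hw hv.T_pos le_rfl le_rfl e hi t ht⟩

end IsProfile

/-! ### Scaling the parameter away, and symmetry -/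

namespace IsProfile

variable {f : ℝ → ℝ} {p T T₁ T₂ L lam : ℝ} {v w : ℕ → ℝ → ℝ}

/-- The fourth derivative scales by c⁴, so c⁴ λ = 1 trades the parameter for a variable length T /
c; comparing lengths recovers λ. -/
theorem rescale {c : ℝ} (hc : 0 < c) (hlam : c ^ 4 * lam = 1)
    (h : IsProfile (fun x => lam * f x) p T v) :
    IsProfile f p (T / c) (fun i t => c ^ i * v i (0 + c * t)) := by
  have hm : ∀ t ∈ Icc 0 (T / c), 0 + c * t ∈ Icc 0 T := fun t ht => by
    rw [zero_add]
    refine ⟨mul_nonneg hc.le ht.1, ?_⟩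
    have := (le_div_iff₀ hc).1 ht.2
    linarith
  have hT : 0 + c * (T / c) = T := by field_simp; ring
  exact
  { T_pos := div_pos h.T_pos hc
    p_pos := h.p_pos
    chain := h.chain.affine hm
    init := by simp [h.init]
    init' := by simp [h.init']
    fin := by rw [hT]; simp [h.fin]
    fin' := by rw [hT]; simp [h.fin']
    nonneg := fun t ht => by simpa using h.nonneg _ (hm t ht)
    le := fun t ht => by simpa using h.le _ (hm t ht)
    eqn := fun t ht => by
      rw [h.eqn _ (hm t ht), ← mul_assoc, hlam]
      simp }

/-- Profiles of `v'''' = lam * f v` on `[0, T]` are determined by their maximum. -/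
theorem unique_of_scaled {lam₁ lam₂ : ℝ} (hl₁ : 0 < lam₁) (hl₂ : 0 < lam₂)
    (hv : IsProfile (fun x => lam₁ * f x) p T v) (hw : IsProfile (fun x => lam₂ * f x) p T w)
    (hf : ∀ x ∈ Icc 0 p, 0 < f x) (hmono : MonotoneOn f (Icc 0 p)) (hL : 0 ≤ L)
    (hlip : ∀ x ∈ Icc 0 p, ∀ y ∈ Icc 0 p, x ≤ y → f y - f x ≤ L * (y - x))
    (hv3 : v 3 0 = 0) (hw3 : w 3 0 = 0) :
    lam₁ = lam₂ ∧ ∀ t ∈ Icc 0 T, v 0 t = w 0 t := by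
  have ex : ∀ l : ℝ, 0 < l → ∃ c : ℝ, 0 < c ∧ c ^ 4 * l = 1 := fun l hl => by
    refine ⟨(l⁻¹) ^ ((1 : ℝ) / 4), by positivity, ?_⟩
    rw [← Real.rpow_natCast, ← Real.rpow_mul (by positivity)]
    norm_num
    exact inv_mul_cancel₀ hl.ne'
  obtain ⟨c₁, hc₁, e₁⟩ := ex lam₁ hl₁
  obtain ⟨c₂, hc₂, e₂⟩ := ex lam₂ hl₂
  have h1 := hv.rescale hc₁ e₁
  have h2 := hw.rescale hc₂ e₂
  -- The third derivatives vanish at 0, so the second derivative is the only free datum and the data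
  -- are always comparable.
  have key : T / c₁ = T / c₂ ∧ ∀ t ∈ Icc 0 (T / c₁), v 0 (c₁ * t) = w 0 (c₂ * t) := by
    rcases le_total (c₂ ^ 2 * w 2 0) (c₁ ^ 2 * v 2 0) with hc | hc
    · obtain ⟨hT, he⟩ := h1.unique h2 hf hmono hL hlip (by simpa using hc) (by simp [hv3, hw3])
      exact ⟨hT, fun t ht => by simpa using he t ht 0 (by norm_num)⟩
    · obtain ⟨hT, he⟩ := h2.unique h1 hf hmono hL hlip (by simpa using hc) (by simp [hv3, hw3])
      refine ⟨hT.symm, fun t ht => ?_⟩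
      rw [← hT] at ht
      simpa using (he t ht 0 (by norm_num)).symm
  have hc : c₁ = c₂ := by
    have h3 := key.1
    have := hv.T_pos
    field_simp at h3
    exact h3.symm
  subst hc
  refine ⟨mul_left_cancel₀ (pow_pos hc₁ 4).ne' (e₁.trans e₂.symm), fun t ht => ?_⟩
  have := key.2 (t / c₁) ⟨div_nonneg ht.1 hc₁.le, by gcongr; exact ht.2⟩
  rwa [mul_div_cancel₀ t hc₁.ne'] at this

end IsProfile

/-- A clamped nonnegative nontrivial solution on `[0,1]` is symmetric and attains its maximum at
`1/2`; its right half is a profile. -/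
theorem clamped_solution_symmetric {f : ℝ → ℝ} {r : ℝ} {v : ℕ → ℝ → ℝ}
    (hf : ∀ x ∈ Ico 0 r, 0 < f x) (hmono : MonotoneOn f (Ico 0 r))
    (hlip : ∀ p < r, ∃ L, 0 ≤ L ∧ ∀ x ∈ Icc 0 p, ∀ y ∈ Icc 0 p, x ≤ y → f y - f x ≤ L * (y - x))
    (hch : DerivChain 0 1 v) (hnn : ∀ t ∈ Icc 0 1, 0 ≤ v 0 t) (hlt : ∀ t ∈ Icc 0 1, v 0 t < r)
    (hne : ∃ t ∈ Icc (0 : ℝ) 1, v 0 t ≠ 0) (heq : ∀ t ∈ Icc 0 1, v 4 t = f (v 0 t))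
    (hl : v 0 0 = 0) (hr : v 0 1 = 0) (hl' : v 1 0 = 0) (hr' : v 1 1 = 0) :
    IsProfile f (v 0 (1 / 2)) (1 / 2) (fun i t => v i (1 / 2 + t)) ∧ v 3 (1 / 2) = 0 ∧
      ∀ t ∈ Icc (0 : ℝ) 1, v 0 (1 - t) = v 0 t := by
  obtain ⟨x, hx, hmax⟩ := isCompact_Icc.exists_isMaxOn (nonempty_Icc.2 zero_le_one)
    (hch.continuousOn (i := 0) (by norm_num))
  obtain ⟨s, hs, hsn⟩ := hne
  have hp : 0 < v 0 x := lt_of_lt_of_le (lt_of_le_of_ne (hnn s hs) hsn.symm) (hmax hs)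
  have hx0 : 0 < x := lt_of_le_of_ne hx.1 (by rintro rfl; linarith)
  have hx1 : x < 1 := lt_of_le_of_ne hx.2 (by rintro rfl; linarith)
  have hx1' : v 1 x = 0 := by
    have hn : Icc (0 : ℝ) 1 ∈ nhds x := Icc_mem_nhds hx0 hx1
    exact (hmax.isLocalMax hn).hasDerivAt_eq_zero ((hch 0 (by norm_num) x hx).hasDerivAt hn)
  have hpr : v 0 x < r := hlt x hx
  have hsub : Icc 0 (v 0 x) ⊆ Ico 0 r := fun y hy => ⟨hy.1, hy.2.trans_lt hpr⟩
  have mR : ∀ t ∈ Icc 0 (1 - x), x + 1 * t ∈ Icc (0 : ℝ) 1 := fun t ht =>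
    ⟨by linarith [ht.1], by linarith [ht.2]⟩
  have mL : ∀ t ∈ Icc 0 x, x + -1 * t ∈ Icc (0 : ℝ) 1 := fun t ht =>
    ⟨by linarith [ht.2], by linarith [ht.1]⟩
  have hR : IsProfile f (v 0 x) (1 - x) (fun i t => 1 ^ i * v i (x + 1 * t)) :=
  { T_pos := by linarith
    p_pos := hp
    chain := hch.affine mR
    init := by simp
    init' := by simp [hx1']
    fin := by simp [hr]
    fin' := by simp [hr']
    nonneg := fun t ht => by simpa using hnn _ (mR t ht)
    le := fun t ht => by simpa using hmax (mR t ht)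
    eqn := fun t ht => by simpa using heq _ (mR t ht) }
  have hL : IsProfile f (v 0 x) x (fun i t => (-1) ^ i * v i (x + -1 * t)) :=
  { T_pos := hx0
    p_pos := hp
    chain := hch.affine mL
    init := by simp
    init' := by simp [hx1']
    fin := by simp [hl]
    fin' := by simp [hl']
    nonneg := fun t ht => by simpa using hnn _ (mL t ht)
    le := fun t ht => by simpa using hmax (mL t ht)
    eqn := fun t ht => by
      have := heq _ (mL t ht)
      simp only [pow_zero, one_mul, this]
      norm_num }
  obtain ⟨L, hL0, hL1⟩ := hlip _ hpr
  -- Both halves start with the same second derivative and with opposite third derivatives, so one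
  -- set of data dominates the other, according to the sign of v'''(x).
  have key : 1 - x = x ∧ ∀ t ∈ Icc 0 x, ∀ i ≤ 4, v i (x + t) = (-1) ^ i * v i (x - t) := by
    rcases le_total 0 (v 3 x) with hc | hc
    · obtain ⟨hT, he⟩ := hR.unique hL (fun y hy => hf y (hsub hy)) (hmono.mono hsub) hL0 hL1
        (by simp) (by norm_num; linarith)
      refine ⟨hT, fun t ht i hi => ?_⟩
      rw [hT] at he
      simpa [sub_eq_add_neg] using he t ht i hi
    · obtain ⟨hT, he⟩ := hL.unique hR (fun y hy => hf y (hsub hy)) (hmono.mono hsub) hL0 hL1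
        (by simp) (by norm_num; linarith)
      refine ⟨hT.symm, fun t ht i hi => ?_⟩
      simpa [sub_eq_add_neg] using (he t ht i hi).symm
  have hxh : x = 1 / 2 := by linarith [key.1]
  subst hxh
  refine ⟨?_, ?_, ?_⟩
  · convert hR using 3
    · norm_num
    · ring_nf
  · have := key.2 0 (by norm_num) 3 (by norm_num)
    norm_num at this
    norm_num
    linarith
  · intro t ht
    rcases le_total t (1 / 2) with hc | hc
    · have := key.2 (1 / 2 - t) ⟨by linarith, by linarith [ht.1]⟩ 0 (by norm_num)
      rw [pow_zero, one_mul] at this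
      convert this using 2 <;> ring
    · have := key.2 (t - 1 / 2) ⟨by linarith, by linarith [ht.2]⟩ 0 (by norm_num)
      rw [pow_zero, one_mul] at this
      rw [show 1 - t = 1 / 2 - (t - 1 / 2) by ring, ← this]
      congr 1
      ring

/-! ### Elements of C^k[0,1] as functions on the line -/

/-- The derivatives of `u ∈ C^k[0,1]` as functions on the line. -/
noncomputable def CkFun.fn {k : ℕ} (u : CkFun k) (i : ℕ) : ℝ → ℝ :=
  IccExtend zero_le_one (u.der (Fin.ofNat (k + 1) i))

namespace CkFun

variable {k : ℕ}

theorem fn_coe (u : CkFun k) (i : Fin (k + 1)) (x : unitInterval) : u.fn i x = u.der i x := by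
  have : Fin.ofNat (k + 1) (i : ℕ) = i := by ext; simp
  rw [fn, this]
  exact IccExtend_val _ _ _

theorem hasDerivWithinAt_fn (u : CkFun k) {i : ℕ} (hi : i < k) {x : ℝ} (hx : x ∈ Icc (0 : ℝ) 1) :
    HasDerivWithinAt (u.fn i) (u.fn (i + 1) x) (Icc 0 1) x := by
  have h := u.2 ⟨i, hi⟩ ⟨x, hx⟩
  have e1 : Fin.ofNat (k + 1) i = (⟨i, hi⟩ : Fin k).castSucc := by
    ext; simp [Nat.mod_eq_of_lt (hi.trans (Nat.lt_succ_self k))]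
  have e2 : Fin.ofNat (k + 1) (i + 1) = (⟨i, hi⟩ : Fin k).succ := by
    ext; simp [Nat.mod_eq_of_lt (Nat.succ_lt_succ hi)]
  have e3 : u.fn (i + 1) x = u.1 (⟨i, hi⟩ : Fin k).succ ⟨x, hx⟩ := by
    rw [fn, e2, IccExtend_of_mem _ _ hx]; rfl
  rw [e3, fn, e1]
  exact h

theorem derivChain (u : CkFun 4) : DerivChain 0 1 u.fn := fun _ hi _ ht =>
  u.hasDerivWithinAt_fn hi ht

theorem ext_der_zero {u v : CkFun k} (h : ∀ x, u.der 0 x = v.der 0 x) : u = v := by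
  have key : ∀ i : ℕ, ∀ hi : i < k + 1, u.der ⟨i, hi⟩ = v.der ⟨i, hi⟩ := by
    intro i
    induction i with
    | zero => exact fun _ => ContinuousMap.ext h
    | succ i ih =>
      intro hi
      ext x
      have h1 := u.2 ⟨i, by omega⟩ x
      have h2 := v.2 ⟨i, by omega⟩ x
      have h3 : u.1 (Fin.castSucc ⟨i, by omega⟩) = v.1 (Fin.castSucc ⟨i, by omega⟩) :=
        ih (by omega)
      rw [h3] at h1
      have hu := uniqueDiffOn_Icc (zero_lt_one' ℝ) x x.2
      exact (h1.derivWithin hu).symm.trans (h2.derivWithin hu)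
  exact Subtype.ext (funext fun j => key j j.2)

end CkFun

/-! ### Convex nonlinearities: ordering, and no three solutions -/

/-- The hypotheses on the nonlinearity that are used on `[0, r)`; `f'` is its derivative. -/
structure IsConvexSource (r : ℝ) (f f' : ℝ → ℝ) : Prop where
  pos : ∀ x ∈ Ico 0 r, 0 < f x
  strictMonoOn : StrictMonoOn f (Ico 0 r)
  strictConvexOn : StrictConvexOn ℝ (Ico 0 r) f
  hasDeriv : ∀ x ∈ Ico 0 r, HasDerivWithinAt f (f' x) (Ico 0 r) x
  deriv_nonneg : ∀ x ∈ Ico 0 r, 0 ≤ f' x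
  lipschitz : ∀ p < r, ∃ L, 0 ≤ L ∧
    ∀ x ∈ Icc 0 p, ∀ y ∈ Icc 0 p, x ≤ y → f y - f x ≤ L * (y - x)

namespace IsConvexSource

variable {r : ℝ} {f f' : ℝ → ℝ}

theorem const_mul (h : IsConvexSource r f f') {c : ℝ} (hc : 0 < c) :
    IsConvexSource r (fun x => c * f x) (fun x => c * f' x) where
  pos x hx := mul_pos hc (h.pos x hx)
  strictMonoOn x hx y hy hxy := mul_lt_mul_of_pos_left (h.strictMonoOn hx hy hxy) hc
  strictConvexOn := by
    refine ⟨h.strictConvexOn.1, fun x hx y hy hxy a b ha hb hab => ?_⟩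
    have := mul_lt_mul_of_pos_left (h.strictConvexOn.2 hx hy hxy ha hb hab) hc
    simp only [smul_eq_mul] at this ⊢
    linarith
  hasDeriv x hx := (h.hasDeriv x hx).const_mul c
  deriv_nonneg x hx := mul_nonneg hc.le (h.deriv_nonneg x hx)
  lipschitz p hp := by
    obtain ⟨L, hL, h1⟩ := h.lipschitz p hp
    refine ⟨c * L, mul_nonneg hc.le hL, fun x hx y hy hxy => ?_⟩
    have := mul_le_mul_of_nonneg_left (h1 x hx y hy hxy) hc.le
    linarith

theorem sub_le_deriv_mul (h : IsConvexSource r f f') {x y : ℝ} (hx : x ∈ Ico 0 r) (hy : y ∈ Ico 0 r)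
    (hxy : x < y) : f y - f x ≤ f' y * (y - x) := by
  have hd : HasDerivAt f (f' y) y :=
    (h.hasDeriv y hy).hasDerivAt (Ico_mem_nhds (hx.1.trans_lt hxy) hy.2)
  have := h.strictConvexOn.convexOn.slope_le_of_hasDerivAt hx hy hxy hd
  rwa [slope_def_field, div_le_iff₀ (by linarith)] at this

/-- Monotonicity of slopes with the denominators cleared, so that coinciding points are allowed.
This is the sign of the integrand in `IsProfile.not_three`. -/
theorem cross_le (h : IsConvexSource r f f') {x y z : ℝ} (hx : x ∈ Ico 0 r) (hz : z ∈ Ico 0 r)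
    (hxy : x ≤ y) (hyz : y ≤ z) : (f y - f x) * (z - y) ≤ (y - x) * (f z - f y) := by
  rcases hxy.eq_or_lt with rfl | h1
  · simp
  rcases hyz.eq_or_lt with rfl | h2
  · simp
  have := h.strictConvexOn.convexOn.slope_mono_adjacent hx hz h1 h2
  rw [div_le_div_iff₀ (by linarith) (by linarith)] at this
  linarith

theorem cross_lt (h : IsConvexSource r f f') {x y z : ℝ} (hx : x ∈ Ico 0 r) (hz : z ∈ Ico 0 r)
    (hxy : x < y) (hyz : y < z) : (f y - f x) * (z - y) < (y - x) * (f z - f y) := by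
  have := h.strictConvexOn.slope_strict_mono_adjacent hx hz hxy hyz
  rw [div_lt_div_iff₀ (by linarith) (by linarith)] at this
  linarith

end IsConvexSource

/-- `h ≥ 0` with `h'''' ≥ 0` cannot touch zero inside if it starts positive and nondecreasing and
arrives at zero with negative slope. -/
theorem DerivChain.not_touching {T m : ℝ} {h : ℕ → ℝ → ℝ} (ch : DerivChain 0 T h)
    (h4 : ∀ t ∈ Icc 0 T, 0 ≤ h 4 t) (h0 : ∀ t ∈ Icc 0 T, 0 ≤ h 0 t) (hm0 : 0 < m) (hmT : m < T)
    (hm : h 0 m = 0) (hi : 0 < h 0 0) (hi' : 0 ≤ h 1 0) (hT' : h 1 T < 0) : False := by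
  have hmI : m ∈ Icc 0 T := ⟨hm0.le, hmT.le⟩
  have hm1 : h 1 m = 0 := by
    have hn : Icc 0 T ∈ nhds m := Icc_mem_nhds hm0 hmT
    have hmin : IsMinOn (h 0) (Icc 0 T) m := fun t ht => by
      simp only [mem_ofPred_eq, hm]; exact h0 t ht
    exact (hmin.isLocalMin hn).hasDerivAt_eq_zero ((ch 0 (by norm_num) m hmI).hasDerivAt hn)
  have c1 := ch.mono (a' := 0) le_rfl hmT.le
  -- Since h falls from a positive value to 0 on [0, m] and h' falls from 0 to a negative value on
  -- [m, T], h'' is negative somewhere on either side. As h'' is convex, it is then negative on the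
  -- whole interval [ξ, ζ] around m.
  obtain ⟨ξ, hξ, hξn⟩ : ∃ ξ ∈ Icc 0 m, h 2 ξ < 0 := by
    by_contra! hc
    have e1 : ∀ t ∈ Icc 0 m, 0 ≤ h 1 t := fun t ht =>
      hi'.trans (c1.le_of_nonneg (by norm_num) hc ht)
    have := c1.le_of_nonneg (i := 0) (by norm_num) e1 (right_mem_Icc.2 hm0.le)
    linarith
  have c2 := ch.mono (a' := m) hm0.le le_rfl
  obtain ⟨ζ, hζ, hζn⟩ : ∃ ζ ∈ Icc m T, h 2 ζ < 0 := by
    by_contra! hc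
    have := c2.le_of_nonneg (i := 1) (by norm_num) hc (right_mem_Icc.2 hmT.le)
    linarith
  set ε := -max (h 2 ξ) (h 2 ζ) with hε
  have hεp : 0 < ε := by rw [hε, neg_pos]; exact max_lt hξn hζn
  have c3 := ch.mono hξ.1 hζ.2
  have hneg := nonpos_of_second_deriv_nonneg (a := ξ) (b := ζ) (g := fun t => h 2 t + ε)
    (fun t ht => (c3 2 (by norm_num) t ht).add_const ε) (c3 3 (by norm_num))
    (fun t ht => h4 t ⟨hξ.1.trans ht.1, ht.2.trans hζ.2⟩)
    (by have := le_max_left (h 2 ξ) (h 2 ζ); linarith)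
    (by have := le_max_right (h 2 ξ) (h 2 ζ); linarith)
  -- If ζ = m, continuity still gives h'' < 0 just to the right of m. With h(m) = h'(m) = 0 this
  -- forces h ≤ 0, hence h = 0 there, contradicting h''(m) < 0. The case ζ > m ends in the same way.
  have hmζ : m < ζ := by
    rcases hζ.1.eq_or_lt with rfl | hc
    · exfalso
      obtain ⟨δ, hδ, hb⟩ := Metric.mem_nhdsWithin_iff.1
        ((ch.continuousOn (i := 2) (by norm_num) m hmI).eventually_lt continuousWithinAt_const hζn)
      set s := min T (m + δ / 2) with hs
      have hms : m < s := lt_min hmT (by linarith)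
      have hsT : s ≤ T := min_le_left _ _
      have cs := ch.mono (a' := m) hm0.le hsT
      have e2 : ∀ t ∈ Icc m s, h 2 t ≤ 0 := fun t ht => by
        refine le_of_lt (hb ⟨?_, hm0.le.trans ht.1, ht.2.trans hsT⟩)
        have := ht.2.trans (min_le_right T (m + δ / 2))
        rw [Metric.mem_ball, Real.dist_eq, abs_lt]
        constructor <;> linarith [ht.1]
      have m1 := cs.antitoneOn (i := 1) (by norm_num) e2
      have e1 : ∀ t ∈ Icc m s, h 1 t ≤ 0 := fun t ht => by
        have := m1 (left_mem_Icc.2 hms.le) ht ht.1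
        linarith
      have m0 := cs.antitoneOn (i := 0) (by norm_num) e1
      have z0 : ∀ t ∈ Icc m s, h 0 t = 0 := fun t ht => le_antisymm
        (by have := m0 (left_mem_Icc.2 hms.le) ht ht.1; linarith)
        (h0 t ⟨hm0.le.trans ht.1, ht.2.trans hsT⟩)
      have z1 := cs.eq_zero_of_const hms (i := 0) (by norm_num) z0
      have z2 := cs.eq_zero_of_const hms (i := 1) (by norm_num) z1 m (left_mem_Icc.2 hms.le)
      linarith
    · exact hc
  have cs := ch.mono (a' := m) hm0.le hζ.2
  have e2 : ∀ t ∈ Icc m ζ, h 2 t ≤ -ε := fun t ht => by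
    have := hneg t ⟨hξ.2.trans ht.1, ht.2⟩
    linarith
  have m1 := cs.antitoneOn (i := 1) (by norm_num) (fun t ht => (e2 t ht).trans (by linarith))
  have e1 : ∀ t ∈ Icc m ζ, h 1 t ≤ 0 := fun t ht => by
    have := m1 (left_mem_Icc.2 hmζ.le) ht ht.1
    linarith
  have m0 := cs.antitoneOn (i := 0) (by norm_num) e1
  have z0 : ∀ t ∈ Icc m ζ, h 0 t = 0 := fun t ht => le_antisymm
    (by have := m0 (left_mem_Icc.2 hmζ.le) ht ht.1; linarith)
    (h0 t ⟨hm0.le.trans ht.1, ht.2.trans hζ.2⟩)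
  have z1 := cs.eq_zero_of_const hmζ (i := 0) (by norm_num) z0
  have z2 := cs.eq_zero_of_const hmζ (i := 1) (by norm_num) z1 m (left_mem_Icc.2 hmζ.le)
  have := e2 m (left_mem_Icc.2 hmζ.le)
  linarith

namespace IsProfile

variable {f f' : ℝ → ℝ} {r p p₁ p₂ p₃ T : ℝ} {v w x : ℕ → ℝ → ℝ}

theorem mem_Ico (h : IsProfile f p T v) (hp : p < r) {t : ℝ} (ht : t ∈ Icc 0 T) :
    v 0 t ∈ Ico 0 r := ⟨h.nonneg t ht, (h.le t ht).trans_lt hp⟩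

theorem third_deriv_nonneg (h : IsProfile f p T v) (hf : ∀ x ∈ Icc 0 p, 0 < f x) (h3 : v 3 0 = 0) :
    ∀ t ∈ Icc 0 T, 0 ≤ v 3 t := fun t ht => by
  have := h.chain.le_of_nonneg (i := 3) (by norm_num) (fun s hs => by
    rw [h.eqn s hs]; exact (hf _ ⟨h.nonneg s hs, h.le s hs⟩).le) ht
  linarith

/-- The slope of a symmetric profile is bounded away from zero inside. -/
theorem deriv_le (h : IsProfile f p T v) (hf : ∀ x ∈ Icc 0 p, 0 < f x) (h3 : v 3 0 = 0) :
    ∀ t ∈ Icc 0 T, v 1 t ≤ -(p / T ^ 2 * min t (T - t)) := by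
  have hT := h.T_pos
  have hp := h.p_pos
  have e3 := h.third_deriv_nonneg hf h3
  -- At a mean value point v'(ξ) = -p / T. The convex function v' vanishes at both ends, so it lies
  -- below the two chords to (ξ, -p / T), whose slopes are at least p / T² in absolute value.
  obtain ⟨ξ, hξ, he⟩ := exists_hasDerivAt_eq_slope (v 0) (v 1) hT
    (h.chain.continuousOn (by norm_num)) (fun t ht =>
      (h.chain 0 (by norm_num) t ⟨ht.1.le, ht.2.le⟩).hasDerivAt (Icc_mem_nhds ht.1 ht.2))
  rw [h.fin, h.init, zero_sub, sub_zero] at he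
  intro t ht
  rcases le_total t ξ with hc | hc
  · have c := h.chain.mono (a' := 0) le_rfl hξ.2.le
    have hd : ∀ s ∈ Icc 0 ξ, HasDerivWithinAt (fun s => v 1 s + p / (T * ξ) * s)
        (v 2 s + p / (T * ξ)) (Icc 0 ξ) s := fun s hs => by
      have := (c 1 (by norm_num) s hs).add ((hasDerivWithinAt_id s _).const_mul (p / (T * ξ)))
      rw [mul_one] at this
      exact this
    have := nonpos_of_second_deriv_nonneg hd
      (fun s hs => (c 2 (by norm_num) s hs).add_const _)
      (fun s hs => e3 s ⟨hs.1, hs.2.trans hξ.2.le⟩) (by simp [h.init'])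
      (by rw [he]; have := hξ.1; field_simp; simp) t ⟨ht.1, hc⟩
    have h5 : p / T ^ 2 * min t (T - t) ≤ p / (T * ξ) * t := by
      have h7 : p / T ^ 2 ≤ p / (T * ξ) := by
        apply div_le_div_of_nonneg_left hp.le (mul_pos hT hξ.1)
        nlinarith [hξ.2]
      exact mul_le_mul h7 (min_le_left _ _) (le_min ht.1 (by linarith [ht.2]))
        (div_nonneg hp.le (mul_pos hT hξ.1).le)
    linarith
  · have c := h.chain.mono (a' := ξ) hξ.1.le le_rfl
    have hTξ : 0 < T - ξ := by linarith [hξ.2]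
    have hd : ∀ s ∈ Icc ξ T, HasDerivWithinAt (fun s => v 1 s + p / (T * (T - ξ)) * (T - s))
        (v 2 s + p / (T * (T - ξ)) * (-1)) (Icc ξ T) s := fun s hs => by
      exact (c 1 (by norm_num) s hs).add
        (((hasDerivWithinAt_id s _).const_sub T).const_mul (p / (T * (T - ξ))))
    have := nonpos_of_second_deriv_nonneg hd
      (fun s hs => (c 2 (by norm_num) s hs).add_const _)
      (fun s hs => e3 s ⟨hξ.1.le.trans hs.1, hs.2⟩)
      (by rw [he]; field_simp; simp) (by simp [h.fin']) t ⟨hc, ht.2⟩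
    have h5 : p / T ^ 2 * min t (T - t) ≤ p / (T * (T - ξ)) * (T - t) := by
      have h7 : p / T ^ 2 ≤ p / (T * (T - ξ)) := by
        apply div_le_div_of_nonneg_left hp.le (mul_pos hT hTξ)
        nlinarith [hξ.1]
      exact mul_le_mul h7 (min_le_right _ _) (le_min ht.1 (by linarith [ht.2]))
        (div_nonneg hp.le (mul_pos hT hTξ).le)
    linarith

theorem deriv_nonpos (h : IsProfile f p T v) (hf : ∀ x ∈ Icc 0 p, 0 < f x) (h3 : v 3 0 = 0) :
    ∀ t ∈ Icc 0 T, v 1 t ≤ 0 := fun t ht =>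
  (h.deriv_le hf h3 t ht).trans (neg_nonpos.2 (mul_nonneg
    (div_nonneg h.p_pos.le (sq_nonneg _)) (le_min ht.1 (by linarith [ht.2]))))

theorem second_deriv_pos (h : IsProfile f p T v) (hf : ∀ x ∈ Icc 0 p, 0 < f x) (h3 : v 3 0 = 0) :
    0 < v 2 T := by
  refine lt_of_le_of_ne h.second_deriv_nonneg fun h2 => ?_
  have e3 := h.third_deriv_nonneg hf h3
  have m2 := h.chain.monotoneOn (i := 2) (by norm_num) e3
  have e2 : ∀ t ∈ Icc 0 T, v 2 t ≤ 0 := fun t ht =>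
    (m2 ht (right_mem_Icc.2 h.T_pos.le) ht.2).trans h2.ge
  have m1 := h.chain.antitoneOn (i := 1) (by norm_num) e2
  have hT := h.T_pos
  have h5 : T / 2 ∈ Icc 0 T := ⟨by linarith, by linarith⟩
  have h6 := m1 h5 (right_mem_Icc.2 hT.le) h5.2
  have h7 := h.deriv_le hf h3 _ h5
  have h8 : 0 < p / T ^ 2 * min (T / 2) (T - T / 2) :=
    mul_pos (div_pos h.p_pos (by positivity)) (lt_min (by linarith) (by linarith))
  rw [h.fin'] at h6
  linarith

/-- Symmetric profiles of one equation on one interval are ordered by their maxima. -/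
theorem le_of_max_lt (hf : IsConvexSource r f f') (hv : IsProfile f p₁ T v)
    (hw : IsProfile f p₂ T w) (hv3 : v 3 0 = 0) (h12 : p₁ < p₂)
    (h2 : p₂ < r) : ∀ t ∈ Icc 0 T, v 0 t ≤ w 0 t := by
  by_contra! hneg
  obtain ⟨s, hs, hsn⟩ := hneg
  have h1 : p₁ < r := h12.trans h2
  have hT := hv.T_pos
  have fv : ∀ x ∈ Icc 0 p₁, 0 < f x := fun x hx => hf.pos x ⟨hx.1, hx.2.trans_lt h1⟩
  -- Sliding: q is positive inside and solves the linearized equation q'''' = f'(v) q. If d = w - v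
  -- is negative somewhere, the smallest k with d + k q ≥ 0 makes this function touch 0 inside,
  -- which `DerivChain.not_touching` excludes.
  set q : ℝ → ℝ := fun t => -v 1 t with hq
  set d : ℝ → ℝ := fun t => w 0 t - v 0 t with hd
  have cd := hw.chain.sub hv.chain
  have hqd := hv.deriv_le fv hv3
  have hq0 : ∀ t ∈ Icc 0 T, 0 ≤ q t := fun t ht => neg_nonneg.2 (hv.deriv_nonpos fv hv3 t ht)
  have hqp : ∀ t ∈ Ioo 0 T, 0 < q t := fun t ht => by
    have h5 : 0 < p₁ / T ^ 2 * min t (T - t) :=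
      mul_pos (div_pos hv.p_pos (by positivity)) (lt_min ht.1 (by linarith [ht.2]))
    have := hqd t ⟨ht.1.le, ht.2.le⟩
    simp only [hq]; linarith
  have hs0 : 0 < s := lt_of_le_of_ne hs.1 (by
    rintro rfl; rw [hv.init, hw.init] at hsn; linarith)
  have hsT : s < T := lt_of_le_of_ne hs.2 (by
    rintro rfl; rw [hv.fin, hw.fin] at hsn; linarith)
  set κ := -(d s / q s) with hκ
  have hκp : 0 < κ := by
    rw [hκ, neg_pos]; exact div_neg_of_neg_of_pos (by simp only [hd]; linarith) (hqp s ⟨hs0, hsT⟩)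
  -- near `0`
  have hd0 : 0 < d 0 := by simp only [hd, hw.init, hv.init]; linarith
  have cdc : ContinuousOn d (Icc 0 T) := cd.continuousOn (i := 0) (by norm_num)
  obtain ⟨δ₁, hδ₁, hn1⟩ : ∃ δ > 0, ∀ t ∈ Icc 0 T, t < δ → 0 < d t := by
    obtain ⟨δ, hδ, hb⟩ := Metric.mem_nhdsWithin_iff.1
      (continuousWithinAt_const.eventually_lt (cdc 0 (left_mem_Icc.2 hT.le)) hd0)
    refine ⟨δ, hδ, fun t ht htδ => hb ⟨?_, ht⟩⟩
    rw [Metric.mem_ball, Real.dist_eq, sub_zero, abs_of_nonneg ht.1]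
    exact htδ
  -- near `T`
  obtain ⟨C, hC, hCb⟩ : ∃ C > 0, ∀ t ∈ Icc 0 T, -C * (T - t) ^ 2 ≤ d t := by
    obtain ⟨C, hC⟩ := isCompact_Icc.exists_bound_of_continuousOn
      (cd.continuousOn (i := 2) (by norm_num))
    have hC0 : ∀ t ∈ Icc 0 T, w 2 t - v 2 t ≥ -(|C| + 1) := fun t ht => by
      have := (abs_le.1 ((hC t ht).trans (le_abs_self C))).1
      linarith
    refine ⟨|C| + 1, by positivity, fun t ht => ?_⟩
    have g1 : ∀ t ∈ Icc 0 T, w 1 t - v 1 t ≤ (|C| + 1) * (T - t) := by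
      have hm := monotoneOn_of_hasDerivWithinAt_Icc (a := 0) (b := T)
        (g := fun t => w 1 t - v 1 t - (|C| + 1) * (T - t))
        (g' := fun t => w 2 t - v 2 t - (|C| + 1) * (-1))
        (fun t ht => (cd 1 (by norm_num) t ht).sub
          (((hasDerivWithinAt_id t _).const_sub T).const_mul (|C| + 1)))
        (fun t ht => by have := hC0 t ht; linarith)
      intro t ht
      have := hm ht (right_mem_Icc.2 hT.le) ht.2
      simp only [hw.fin', hv.fin', sub_self, mul_zero] at this
      linarith
    have hm := antitoneOn_of_hasDerivWithinAt_Icc (a := 0) (b := T)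
      (g := fun t => w 0 t - v 0 t + (|C| + 1) * (T - t) ^ 2)
      (g' := fun t => w 1 t - v 1 t + (|C| + 1) * (((2 : ℕ) : ℝ) * (T - t) ^ (2 - 1) * (-1)))
      (fun t ht => (cd 0 (by norm_num) t ht).add
          ((((hasDerivWithinAt_id t _).const_sub T).pow 2).const_mul (|C| + 1)))
      (fun t ht => by
        have := g1 t ht
        have h9 : 0 ≤ (|C| + 1) * (T - t) :=
          mul_nonneg (by positivity) (by linarith [ht.2])
        norm_num
        linarith)
    have := hm ht (right_mem_Icc.2 hT.le) ht.2
    simp only [hw.fin, hv.fin, sub_self] at this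
    simp only [hd]
    linarith
  set c := p₁ / T ^ 2 with hc
  have hcp : 0 < c := div_pos hv.p_pos (by positivity)
  -- Near T, d ≥ -C (T - t)² while κ q ≥ κ c (T - t), so d + κ q ≥ 0 once T - t ≤ κ c / C. The bound
  -- T / 2 makes T - t the smaller distance in `deriv_le`. Thus the minimum of d / q can be sought
  -- on a compact interval inside.
  set δ₂ := min (T / 2) (κ * c / C) with hδ₂
  have hδ₂p : 0 < δ₂ := lt_min (by linarith) (by positivity)
  have hn2 : ∀ t ∈ Icc 0 T, T - t ≤ δ₂ → 0 ≤ d t + κ * q t := fun t ht htδ => by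
    have h5 : T - t ≤ T / 2 := htδ.trans (min_le_left _ _)
    have h6 : C * (T - t) ≤ κ * c := by
      have := htδ.trans (min_le_right _ _)
      rwa [le_div_iff₀ hC, mul_comm] at this
    have h7 := hqd t ht
    rw [min_eq_right (by linarith)] at h7
    have h8 : κ * (c * (T - t)) ≤ κ * q t :=
      mul_le_mul_of_nonneg_left (by simp only [hq]; linarith) hκp.le
    have h9 := mul_le_mul_of_nonneg_right h6 (by linarith [ht.2] : 0 ≤ T - t)
    have := hCb t ht
    nlinarith
  -- minimum of `d / q`
  set a := min (δ₁ / 2) s with ha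
  set b := max (T - δ₂) s with hb
  have ha0 : 0 < a := lt_min (by linarith) hs0
  have hbT : b < T := max_lt (by linarith) hsT
  have hsub : Icc a b ⊆ Ioo 0 T := fun t ht => ⟨ha0.trans_le ht.1, ht.2.trans_lt hbT⟩
  have hsubc : Icc a b ⊆ Icc 0 T := hsub.trans Ioo_subset_Icc_self
  have hsab : s ∈ Icc a b := ⟨min_le_right _ _, le_max_right _ _⟩
  have cq : ContinuousOn q (Icc 0 T) := (hv.chain.continuousOn (i := 1) (by norm_num)).neg
  obtain ⟨m, hm, hmin⟩ := isCompact_Icc.exists_isMinOn ⟨s, hsab⟩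
    ((cdc.mono hsubc).div (cq.mono hsubc) (fun t ht => (hqp t (hsub ht)).ne'))
  set k := -(d m / q m) with hk
  have hkκ : κ ≤ k := by
    have : d m / q m ≤ d s / q s := hmin hsab
    rw [hk, hκ]; linarith
  have hkp : 0 < k := hκp.trans_le hkκ
  have hnn : ∀ t ∈ Icc 0 T, 0 ≤ d t + k * q t := by
    intro t ht
    by_cases h5 : t ∈ Icc a b
    · have h6 : d m / q m ≤ d t / q t := hmin h5
      rw [le_div_iff₀ (hqp t (hsub h5))] at h6
      rw [hk]; linarith
    · rw [mem_Icc, not_and_or, not_le, not_le] at h5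
      rcases h5 with h5 | h5
      · have h6 : t < δ₁ := by
          have := h5.trans_le (min_le_left (δ₁ / 2) s)
          linarith
        exact add_nonneg (hn1 t ht h6).le (mul_nonneg hkp.le (hq0 t ht))
      · have h6 : T - t ≤ δ₂ := by
          have := (le_max_left (T - δ₂) s).trans_lt h5
          linarith
        have := hn2 t ht h6
        have h7 := mul_le_mul_of_nonneg_right hkκ (hq0 t ht)
        linarith
  have hmz : d m + k * q m = 0 := by
    have := (hqp m (hsub hm)).ne'
    rw [hk]; field_simp; ring
  -- the touching function
  set h : ℕ → ℝ → ℝ := fun i t =>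
    (w i t - v i t) - k * (if i = 4 then f' (v 0 t) * v 1 t else v (i + 1) t) with hh
  have hch : DerivChain 0 T h := by
    intro i hi t ht
    have h5 := cd i hi t ht
    rcases Nat.lt_or_ge i 3 with h6 | h6
    · have h7 := h5.sub ((hv.chain (i + 1) (by omega) t ht).const_mul k)
      have e1 : ¬ (i = 4) := by omega
      have e2 : ¬ (i + 1 = 4) := by omega
      simp only [hh, e1, e2, if_false]
      exact h7
    · obtain rfl : i = 3 := by omega
      -- The chain provides no derivative of v''''; the equation does, as (f ∘ v)' = f'(v) v'.
      have h8 : HasDerivWithinAt (v 4) (f' (v 0 t) * v 1 t) (Icc 0 T) t := by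
        have := (hf.hasDeriv _ (hv.mem_Ico h1 ht)).comp t (hv.chain 0 (by norm_num) t ht)
          (fun u hu => hv.mem_Ico h1 hu)
        exact this.congr (fun u hu => hv.eqn u hu) (hv.eqn t ht)
      exact h5.sub (h8.const_mul k)
  refine hch.not_touching (m := m) ?_ ?_ (hsub hm).1 (hsub hm).2 ?_ ?_ ?_ ?_
  · intro t ht
    simp only [hh, if_true]
    rw [hw.eqn t ht, hv.eqn t ht]
    have mv := hv.mem_Ico h1 ht
    have mw := hw.mem_Ico h2 ht
    have h5 := hnn t ht
    have hfn := hf.deriv_nonneg _ mv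
    simp only [hd, hq] at h5
    -- Here h'''' = f(w) - f(v) + k f'(v) q. Where w ≥ v both parts are nonnegative; where w < v
    -- convexity gives f(v) - f(w) ≤ f'(v) (v - w) ≤ k f'(v) q.
    rcases le_or_gt (v 0 t) (w 0 t) with h6 | h6
    · have h7 := hf.strictMonoOn.monotoneOn mv mw h6
      have h8 : 0 ≤ k * (f' (v 0 t) * (-v 1 t)) :=
        mul_nonneg hkp.le (mul_nonneg hfn (hq0 t ht))
      linarith
    · have h7 := hf.sub_le_deriv_mul mw mv h6
      have h8 : f' (v 0 t) * (v 0 t - w 0 t) ≤ f' (v 0 t) * (k * -v 1 t) :=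
        mul_le_mul_of_nonneg_left (by linarith) hfn
      linarith
  · intro t ht
    have := hnn t ht
    simp only [hd, hq] at this
    simp only [hh]
    norm_num
    linarith
  · simp only [hd, hq] at hmz
    simp only [hh]
    norm_num
    linarith
  · simp [hh, hw.init, hv.init, hv.init']
    linarith
  · have h5 : v 2 0 ≤ 0 := by
      by_contra! h6
      obtain ⟨δ, hδ, hbb⟩ := Metric.mem_nhdsWithin_iff.1 (continuousWithinAt_const.eventually_lt
        (hv.chain.continuousOn (i := 2) (by norm_num) 0 (left_mem_Icc.2 hT.le)) h6)
      set u := min T (δ / 2) with hu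
      have hu0 : 0 < u := lt_min hT (by linarith)
      have cu := hv.chain.mono (a' := 0) (b' := u) le_rfl (min_le_left _ _)
      have e2 : ∀ t ∈ Icc 0 u, 0 ≤ v 2 t := fun t ht => by
        refine le_of_lt (hbb ⟨?_, ht.1, ht.2.trans (min_le_left _ _)⟩)
        have := ht.2.trans (min_le_right T (δ / 2))
        rw [Metric.mem_ball, Real.dist_eq, sub_zero, abs_of_nonneg ht.1]
        linarith
      have hz : ∀ t ∈ Icc 0 u, v 1 t = 0 := fun t ht => le_antisymm
        (hv.deriv_nonpos fv hv3 t ⟨ht.1, ht.2.trans (min_le_left _ _)⟩)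
        (by have := cu.le_of_nonneg (i := 1) (by norm_num) e2 ht; rwa [hv.init'] at this)
      have := cu.eq_zero_of_const hu0 (i := 1) (by norm_num) hz 0 (left_mem_Icc.2 hu0.le)
      simp only [Nat.reduceAdd] at this
      linarith
    simp [hh, hw.init', hv.init']
    exact mul_nonpos_of_nonneg_of_nonpos hkp.le h5
  · simp [hh, hw.fin', hv.fin']
    exact mul_pos hkp (hv.second_deriv_pos fv hv3)

/-- One equation on one interval has no three symmetric profiles. -/
theorem not_three (hf : IsConvexSource r f f') (hv : IsProfile f p₁ T v)
    (hw : IsProfile f p₂ T w) (hx : IsProfile f p₃ T x) (hv3 : v 3 0 = 0) (hw3 : w 3 0 = 0)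
    (hx3 : x 3 0 = 0) (h12 : p₁ < p₂) (h23 : p₂ < p₃) (h3 : p₃ < r) : False := by
  have hT := hv.T_pos
  have l1 := le_of_max_lt hf hv hw hv3 h12 (h23.trans h3)
  have l2 := le_of_max_lt hf hw hx hw3 h23 h3
  have cd := hw.chain.sub hv.chain
  have ce := hx.chain.sub hw.chain
  -- The boundary form of Lagrange's identity for the fourth derivative, applied to w - v and x - w.
  -- It vanishes at 0 by symmetry (odd derivatives are zero) and at T by the clamped conditions.
  set B : ℝ → ℝ := fun t => (w 3 t - v 3 t) * (x 0 t - w 0 t) - (w 2 t - v 2 t) * (x 1 t - w 1 t)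
    + (w 1 t - v 1 t) * (x 2 t - w 2 t) - (w 0 t - v 0 t) * (x 3 t - w 3 t) with hB
  have hBd : ∀ t ∈ Icc 0 T, HasDerivWithinAt B
      ((w 4 t - v 4 t) * (x 0 t - w 0 t) - (w 0 t - v 0 t) * (x 4 t - w 4 t)) (Icc 0 T) t := by
    intro t ht
    have d0 := cd 0 (by norm_num) t ht
    have d1 := cd 1 (by norm_num) t ht
    have d2 := cd 2 (by norm_num) t ht
    have d3 := cd 3 (by norm_num) t ht
    have e0 := ce 0 (by norm_num) t ht
    have e1 := ce 1 (by norm_num) t ht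
    have e2 := ce 2 (by norm_num) t ht
    have e3 := ce 3 (by norm_num) t ht
    have := (((d3.mul e0).sub (d2.mul e1)).add (d1.mul e2)).sub (d0.mul e3)
    refine this.congr_deriv ?_
    simp only [Nat.reduceAdd]
    ring
  have hle : ∀ t ∈ Icc 0 T,
      (w 4 t - v 4 t) * (x 0 t - w 0 t) - (w 0 t - v 0 t) * (x 4 t - w 4 t) ≤ 0 := by
    intro t ht
    rw [hv.eqn t ht, hw.eqn t ht, hx.eqn t ht]
    have := hf.cross_le (hv.mem_Ico (h12.trans (h23.trans h3)) ht) (hx.mem_Ico h3 ht)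
      (l1 t ht) (l2 t ht)
    linarith
  have hm := antitoneOn_of_hasDerivWithinAt_Icc hBd hle
  have hB0 : B 0 = 0 := by
    simp [hB, hv.init', hw.init', hx.init', hv3, hw3, hx3]
  have hBT : B T = 0 := by
    simp [hB, hv.fin', hw.fin', hx.fin', hv.fin, hw.fin, hx.fin]
  have hz : ∀ t ∈ Icc 0 T, B t = 0 := fun t ht => le_antisymm
    (hB0 ▸ hm (left_mem_Icc.2 hT.le) ht ht.1) (hBT ▸ hm ht (right_mem_Icc.2 hT.le) ht.2)
  have h0 := left_mem_Icc.2 hT.le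
  -- B is decreasing with equal end values, hence constant; but at t = 0 strict convexity at p₁ < p₂
  -- < p₃ makes B' negative.
  have hd0 := deriv_eq_zero_of_const_Icc hT hBd hz 0 h0
  rw [hv.eqn 0 h0, hw.eqn 0 h0, hx.eqn 0 h0, hv.init, hw.init, hx.init] at hd0
  have := hf.cross_lt ⟨hv.p_pos.le, h12.trans (h23.trans h3)⟩ ⟨hx.p_pos.le, h3⟩ h12 h23
  linarith

end IsProfile

/-! ### The Green operator of the clamped problem -/

theorem eqOn_of_hasDerivWithinAt_Icc {a b : ℝ} {g k g' : ℝ → ℝ}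
    (hg : ∀ t ∈ Icc a b, HasDerivWithinAt g (g' t) (Icc a b) t)
    (hk : ∀ t ∈ Icc a b, HasDerivWithinAt k (g' t) (Icc a b) t) (ha : g a = k a) :
    ∀ t ∈ Icc a b, g t = k t := by
  have hd : ∀ t ∈ Icc a b, HasDerivWithinAt (fun t => g t - k t) 0 (Icc a b) t := fun t ht => by
    have := (hg t ht).sub (hk t ht)
    rw [sub_self] at this
    exact this
  have h1 := monotoneOn_of_hasDerivWithinAt_Icc hd (fun _ _ => le_rfl)
  have h2 := antitoneOn_of_hasDerivWithinAt_Icc hd (fun _ _ => le_rfl)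
  intro t ht
  have hl := left_mem_Icc.2 (ht.1.trans ht.2)
  have := h1 hl ht ht.1
  have := h2 hl ht ht.1
  simp only [ha, sub_self] at *
  linarith

theorem hasDerivWithinAt_IccExtend {g : C(unitInterval, ℝ)} {F : ℝ → ℝ} {d : ℝ} {x : unitInterval}
    (hF : HasDerivWithinAt F d (Icc 0 1) x) (h : ∀ y : unitInterval, g y = F y) :
    HasDerivWithinAt (IccExtend zero_le_one g) d (Icc (0 : ℝ) 1) x :=
  hF.congr (fun y hy => by rw [IccExtend_of_mem _ _ hy]; exact h _)
    (by rw [IccExtend_val]; exact h x)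

/-- The primitive that vanishes at `0`. -/
noncomputable def primitive : C(unitInterval, ℝ) →L[ℝ] C(unitInterval, ℝ) :=
  LinearMap.mkContinuous
    { toFun := fun h => ⟨fun x => ∫ t in (0 : ℝ)..x, IccExtend zero_le_one h t, by
        have hc : Continuous (IccExtend zero_le_one h) := h.continuous.Icc_extend'
        exact (intervalIntegral.continuous_primitive (fun a b => hc.intervalIntegrable a b) 0).comp
          continuous_subtype_val⟩
      map_add' := fun h k => by
        ext x
        have hc : Continuous (IccExtend zero_le_one h) := h.continuous.Icc_extend'
        have kc : Continuous (IccExtend zero_le_one k) := k.continuous.Icc_extend'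
        exact intervalIntegral.integral_add (hc.intervalIntegrable _ _) (kc.intervalIntegrable _ _)
      map_smul' := fun c h => by
        ext x
        exact intervalIntegral.integral_smul c _ } 1 (fun h => by
      rw [ContinuousMap.norm_le _ (by positivity)]
      intro x
      have := intervalIntegral.norm_integral_le_of_norm_le_const (a := 0) (b := (x : ℝ))
        (f := IccExtend zero_le_one h) (C := ‖h‖) (fun t _ => h.norm_coe_le_norm _)
      refine this.trans ?_
      rw [sub_zero, abs_of_nonneg x.2.1, one_mul]
      exact mul_le_of_le_one_right (norm_nonneg _) x.2.2)

theorem primitive_zero (h : C(unitInterval, ℝ)) : primitive h 0 = 0 :=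
  intervalIntegral.integral_same

theorem hasDerivAt_integral_IccExtend (h : C(unitInterval, ℝ)) (x : unitInterval) :
    HasDerivAt (fun y : ℝ => ∫ t in (0 : ℝ)..y, IccExtend zero_le_one h t) (h x) x := by
  have hc : Continuous (IccExtend zero_le_one h) := h.continuous.Icc_extend'
  have := (hc.integral_hasStrictDerivAt 0 (x : ℝ)).hasDerivAt
  rwa [IccExtend_val] at this

/-- The coordinate function on `[0,1]`. -/
def coordMap : C(unitInterval, ℝ) := ⟨fun x => (x : ℝ), continuous_subtype_val⟩

/-- The coefficients of the cubic that makes the fourth primitive clamped at `1`. -/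
noncomputable def greenQuad : C(unitInterval, ℝ) →L[ℝ] ℝ :=
  -- Let I₃, I₄ be the third and fourth primitives at 1. Subtracting A x² + B x³ gives clamped
  -- conditions at 1 when A + B = I₄ and 2A + 3B = I₃, that is A = 3 I₄ - I₃ and B = I₃ - 2 I₄.
  (3 : ℝ) • (ContinuousMap.evalCLM ℝ 1 ∘L primitive ∘L primitive ∘L primitive ∘L primitive) -
    ContinuousMap.evalCLM ℝ 1 ∘L primitive ∘L primitive ∘L primitive

/-- See `greenQuad`. -/
noncomputable def greenCub : C(unitInterval, ℝ) →L[ℝ] ℝ :=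
  ContinuousMap.evalCLM ℝ 1 ∘L primitive ∘L primitive ∘L primitive -
    (2 : ℝ) • (ContinuousMap.evalCLM ℝ 1 ∘L primitive ∘L primitive ∘L primitive ∘L primitive)

/-- The derivatives of the solution of the clamped problem `u'''' = h`. -/
noncomputable def greenTuple (j : Fin 5) : C(unitInterval, ℝ) →L[ℝ] C(unitInterval, ℝ) :=
  match j with
  | 0 => primitive ∘L primitive ∘L primitive ∘L primitive -
      (greenQuad.smulRight (coordMap ^ 2) + greenCub.smulRight (coordMap ^ 3))
  | 1 => primitive ∘L primitive ∘L primitive -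
      (greenQuad.smulRight ((2 : ℝ) • coordMap) + greenCub.smulRight ((3 : ℝ) • coordMap ^ 2))
  | 2 => primitive ∘L primitive -
      (greenQuad.smulRight ((2 : ℝ) • (1 : C(unitInterval, ℝ))) +
        greenCub.smulRight ((6 : ℝ) • coordMap))
  | 3 => primitive - greenCub.smulRight ((6 : ℝ) • (1 : C(unitInterval, ℝ)))
  | 4 => ContinuousLinearMap.id ℝ _

theorem greenTuple_mem (h : C(unitInterval, ℝ)) :
    ContinuousLinearMap.pi greenTuple h ∈ ckSubmodule 4 := by
  intro i x
  fin_cases i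
  · refine hasDerivWithinAt_IccExtend (F := fun y =>
      (∫ t in (0 : ℝ)..y, IccExtend zero_le_one (primitive (primitive (primitive h))) t) -
        (greenQuad h * y ^ 2 + greenCub h * y ^ 3)) ?_ (fun y => rfl)
    refine HasDerivAt.hasDerivWithinAt ?_
    refine ((hasDerivAt_integral_IccExtend (primitive (primitive (primitive h))) x).sub
      (((hasDerivAt_pow 2 (x : ℝ)).const_mul (greenQuad h)).add
        ((hasDerivAt_pow 3 (x : ℝ)).const_mul (greenCub h)))).congr_deriv ?_
    change _ = primitive (primitive (primitive h)) x -
        (greenQuad h * (2 * (x : ℝ)) + greenCub h * (3 * (x : ℝ) ^ 2))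
    norm_num
  · refine hasDerivWithinAt_IccExtend (F := fun y =>
      (∫ t in (0 : ℝ)..y, IccExtend zero_le_one (primitive (primitive h)) t) -
        (greenQuad h * (2 * y) + greenCub h * (3 * y ^ 2))) ?_ (fun y => rfl)
    refine HasDerivAt.hasDerivWithinAt ?_
    refine ((hasDerivAt_integral_IccExtend (primitive (primitive h)) x).sub
      ((((hasDerivAt_id (x : ℝ)).const_mul 2).const_mul (greenQuad h)).add
        (((hasDerivAt_pow 2 (x : ℝ)).const_mul 3).const_mul (greenCub h)))).congr_deriv ?_
    change _ = primitive (primitive h) x -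
        (greenQuad h * (2 * 1) + greenCub h * (6 * (x : ℝ)))
    push_cast
    ring
  · refine hasDerivWithinAt_IccExtend (F := fun y =>
      (∫ t in (0 : ℝ)..y, IccExtend zero_le_one (primitive h) t) -
        (greenQuad h * (2 * 1) + greenCub h * (6 * y))) ?_ (fun y => rfl)
    refine HasDerivAt.hasDerivWithinAt ?_
    refine ((hasDerivAt_integral_IccExtend (primitive h) x).sub
      ((((hasDerivAt_id (x : ℝ)).const_mul 6).const_mul (greenCub h)).const_add
        (greenQuad h * (2 * 1)))).congr_deriv ?_
    change _ = primitive h x - greenCub h * (6 * 1)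
    norm_num
  · refine hasDerivWithinAt_IccExtend (F := fun y =>
      (∫ t in (0 : ℝ)..y, IccExtend zero_le_one h t) - greenCub h * (6 * 1)) ?_ (fun y => rfl)
    exact ((hasDerivAt_integral_IccExtend h x).sub_const _).hasDerivWithinAt

/-- The solution operator of `u'''' = h`, `u(0) = u(1) = u'(0) = u'(1) = 0`. -/
noncomputable def green : C(unitInterval, ℝ) →L[ℝ] CkFun 4 :=
  (ContinuousLinearMap.pi greenTuple).codRestrict (ckSubmodule 4) greenTuple_mem

/-- The clamped boundary conditions. -/
structure CkFun.Clamped (u : CkFun 4) : Prop where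
  left : u.der 0 0 = 0
  right : u.der 0 1 = 0
  left' : u.der 1 0 = 0
  right' : u.der 1 1 = 0

theorem green_clamped (h : C(unitInterval, ℝ)) : (green h).Clamped where
  left := by
    change primitive (primitive (primitive (primitive h))) 0 -
        (greenQuad h * (0 : ℝ) ^ 2 + greenCub h * (0 : ℝ) ^ 3) = 0
    rw [primitive_zero]; norm_num
  left' := by
    change primitive (primitive (primitive h)) 0 -
        (greenQuad h * (2 * (0 : ℝ)) + greenCub h * (3 * (0 : ℝ) ^ 2)) = 0
    rw [primitive_zero]; norm_num
  right := by
    change primitive (primitive (primitive (primitive h))) 1 -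
        ((3 * primitive (primitive (primitive (primitive h))) 1 -
            primitive (primitive (primitive h)) 1) * (1 : ℝ) ^ 2 +
          (primitive (primitive (primitive h)) 1 -
            2 * primitive (primitive (primitive (primitive h))) 1) * (1 : ℝ) ^ 3) = 0
    ring
  right' := by
    change primitive (primitive (primitive h)) 1 -
        ((3 * primitive (primitive (primitive (primitive h))) 1 -
            primitive (primitive (primitive h)) 1) * (2 * (1 : ℝ)) +
          (primitive (primitive (primitive h)) 1 -
            2 * primitive (primitive (primitive (primitive h))) 1) * (3 * (1 : ℝ) ^ 2)) = 0
    ring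

theorem CkFun.fn_eq_der {u : CkFun 4} {i : ℕ} (hi : i < 5) {x : ℝ} (hx : x ∈ Icc (0 : ℝ) 1) :
    u.fn i x = u.der ⟨i, hi⟩ ⟨x, hx⟩ := u.fn_coe ⟨i, hi⟩ ⟨x, hx⟩

theorem CkFun.Clamped.fn_left {u : CkFun 4} (h : u.Clamped) : u.fn 0 0 = 0 :=
  (u.fn_coe 0 0).trans h.left

theorem CkFun.Clamped.fn_right {u : CkFun 4} (h : u.Clamped) : u.fn 0 1 = 0 :=
  (u.fn_coe 0 1).trans h.right

theorem CkFun.Clamped.fn_left' {u : CkFun 4} (h : u.Clamped) : u.fn 1 0 = 0 :=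
  (u.fn_coe 1 0).trans h.left'

theorem CkFun.Clamped.fn_right' {u : CkFun 4} (h : u.Clamped) : u.fn 1 1 = 0 :=
  (u.fn_coe 1 1).trans h.right'

/-- The difference is a cubic; the conditions at 0 leave (A/2) t² + (B/6) t³, and the two conditions
at 1 give A = B = 0. -/
theorem CkFun.Clamped.ext {u v : CkFun 4} (hu : u.Clamped) (hv : v.Clamped)
    (h : u.der 4 = v.der 4) : u = v := by
  have ch := u.derivChain.sub v.derivChain
  set A := u.fn 2 0 - v.fn 2 0
  set B := u.fn 3 0 - v.fn 3 0
  have e4 : ∀ t ∈ Icc (0 : ℝ) 1, u.fn 4 t - v.fn 4 t = 0 := fun t ht => by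
    rw [CkFun.fn_eq_der (by norm_num) ht, CkFun.fn_eq_der (by norm_num) ht]
    exact sub_eq_zero.2 (congrArg (fun g => g ⟨t, ht⟩) h)
  have e3 := eqOn_of_hasDerivWithinAt_Icc (k := fun _ => B) (ch 3 (by norm_num))
    (fun t ht => (hasDerivWithinAt_const t _ B).congr_deriv (e4 t ht).symm) rfl
  have e2 := eqOn_of_hasDerivWithinAt_Icc (k := fun t => A + B * t) (ch 2 (by norm_num))
    (fun t ht => (((hasDerivWithinAt_id t _).const_mul B).const_add A).congr_deriv
      ((mul_one B).trans (e3 t ht).symm)) (by simp [A])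
  have e1 := eqOn_of_hasDerivWithinAt_Icc (k := fun t => A * t + B / 2 * t ^ 2)
    (ch 1 (by norm_num))
    (fun t ht => (((hasDerivWithinAt_id t _).const_mul A).add
      ((hasDerivAt_pow 2 t).hasDerivWithinAt.const_mul (B / 2))).congr_deriv (by
        rw [e2 t ht]; norm_num; ring)) (by simp [hu.fn_left', hv.fn_left'])
  have e0 := eqOn_of_hasDerivWithinAt_Icc (k := fun t => A / 2 * t ^ 2 + B / 6 * t ^ 3)
    (ch 0 (by norm_num))
    (fun t ht => (((hasDerivAt_pow 2 t).hasDerivWithinAt.const_mul (A / 2)).add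
      ((hasDerivAt_pow 3 t).hasDerivWithinAt.const_mul (B / 6))).congr_deriv (by
        rw [e1 t ht]; norm_num; ring)) (by simp [hu.fn_left, hv.fn_left])
  have h1 : (1 : ℝ) ∈ Icc (0 : ℝ) 1 := by norm_num
  have f1 := e1 1 h1
  have f0 := e0 1 h1
  simp only [hu.fn_right', hv.fn_right', hu.fn_right, hv.fn_right] at f0 f1
  have hB : B = 0 := by linarith
  have hA : A = 0 := by linarith
  refine CkFun.ext_der_zero fun x => ?_
  have := e0 x x.2
  simp only [hA, hB] at this
  have h2 := u.fn_coe 0 x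
  have h3 := v.fn_coe 0 x
  simp only [Fin.val_zero] at h2 h3
  rw [← h2, ← h3]
  linarith

/-! ### Reflection, folding and the symmetrized Green operator -/

/-- Reflection about `1/2`. -/
noncomputable def CkFun.reflect {k : ℕ} (u : CkFun k) : CkFun k :=
  ⟨fun j => (-1 : ℝ) ^ (j : ℕ) • (u.der j).comp ⟨unitInterval.symm, unitInterval.continuous_symm⟩, by
    intro i x
    have h1 : HasDerivWithinAt (fun t : ℝ => 1 - t) (-1) (Icc 0 1) x :=
      (hasDerivWithinAt_id (x : ℝ) _).const_sub 1
    have h2 : MapsTo (fun t : ℝ => 1 - t) (Icc 0 1) (Icc 0 1) := fun t ht =>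
      ⟨by linarith [ht.2], by linarith [ht.1]⟩
    have h3 := u.2 i (unitInterval.symm x)
    have h4 := (HasDerivWithinAt.comp (x : ℝ) h3 h1 h2).const_mul ((-1 : ℝ) ^ (i : ℕ))
    refine hasDerivWithinAt_IccExtend (h4.congr_deriv ?_) (fun y => ?_)
    · change _ = (-1 : ℝ) ^ ((i : ℕ) + 1) * u.1 i.succ (unitInterval.symm x)
      ring
    · change (-1 : ℝ) ^ (i : ℕ) * u.1 i.castSucc (unitInterval.symm y) = (-1 : ℝ) ^ (i : ℕ) *
        IccExtend zero_le_one (u.1 i.castSucc) ((unitInterval.symm y : unitInterval) : ℝ)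
      rw [IccExtend_val]⟩

theorem CkFun.der_reflect {k : ℕ} (u : CkFun k) (j : Fin (k + 1)) (x : unitInterval) :
    u.reflect.der j x = (-1 : ℝ) ^ (j : ℕ) * u.der j (unitInterval.symm x) := rfl

theorem CkFun.Clamped.reflect {u : CkFun 4} (hu : u.Clamped) : u.reflect.Clamped where
  left := by simp [CkFun.der_reflect, hu.right]
  right := by simp [CkFun.der_reflect, hu.left]
  left' := by simp [CkFun.der_reflect, hu.right']
  right' := by simp [CkFun.der_reflect, hu.left']

theorem CkFun.Clamped.reflect_eq {u : CkFun 4} (hu : u.Clamped)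
    (h : ∀ x, u.der 4 (unitInterval.symm x) = u.der 4 x) : u.reflect = u := by
  refine hu.reflect.ext hu (ContinuousMap.ext fun x => ?_)
  rw [CkFun.der_reflect, h]
  norm_num [show ((4 : Fin 5) : ℕ) = 4 from rfl]

theorem symm_midpt : unitInterval.symm midpt = midpt := Subtype.ext (by simp [midpt]; norm_num)

/-- The folding map `x ↦ max x (1 - x)` of `[0,1]` onto its right half. -/
noncomputable def foldMap : C(unitInterval, unitInterval) :=
  ⟨fun x => max x (unitInterval.symm x), continuous_id.max unitInterval.continuous_symm⟩

theorem foldMap_symm (x : unitInterval) : foldMap (unitInterval.symm x) = foldMap x := by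
  change max (unitInterval.symm x) (unitInterval.symm (unitInterval.symm x)) = _
  rw [unitInterval.symm_symm, max_comm]; rfl

theorem foldMap_of_le {x : unitInterval} (h : (1 / 2 : ℝ) ≤ x) : foldMap x = x :=
  max_eq_left (Subtype.coe_le_coe.1 (by rw [unitInterval.coe_symm_eq]; linarith))

theorem foldMap_midpt : foldMap midpt = midpt := foldMap_of_le le_rfl

/-- Precomposition with the folding map. -/
noncomputable def foldCLM : C(unitInterval, ℝ) →L[ℝ] C(unitInterval, ℝ) where
  toLinearMap := (ContinuousMap.compRightAlgHom ℝ ℝ foldMap).toLinearMap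
  cont := ContinuousMap.continuous_precomp foldMap

/-- The Green operator applied to the symmetrized right-hand side. -/
noncomputable def symGreen : C(unitInterval, ℝ) →L[ℝ] CkFun 4 := green ∘L foldCLM

theorem symGreen_clamped (h : C(unitInterval, ℝ)) : (symGreen h).Clamped := green_clamped _

theorem symGreen_der_four (h : C(unitInterval, ℝ)) (x : unitInterval) :
    (symGreen h).der 4 x = h (foldMap x) := rfl

/-- Folding makes every right-hand side even about 1/2. The whole space C[0,1] can therefore be
kept, although fixed points are symmetric and odd perturbations do not enter the linearization. -/
theorem symGreen_reflect (h : C(unitInterval, ℝ)) : (symGreen h).reflect = symGreen h :=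
  (symGreen_clamped h).reflect_eq fun x => by
    rw [symGreen_der_four, symGreen_der_four, foldMap_symm]

theorem CkFun.der_symm_of_reflect {k : ℕ} {u : CkFun k} (hu : u.reflect = u) (j : Fin (k + 1))
    (x : unitInterval) : (-1 : ℝ) ^ (j : ℕ) * u.der j (unitInterval.symm x) = u.der j x := by
  rw [← CkFun.der_reflect, hu]

theorem CkFun.fn_half_of_reflect {u : CkFun 4} (hu : u.reflect = u) :
    u.fn 1 (1 / 2) = 0 ∧ u.fn 3 (1 / 2) = 0 := by
  have h1 := CkFun.der_symm_of_reflect hu 1 midpt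
  have h3 := CkFun.der_symm_of_reflect hu 3 midpt
  rw [symm_midpt] at h1 h3
  have e1 : u.fn 1 (1 / 2) = u.der 1 midpt := u.fn_coe 1 midpt
  have e3 : u.fn 3 (1 / 2) = u.der 3 midpt := u.fn_coe 3 midpt
  rw [e1, e3]
  norm_num [show ((3 : Fin 5) : ℕ) = 3 from rfl, show ((1 : Fin 5) : ℕ) = 1 from rfl] at h1 h3
  constructor <;> linarith

/-- The right half of `u`, with the variable `t = x - 1/2`. -/
noncomputable def CkFun.half (u : CkFun 4) (i : ℕ) (t : ℝ) : ℝ := u.fn i (1 / 2 + t)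

theorem CkFun.half_chain (u : CkFun 4) : DerivChain 0 (1 / 2) u.half := by
  have := u.derivChain.affine (a' := 0) (b' := 1 / 2) (x := 1 / 2) (c := 1)
    (fun t ht => ⟨by linarith [ht.1], by linarith [ht.2]⟩)
  simp only [one_pow, one_mul] at this
  exact this

theorem CkFun.half_eq_der {u : CkFun 4} (i : Fin 5) {x : unitInterval} :
    u.half i ((x : ℝ) - 1 / 2) = u.der i x := by
  rw [CkFun.half, show 1 / 2 + ((x : ℝ) - 1 / 2) = x by ring]
  exact u.fn_coe i x

/-- Values of `symGreen h` for a right-hand side that is nonnegative on the right half. -/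
theorem symGreen_half {h : C(unitInterval, ℝ)} (h0 : ∀ x : unitInterval, (1 / 2 : ℝ) ≤ x → 0 ≤ h x) :
    AntitoneOn ((symGreen h).half 0) (Icc 0 (1 / 2)) ∧
      ∀ t ∈ Icc (0 : ℝ) (1 / 2), (symGreen h).half 1 t ≤ 0 ∧ 0 ≤ (symGreen h).half 3 t := by
  set u := symGreen h
  have hc := symGreen_clamped h
  have ch := u.half_chain
  obtain ⟨z1, z3⟩ := CkFun.fn_half_of_reflect (symGreen_reflect h)
  have e4 : ∀ t ∈ Icc (0 : ℝ) (1 / 2), 0 ≤ u.half 4 t := fun t ht => by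
    have hx : 1 / 2 + t ∈ Icc (0 : ℝ) 1 := ⟨by linarith [ht.1], by linarith [ht.2]⟩
    have hh : (1 / 2 : ℝ) ≤ 1 / 2 + t := by linarith [ht.1]
    rw [CkFun.half, CkFun.fn_eq_der (by norm_num) hx]
    change 0 ≤ h (foldMap _)
    rw [foldMap_of_le (x := ⟨_, hx⟩) hh]
    exact h0 _ hh
  have e3 : ∀ t ∈ Icc (0 : ℝ) (1 / 2), 0 ≤ u.half 3 t := fun t ht => by
    have := ch.le_of_nonneg (i := 3) (by norm_num) e4 ht
    rw [CkFun.half, add_zero] at this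
    linarith
  -- On the right half u' is convex, and it vanishes at the midpoint by symmetry and at 1 by the
  -- clamped condition.
  have e1 := nonpos_of_second_deriv_nonneg (ch 1 (by norm_num)) (ch 2 (by norm_num)) e3
    (by rw [CkFun.half, add_zero]; exact z1.le)
    (by rw [CkFun.half, add_halves]; exact hc.fn_right'.le)
  exact ⟨ch.antitoneOn (i := 0) (by norm_num) e1, fun t ht => ⟨e1 t ht, e3 t ht⟩⟩

theorem CkFun.der_zero_eq_half_abs {u : CkFun 4} (hu : u.reflect = u) (x : unitInterval) :
    u.der 0 x = u.half 0 |(x : ℝ) - 1 / 2| := by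
  rcases le_total (1 / 2) (x : ℝ) with h | h
  · rw [abs_of_nonneg (by linarith)]
    exact (CkFun.half_eq_der 0).symm
  · have h1 := CkFun.der_symm_of_reflect hu 0 x
    rw [abs_of_nonpos (by linarith), ← h1]
    have := CkFun.half_eq_der (u := u) 0 (x := unitInterval.symm x)
    simp only [Fin.val_zero, pow_zero, one_mul] at *
    rw [← this, unitInterval.coe_symm_eq]
    congr 1
    ring

theorem abs_sub_half_mem (x : unitInterval) : |(x : ℝ) - 1 / 2| ∈ Icc (0 : ℝ) (1 / 2) :=
  ⟨abs_nonneg _, abs_le.2 ⟨by linarith [x.2.1], by linarith [x.2.2]⟩⟩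

theorem symGreen_bounds {h : C(unitInterval, ℝ)}
    (h0 : ∀ x : unitInterval, (1 / 2 : ℝ) ≤ x → 0 ≤ h x) (x : unitInterval) :
    0 ≤ (symGreen h).der 0 x ∧ (symGreen h).der 0 x ≤ (symGreen h).der 0 midpt := by
  have hs := symGreen_reflect h
  have ha := (symGreen_half h0).1
  have hm := abs_sub_half_mem x
  rw [CkFun.der_zero_eq_half_abs hs x, CkFun.der_zero_eq_half_abs hs midpt]
  have e1 : |(midpt : ℝ) - 1 / 2| = 0 := by simp [midpt]
  rw [e1]
  constructor
  · have := ha hm (right_mem_Icc.2 (by norm_num)) hm.2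
    rw [CkFun.half, add_halves, (symGreen_clamped h).fn_right] at this
    exact this
  · exact ha (left_mem_Icc.2 (by norm_num)) hm hm.1

/-- The midpoint value is the maximum of a nonnegative function. If it were 0, the function would
vanish identically, but its fourth derivative at 1/2 is h(1/2) > 0. -/
theorem symGreen_midpt_pos {h : C(unitInterval, ℝ)}
    (h0 : ∀ x : unitInterval, (1 / 2 : ℝ) ≤ x → 0 ≤ h x) (hp : 0 < h midpt) :
    0 < (symGreen h).der 0 midpt := by
  refine lt_of_le_of_ne (symGreen_bounds h0 midpt).1 fun hz => ?_
  have hu : symGreen h = 0 := CkFun.ext_der_zero fun x => by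
    have := symGreen_bounds h0 x
    rw [← hz] at this
    exact le_antisymm this.2 this.1
  have h4 := symGreen_der_four h midpt
  rw [hu, foldMap_midpt] at h4
  exact hp.ne h4

/-! ### Compactness, superposition operators, extension of f -/

/-- The `j`-th derivative as a continuous linear map. -/
noncomputable def derCLM (k : ℕ) (j : Fin (k + 1)) : CkFun k →L[ℝ] C(unitInterval, ℝ) :=
  ContinuousLinearMap.proj j ∘L (ckSubmodule k).subtypeL

theorem derCLM_apply {k : ℕ} (j : Fin (k + 1)) (u : CkFun k) : derCLM k j u = u.der j := rfl

theorem CkFun.norm_der_le {k : ℕ} (u : CkFun k) (j : Fin (k + 1)) : ‖u.der j‖ ≤ ‖u‖ :=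
  norm_le_pi_norm u.1 j

/-- Arzelà–Ascoli: the unit ball of C⁴[0,1] consists of 1-Lipschitz functions with values in [-1,
1]. -/
theorem isCompactOperator_derCLM : IsCompactOperator (derCLM 4 0) := by
  refine (isCompactOperator_iff_exists_mem_nhds_image_subset_compact _).2
    ⟨Metric.closedBall 0 1, Metric.closedBall_mem_nhds 0 one_pos, ?_⟩
  let e := ContinuousMap.isometryEquivBoundedOfCompact unitInterval ℝ
  let A : Set (BoundedContinuousFunction unitInterval ℝ) :=
    {g | LipschitzWith 1 g ∧ ∀ x, g x ∈ Icc (-1 : ℝ) 1}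
  have hA : IsCompact (closure A) := by
    refine BoundedContinuousFunction.arzela_ascoli (Icc (-1) 1) isCompact_Icc A
      (fun g x hg => hg.2 x) ?_
    refine UniformEquicontinuous.equicontinuous ?_
    exact LipschitzWith.uniformEquicontinuous _ 1 (fun g => g.2.1)
  refine ⟨e.symm '' closure A, hA.image e.symm.continuous, ?_⟩
  rintro _ ⟨u, hu, rfl⟩
  refine ⟨e (u.der 0), subset_closure ⟨?_, ?_⟩, e.symm_apply_apply _⟩
  · have hn : ‖u‖ ≤ 1 := by simpa using hu
    refine LipschitzWith.of_dist_le_mul fun x y => ?_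
    have hb : ∀ t ∈ Icc (0 : ℝ) 1, ‖u.fn 1 t‖ ≤ 1 := fun t ht => by
      rw [CkFun.fn_eq_der (by norm_num) ht]
      exact ((u.der _).norm_coe_le_norm _).trans ((u.norm_der_le _).trans hn)
    have := Convex.norm_image_sub_le_of_norm_hasDerivWithin_le (u.derivChain 0 (by norm_num)) hb
      (convex_Icc 0 1) y.2 x.2
    have e0 := u.fn_coe 0 x
    have e1 := u.fn_coe 0 y
    simp only [Fin.val_zero] at e0 e1
    rw [e0, e1] at this
    exact this
  · intro x
    have hn : ‖u‖ ≤ 1 := by simpa using hu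
    exact abs_le.1 (((u.der 0).norm_coe_le_norm x).trans ((u.norm_der_le 0).trans hn))

/-- Continuity of g' is uniform near the compact range of u. The mean value inequality for y ↦ g(y)
- g'(u(x)) y then bounds the remainder uniformly in x. -/
theorem hasFDerivAt_comp_continuousMap {K : Type*} [TopologicalSpace K] [CompactSpace K]
    {g g' : C(ℝ, ℝ)} (hg : ∀ x, HasDerivAt g (g' x) x) (u : C(K, ℝ)) :
    HasFDerivAt (fun u : C(K, ℝ) => g.comp u) (ContinuousLinearMap.mul ℝ C(K, ℝ) (g'.comp u)) u := by
  refine .of_isLittleO (Asymptotics.isLittleO_iff.2 fun c hc => ?_)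
  have h1 := (isCompact_range u.continuous).uniformContinuousAt_of_continuousAt g'
    (fun a _ => g'.continuous.continuousAt) (Metric.dist_mem_uniformity hc)
  obtain ⟨δ, hδ, h2⟩ := Metric.mem_uniformity_dist.1 h1
  filter_upwards [Metric.ball_mem_nhds u hδ] with v hv
  rw [ContinuousMap.norm_le _ (by positivity)]
  intro x
  have hvx : ‖v x - u x‖ ≤ ‖v - u‖ := (v - u).norm_coe_le_norm x
  have hlt : ‖v - u‖ < δ := by simpa [dist_eq_norm] using hv
  have h3 := (convex_closedBall (u x) ‖v x - u x‖).norm_image_sub_le_of_norm_hasDerivWithin_le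
    (f := fun y => g y - g' (u x) * y) (f' := fun y => g' y - g' (u x) * 1) (C := c)
    (x := u x) (y := v x)
    (fun y _ => ((hg y).sub ((hasDerivAt_id y).const_mul _)).hasDerivWithinAt)
    (fun y hy => by
      rw [mul_one, ← dist_eq_norm, dist_comm]
      refine le_of_lt (h2 ?_ (mem_range_self x))
      rw [dist_comm]
      exact (Metric.mem_closedBall.1 hy).trans_lt (hvx.trans_lt hlt))
    (Metric.mem_closedBall_self (norm_nonneg _)) (by simp [dist_eq_norm])
  calc ‖(g.comp v - g.comp u - ContinuousLinearMap.mul ℝ C(K, ℝ) (g'.comp u) (v - u)) x‖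
      = ‖g (v x) - g' (u x) * v x - (g (u x) - g' (u x) * u x)‖ := by
        congr 1
        change g (v x) - g (u x) - g' (u x) * (v x - u x) = _
        ring
    _ ≤ c * ‖v x - u x‖ := h3
    _ ≤ c * ‖v - u‖ := mul_le_mul_of_nonneg_left hvx hc.le

/-- Superposition with a `C^n` function is a `C^n` operator on continuous functions. -/
theorem contDiff_comp_continuousMap {K : Type*} [TopologicalSpace K] [CompactSpace K] (n : ℕ) :
    ∀ g : C(ℝ, ℝ), ContDiff ℝ n g → ContDiff ℝ n (fun u : C(K, ℝ) => g.comp u) := by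
  induction n with
  | zero =>
    intro g _
    exact contDiff_zero.2 (ContinuousMap.continuous_postcomp g)
  | succ n ih =>
    intro g hg
    push_cast at hg ⊢
    obtain ⟨hd, -, hc⟩ := contDiff_succ_iff_deriv.1 hg
    have hgc : Continuous (deriv g) := hc.continuous
    rw [contDiff_succ_iff_hasFDerivAt]
    -- The derivative is multiplication by g' ∘ u, itself a superposition operator with one
    -- derivative less, so the induction applies to it.
    refine ⟨fun u => ContinuousLinearMap.mul ℝ C(K, ℝ) ((⟨deriv g, hgc⟩ : C(ℝ, ℝ)).comp u), ?_, ?_⟩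
    · have h1 : ContDiff ℝ n (fun w : C(K, ℝ) => ContinuousLinearMap.mul ℝ C(K, ℝ) w) :=
        ContinuousLinearMap.contDiff (E := C(K, ℝ)) (F := C(K, ℝ) →L[ℝ] C(K, ℝ)) _
      exact h1.comp (ih ⟨deriv g, hgc⟩ hc)
    · intro u
      exact hasFDerivAt_comp_continuousMap (fun x => (hd x).hasDerivAt) u

theorem contDiff_two_of_hasDerivAt {F F₁ F₂ : ℝ → ℝ} (h1 : ∀ x, HasDerivAt F (F₁ x) x)
    (h2 : ∀ x, HasDerivAt F₁ (F₂ x) x) (hc : Continuous F₂) : ContDiff ℝ 2 F := by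
  have e1 : deriv F = F₁ := funext fun x => (h1 x).deriv
  have e2 : deriv F₁ = F₂ := funext fun x => (h2 x).deriv
  rw [show (2 : WithTop ℕ∞) = 1 + 1 from rfl, contDiff_succ_iff_deriv]
  refine ⟨fun x => (h1 x).differentiableAt, by simp, ?_⟩
  rw [e1, contDiff_one_iff_deriv, e2]
  exact ⟨fun x => (h2 x).differentiableAt, hc⟩

/-- A `C^2` function on a compact interval extends to a `C^2` function on the line. -/
theorem exists_contDiff_two_extension {f : ℝ → ℝ} {R : ℝ} (hR : 0 < R)
    (hf : ContDiffOn ℝ 2 f (Icc 0 R)) :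
    ∃ F : ℝ → ℝ, ContDiff ℝ 2 F ∧ EqOn F f (Icc 0 R) := by
  have hu := uniqueDiffOn_Icc hR
  obtain ⟨hd, -, hf1⟩ := (contDiffOn_succ_iff_derivWithin (n := 1) hu).1 hf
  obtain ⟨hd1, -, hf2⟩ := (contDiffOn_succ_iff_derivWithin (n := 0) hu).1 hf1
  set f₁ := derivWithin f (Icc 0 R)
  set f₂ := derivWithin f₁ (Icc 0 R)
  -- The second derivative is extended by constants and integrated twice from the data at 0.
  set e : ℝ → ℝ := IccExtend hR.le ((Icc 0 R).domRestrict f₂) with he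
  have hec : Continuous e := (continuousOn_iff_continuous_domRestrict.1 hf2.continuousOn).Icc_extend'
  set F₁ : ℝ → ℝ := fun x => f₁ 0 + ∫ t in (0 : ℝ)..x, e t with hF₁
  have h2 : ∀ x, HasDerivAt F₁ (e x) x := fun x =>
    ((hec.integral_hasStrictDerivAt 0 x).hasDerivAt).const_add _
  have hF₁c : Continuous F₁ := continuous_iff_continuousAt.2 fun x => (h2 x).continuousAt
  set F : ℝ → ℝ := fun x => f 0 + ∫ t in (0 : ℝ)..x, F₁ t with hF
  have h1 : ∀ x, HasDerivAt F (F₁ x) x := fun x =>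
    ((hF₁c.integral_hasStrictDerivAt 0 x).hasDerivAt).const_add _
  refine ⟨F, contDiff_two_of_hasDerivAt h1 h2 hec, ?_⟩
  have e1 : ∀ t ∈ Icc 0 R, F₁ t = f₁ t := eqOn_of_hasDerivWithinAt_Icc
    (fun t _ => (h2 t).hasDerivWithinAt)
    (fun t ht => by
      rw [he, IccExtend_of_mem _ _ ht]
      exact (hd1 t ht).hasDerivWithinAt) (by simp [hF₁])
  exact eqOn_of_hasDerivWithinAt_Icc (fun t _ => (h1 t).hasDerivWithinAt)
    (fun t ht => by
      rw [e1 t ht]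
      exact (hd t ht).hasDerivWithinAt) (by simp [hF])

theorem isConvexSource_of_contDiffOn {f : ℝ → ℝ} {r : ℝ}
    (hf : ContDiffOn ℝ 2 f (Ico 0 r)) (hpos : ∀ u ∈ Ico 0 r, 0 < f u)
    (hinc : ∀ u ∈ Ioo 0 r, 0 < deriv f u) (hconv : ∀ u ∈ Ioo 0 r, 0 < deriv (deriv f) u) :
    IsConvexSource r f (derivWithin f (Ico 0 r)) where
  pos := hpos
  strictMonoOn := strictMonoOn_of_deriv_pos (convex_Ico 0 r) hf.continuousOn (by
    rw [interior_Ico]; exact hinc)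
  strictConvexOn := strictConvexOn_of_deriv2_pos (convex_Ico 0 r) hf.continuousOn (by
    rw [interior_Ico]; exact hconv)
  hasDeriv x hx := (hf.differentiableOn (by norm_num) x hx).hasDerivWithinAt
  deriv_nonneg x hx := (strictMonoOn_of_deriv_pos (convex_Ico 0 r) hf.continuousOn (by
    rw [interior_Ico]; exact hinc)).monotoneOn.derivWithin_nonneg
  lipschitz p hp := by
    obtain ⟨K, hK⟩ := (hf.mono (fun x hx => ⟨hx.1, hx.2.trans_lt hp⟩ :
      Icc 0 p ⊆ Ico 0 r)).exists_lipschitzOnWith (by norm_num) (convex_Icc 0 p) isCompact_Icc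
    refine ⟨K, K.2, fun x hx y hy hxy => ?_⟩
    have := hK.dist_le_mul y hy x hx
    rw [Real.dist_eq, Real.dist_eq, abs_of_nonneg (by linarith : 0 ≤ y - x)] at this
    exact (le_abs_self _).trans this

/-! ### Nondegeneracy of the linearized problem -/

/-- The linearized clamped problem together with `z(1/2) = 0` has only the trivial solution. -/
theorem IsProfile.linearized_eq_zero {f f' : ℝ → ℝ} {p T η : ℝ} {v Z : ℕ → ℝ → ℝ}
    (hv : IsProfile f p T v) (hf : ∀ x ∈ Icc 0 p, 0 < f x)
    (hd : ∀ x ∈ Icc 0 p, HasDerivAt f (f' x) x) (hf' : ∀ x ∈ Icc 0 p, 0 ≤ f' x)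
    (hc : ContinuousOn f' (Icc 0 p)) (hv3 : v 3 0 = 0) (hZ : DerivChain 0 T Z)
    (hZ4 : ∀ t ∈ Icc 0 T, Z 4 t = f' (v 0 t) * Z 0 t - η * f (v 0 t))
    (z0 : Z 0 0 = 0) (z1 : Z 1 0 = 0) (z3 : Z 3 0 = 0) (zT : Z 0 T = 0) (zT' : Z 1 T = 0) :
    ∀ t ∈ Icc 0 T, Z 0 t = 0 := by
  have hT := hv.T_pos
  have mv : ∀ t ∈ Icc 0 T, v 0 t ∈ Icc 0 p := fun t ht => ⟨hv.nonneg t ht, hv.le t ht⟩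
  obtain ⟨L, hL⟩ := isCompact_Icc.exists_bound_of_continuousOn hc
  have hLb : ∀ t ∈ Icc 0 T, f' (v 0 t) ≤ |L| := fun t ht =>
    (le_abs_self _).trans ((hL _ (mv t ht)).trans (le_abs_self L))
  -- The function t v' generates the scaling of v, and (t v')'''' = f'(v) t v' + 4 f(v). Adding
  -- (η/4) t v' to Z therefore cancels the inhomogeneous term. The i-th derivative of t v' is t
  -- v^(i+1) + i v^(i).
  set κ := η / 4 with hκ
  set y : ℕ → ℝ → ℝ := fun i t => Z i t + κ * (t * (if i = 4 then f' (v 0 t) * v 1 t else v (i + 1) t)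
    + (i : ℝ) * v i t) with hy
  have hych : DerivChain 0 T y := by
    intro i hi t ht
    have hid := hasDerivWithinAt_id t (Icc 0 T)
    have h1 : HasDerivWithinAt (fun t => if i = 4 then f' (v 0 t) * v 1 t else v (i + 1) t)
        (if i + 1 = 4 then f' (v 0 t) * v 1 t else v (i + 1 + 1) t) (Icc 0 T) t := by
      have e1 : ¬ (i = 4) := by omega
      simp only [e1, if_false]
      rcases Nat.lt_or_ge i 3 with h6 | h6
      · have e2 : ¬ (i + 1 = 4) := by omega
        simp only [e2, if_false]
        exact hv.chain (i + 1) (by omega) t ht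
      · obtain rfl : i = 3 := by omega
        have := (hd _ (mv t ht)).comp_hasDerivWithinAt t (hv.chain 0 (by norm_num) t ht)
        exact this.congr (fun u hu => hv.eqn u hu) (hv.eqn t ht)
    have := (hZ i hi t ht).add (((hid.mul h1).add
      ((hv.chain i hi t ht).const_mul (i : ℝ))).const_mul κ)
    refine this.congr_deriv ?_
    have e1 : ¬ (i = 4) := by omega
    simp only [hy, e1, if_false, id]
    push_cast
    ring
  have y4 : ∀ t ∈ Icc 0 T, y 4 t = f' (v 0 t) * y 0 t := fun t ht => by
    simp only [hy, if_true, hZ4 t ht, hv.eqn t ht]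
    norm_num
    rw [hκ]
    ring
  have y0 : y 0 0 = 0 := by simp [hy, z0]
  have y1 : y 1 0 = 0 := by simp [hy, z1, hv.init']
  have y3 : y 3 0 = 0 := by simp [hy, z3, hv3]
  have yT : y 0 T = 0 := by simp [hy, zT, hv.fin']
  -- Only w''(0) is free. If it is nonnegative, comparison gives w ≥ 0, and if it is positive,
  -- growth gives w(T) > 0. Applied to y and -y, this yields y = 0.
  have key : ∀ w : ℕ → ℝ → ℝ, DerivChain 0 T w → (∀ t ∈ Icc 0 T, w 4 t = f' (v 0 t) * w 0 t) →
      w 0 0 = 0 → w 1 0 = 0 → w 3 0 = 0 → w 0 T = 0 → 0 ≤ w 2 0 →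
      w 2 0 = 0 ∧ ∀ t ∈ Icc 0 T, 0 ≤ w 0 t := by
    intro w cw w4 w0 w1 w3 wT w2
    have hn := cw.ivp_nonneg (abs_nonneg L) (by
      intro i hi
      interval_cases i <;> simp [w0, w1, w3, w2]) (by
      intro t ht
      rw [w4 t ht]
      rcases le_total 0 (w 0 t) with h | h
      · rw [min_eq_right h, mul_zero]
        exact mul_nonneg (hf' _ (mv t ht)) h
      · rw [min_eq_left h]
        exact mul_le_mul_of_nonpos_right (hLb t ht) h)
    refine ⟨?_, hn⟩
    by_contra hne
    have := (cw.growth hT (fun t ht => by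
      rw [w4 t ht]; exact mul_nonneg (hf' _ (mv t ht)) (hn t ht)) w1.ge w2 w3.ge
      (Or.inr (Or.inl hne))).1
    linarith
  have hyz : ∀ t ∈ Icc 0 T, y 0 t = 0 := by
    have n4 : ∀ t ∈ Icc 0 T, -y 4 t = f' (v 0 t) * -y 0 t := fun t ht => by rw [y4 t ht]; ring
    have hy2 : y 2 0 = 0 := by
      rcases le_total 0 (y 2 0) with h | h
      · exact (key y hych y4 y0 y1 y3 yT h).1
      · have := (key _ hych.neg n4 (by simp [y0]) (by simp [y1]) (by simp [y3]) (by simp [yT])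
          (by simpa using h)).1
        linarith
    intro t ht
    have h1 := (key y hych y4 y0 y1 y3 yT hy2.ge).2 t ht
    have h2 := (key _ hych.neg n4 (by simp [y0]) (by simp [y1]) (by simp [y3]) (by simp [yT])
          (by simp [hy2])).2 t ht
    linarith
  -- The clamped conditions reduce y'(T) to κ T v''(T), and v''(T) > 0, so κ = 0 and Z = y = 0.
  have hy1 := hych.eq_zero_of_const hT (i := 0) (by norm_num) hyz T (right_mem_Icc.2 hT.le)
  simp [hy, zT', hv.fin'] at hy1
  have h2 := hv.second_deriv_pos hf hv3
  have hκ0 : κ = 0 := by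
    rcases hy1 with h | h | h
    · exact h
    · linarith
    · linarith
  intro t ht
  have := hyz t ht
  simpa [hy, hκ0] using this

/-! ### The equation with prescribed maximum p -/

/-- The symmetrized Green operator on continuous functions. -/
noncomputable def greenOp : C(unitInterval, ℝ) →L[ℝ] C(unitInterval, ℝ) := derCLM 4 0 ∘L symGreen

theorem greenOp_apply (h : C(unitInterval, ℝ)) (x : unitInterval) :
    greenOp h x = (symGreen h).der 0 x := rfl

theorem isCompactOperator_greenOp : IsCompactOperator greenOp :=
  isCompactOperator_derCLM.comp_clm symGreen

/-- `greenOp (F ∘ u)` at the midpoint. -/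
noncomputable def midGreen (F : C(ℝ, ℝ)) (u : C(unitInterval, ℝ)) : ℝ := greenOp (F.comp u) midpt

/-- The equation for a solution `u` with maximum `p`. -/
noncomputable def branchEq (F : C(ℝ, ℝ)) (q : ℝ × C(unitInterval, ℝ)) : C(unitInterval, ℝ) :=
  -- This is u = λ G(F ∘ u) with λ = p / G(F ∘ u)(1/2), freed of the denominator so that the map is
  -- C² everywhere, including at p = 0.
  midGreen F q.2 • q.2 - q.1 • greenOp (F.comp q.2)

/-- `u` solves the problem with maximum `p`, for some parameter. -/
structure IsBranchPoint (F : C(ℝ, ℝ)) (p : ℝ) (u : C(unitInterval, ℝ)) : Prop where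
  nonneg : ∀ x, 0 ≤ u x
  le : ∀ x, u x ≤ p
  eqn : branchEq F (p, u) = 0

/-- A globally defined nonlinearity that is admissible on `[0, R]`. -/
structure IsGlobalSource (R : ℝ) (F : C(ℝ, ℝ)) : Prop where
  R_pos : 0 < R
  contDiff : ContDiff ℝ 2 F
  pos : ∀ x ∈ Icc 0 R, 0 < F x
  monotoneOn : MonotoneOn F (Icc 0 R)
  deriv_nonneg : ∀ x ∈ Icc 0 R, 0 ≤ deriv F x

theorem contDiff_midGreen {F : C(ℝ, ℝ)} (hF : ContDiff ℝ 2 F) : ContDiff ℝ 2 (midGreen F) :=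
  ((ContinuousMap.evalCLM ℝ midpt) ∘L greenOp).contDiff.comp
    (contDiff_comp_continuousMap 2 F hF)

theorem contDiff_branchEq {F : C(ℝ, ℝ)} (hF : ContDiff ℝ 2 F) : ContDiff ℝ 2 (branchEq F) :=
  (((contDiff_midGreen hF).comp contDiff_snd).smul contDiff_snd).sub
    (contDiff_fst.smul (greenOp.contDiff.comp
      ((contDiff_comp_continuousMap 2 F hF).comp contDiff_snd)))

theorem eq_smul_of_branchEq {F : C(ℝ, ℝ)} {p : ℝ} {u : C(unitInterval, ℝ)}
    (h : branchEq F (p, u) = 0) (h0 : midGreen F u ≠ 0) :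
    u = (p / midGreen F u) • greenOp (F.comp u) := by
  have h1 : midGreen F u • u = p • greenOp (F.comp u) := sub_eq_zero.1 h
  rw [div_eq_inv_mul, mul_smul, ← h1, smul_smul, inv_mul_cancel₀ h0, one_smul]

namespace IsBranchPoint

variable {F : C(ℝ, ℝ)} {p R : ℝ} {u : C(unitInterval, ℝ)}

theorem comp_pos (hF : IsGlobalSource R F) (h : IsBranchPoint F p u) (hp : p ≤ R)
    (x : unitInterval) : 0 < F.comp u x := hF.pos _ ⟨h.nonneg x, (h.le x).trans hp⟩

theorem midGreen_pos (hF : IsGlobalSource R F) (h : IsBranchPoint F p u) (hp : p ≤ R) :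
    0 < midGreen F u :=
  symGreen_midpt_pos (fun x _ => (h.comp_pos hF hp x).le) (h.comp_pos hF hp midpt)

theorem p_nonneg (h : IsBranchPoint F p u) : 0 ≤ p := (h.nonneg 0).trans (h.le 0)

theorem eq_symGreen (hF : IsGlobalSource R F) (h : IsBranchPoint F p u) (hp : p ≤ R) :
    u = (symGreen ((p / midGreen F u) • F.comp u)).der 0 := by
  conv_lhs => rw [eq_smul_of_branchEq h.eqn (h.midGreen_pos hF hp).ne']
  rw [← map_smul]
  rfl

theorem midpt_eq (hF : IsGlobalSource R F) (h : IsBranchPoint F p u) (hp : p ≤ R) :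
    u midpt = p := by
  have h1 := congrArg (fun g => g midpt) (eq_smul_of_branchEq h.eqn (h.midGreen_pos hF hp).ne')
  have h2 : u midpt = p / midGreen F u * midGreen F u := h1
  rwa [div_mul_cancel₀ _ (h.midGreen_pos hF hp).ne'] at h2

theorem isProfile (hF : IsGlobalSource R F) (h : IsBranchPoint F p u) (hp : p ≤ R) (hp0 : 0 < p) :
    IsProfile (fun x => p / midGreen F u * F x) p (1 / 2)
      (symGreen ((p / midGreen F u) • F.comp u)).half := by
  set U := symGreen ((p / midGreen F u) • F.comp u) with hU
  have hu : u = U.der 0 := h.eq_symGreen hF hp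
  have hc : U.Clamped := symGreen_clamped _
  have hr : U.reflect = U := symGreen_reflect _
  have hm : ∀ t ∈ Icc (0 : ℝ) (1 / 2), 1 / 2 + t ∈ Icc (0 : ℝ) 1 := fun t ht =>
    ⟨by linarith [ht.1], by linarith [ht.2]⟩
  have h0 : ∀ t, ∀ ht : t ∈ Icc (0 : ℝ) (1 / 2), U.half 0 t = u ⟨_, hm t ht⟩ := fun t ht => by
    rw [CkFun.half, CkFun.fn_eq_der (by norm_num) (hm t ht)]
    exact congrArg (fun g => g ⟨1 / 2 + t, hm t ht⟩) hu.symm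
  exact
  { T_pos := by norm_num
    p_pos := hp0
    chain := U.half_chain
    init := by
      rw [h0 0 (by norm_num)]
      convert h.midpt_eq hF hp using 2
      exact Subtype.ext (by simp [midpt])
    init' := by rw [CkFun.half, add_zero]; exact (CkFun.fn_half_of_reflect hr).1
    fin := by rw [CkFun.half, add_halves]; exact hc.fn_right
    fin' := by rw [CkFun.half, add_halves]; exact hc.fn_right'
    nonneg := fun t ht => by rw [h0 t ht]; exact h.nonneg _
    le := fun t ht => by rw [h0 t ht]; exact h.le _
    eqn := fun t ht => by
      rw [h0 t ht, CkFun.half, CkFun.fn_eq_der (by norm_num) (hm t ht)]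
      change (p / midGreen F u) * F (u (foldMap _)) = _
      rw [foldMap_of_le (x := ⟨_, hm t ht⟩) (by change (1 / 2 : ℝ) ≤ 1 / 2 + t; linarith [ht.1])] }

theorem half_three (F : C(ℝ, ℝ)) (p : ℝ) (u : C(unitInterval, ℝ)) :
    (symGreen ((p / midGreen F u) • F.comp u)).half 3 0 = 0 := by
  rw [CkFun.half, add_zero]; exact (CkFun.fn_half_of_reflect (symGreen_reflect _)).2

end IsBranchPoint

/-- The derivative of `branchEq F` in `u`. -/
noncomputable def branchDeriv (F F' : C(ℝ, ℝ)) (p : ℝ) (u : C(unitInterval, ℝ)) :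
    C(unitInterval, ℝ) →L[ℝ] C(unitInterval, ℝ) :=
  midGreen F u • ContinuousLinearMap.id ℝ C(unitInterval, ℝ) +
    ((ContinuousMap.evalCLM ℝ midpt ∘L greenOp) ∘L
      (ContinuousLinearMap.mul ℝ C(unitInterval, ℝ) (F'.comp u))).smulRight u -
    p • (greenOp ∘L (ContinuousLinearMap.mul ℝ C(unitInterval, ℝ) (F'.comp u)))

theorem fderiv_branchEq_comp_inr {F F' : C(ℝ, ℝ)} (hF : ContDiff ℝ 2 F)
    (hd : ∀ x, HasDerivAt F (F' x) x) (p : ℝ) (u : C(unitInterval, ℝ)) :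
    fderiv ℝ (branchEq F) (p, u) ∘L .inr ℝ ℝ C(unitInterval, ℝ) = branchDeriv F F' p u := by
  have hN := hasFDerivAt_comp_continuousMap hd u
  have hG : HasFDerivAt (fun u => greenOp (F.comp u))
      (greenOp ∘L (ContinuousLinearMap.mul ℝ C(unitInterval, ℝ) (F'.comp u))) u :=
    greenOp.hasFDerivAt.comp u hN
  have hM : HasFDerivAt (midGreen F) ((ContinuousMap.evalCLM ℝ midpt ∘L greenOp) ∘L
      (ContinuousLinearMap.mul ℝ C(unitInterval, ℝ) (F'.comp u))) u :=
    (ContinuousMap.evalCLM ℝ midpt ∘L greenOp).hasFDerivAt.comp u hN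
  have h1 : HasFDerivAt (fun w => branchEq F (p, w)) (branchDeriv F F' p u) u :=
    (hM.smul (hasFDerivAt_id u)).sub (hG.const_smul p)
  have h2 : HasFDerivAt (branchEq F) (fderiv ℝ (branchEq F) (p, u)) (p, u) :=
    ((contDiff_branchEq hF).differentiable (by norm_num) _).hasFDerivAt
  have h3 : HasFDerivAt (fun w => branchEq F (p, w))
      (fderiv ℝ (branchEq F) (p, u) ∘L .inr ℝ ℝ C(unitInterval, ℝ)) u :=
    h2.comp u (hasFDerivAt_prodMk_right p u)
  exact h3.unique h1

/-- For z in the kernel, z = l G(F'(u) z) - η u, where u = l G(F(u)) and η is the relative change of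
G(F(u))(1/2). So z is a clamped solution of the linearized equation with λ varied, and z(1/2) = 0
because the maximum is fixed: the situation of `IsProfile.linearized_eq_zero`. -/
theorem branchDeriv_injective {F F' : C(ℝ, ℝ)} {R p : ℝ} {u : C(unitInterval, ℝ)}
    (hF : IsGlobalSource R F) (hd : ∀ x, HasDerivAt F (F' x) x) (h : IsBranchPoint F p u)
    (hp : p ≤ R) {z : C(unitInterval, ℝ)} (hz : branchDeriv F F' p u z = 0) : z = 0 := by
  have hm := h.midGreen_pos hF hp
  set l := p / midGreen F u with hl
  set g := greenOp (F'.comp u * z) with hg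
  set η := g midpt / midGreen F u with hη
  have hp0 := h.p_nonneg
  have e1 : midGreen F u • z + g midpt • u - p • g = 0 := hz
  have e2 : z = l • g - η • u := by
    have : midGreen F u • z = p • g - g midpt • u := by rw [← sub_eq_zero, ← e1]; abel
    rw [hl, hη, div_eq_inv_mul, div_eq_inv_mul, mul_smul, mul_smul, ← smul_sub, ← this, smul_smul,
      inv_mul_cancel₀ hm.ne', one_smul]
  rcases hp0.eq_or_lt with rfl | hp0
  · have hu : u = 0 := ContinuousMap.ext fun x => le_antisymm (h.le x) (h.nonneg x)
    rw [e2, hu, hl]; simp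
  set U := symGreen (l • F.comp u) with hU
  have hu : u = U.der 0 := h.eq_symGreen hF hp
  set Z := symGreen (l • (F'.comp u * z) - η • (l • F.comp u)) with hZ
  have hzZ : z = Z.der 0 := by
    rw [e2, ← derCLM_apply, hZ, map_sub, map_sub, map_smul, map_smul, map_smul (symGreen) η,
      map_smul (derCLM 4 0) η, derCLM_apply, derCLM_apply, ← hU, ← hu]
    rfl
  have hprof := h.isProfile hF hp hp0
  have hmem : ∀ t ∈ Icc (0 : ℝ) (1 / 2), 1 / 2 + t ∈ Icc (0 : ℝ) 1 := fun t ht =>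
    ⟨by linarith [ht.1], by linarith [ht.2]⟩
  have hlp : 0 < l := div_pos hp0 hm
  have hsub : ∀ x ∈ Icc 0 p, x ∈ Icc 0 R := fun x hx => ⟨hx.1, hx.2.trans hp⟩
  have hzero := hprof.linearized_eq_zero (f' := fun x => l * F' x) (η := η) (Z := Z.half)
    (fun x hx => mul_pos hlp (hF.pos x (hsub x hx))) (fun x _ => (hd x).const_mul l)
    (fun x hx => mul_nonneg hlp.le (by
      rw [← (hd x).deriv]; exact hF.deriv_nonneg x (hsub x hx)))
    (by fun_prop) (IsBranchPoint.half_three F p u) Z.half_chain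
    (fun t ht => by
      have e0 : U.half 0 t = u ⟨_, hmem t ht⟩ := by
        rw [CkFun.half, CkFun.fn_eq_der (by norm_num) (hmem t ht)]
        exact congrArg (fun g => g ⟨1 / 2 + t, hmem t ht⟩) hu.symm
      have e3 : Z.half 0 t = z ⟨_, hmem t ht⟩ := by
        rw [CkFun.half, CkFun.fn_eq_der (by norm_num) (hmem t ht)]
        exact congrArg (fun g => g ⟨1 / 2 + t, hmem t ht⟩) hzZ.symm
      rw [e0, e3, CkFun.half, CkFun.fn_eq_der (by norm_num) (hmem t ht)]
      have hf : foldMap ⟨1 / 2 + t, hmem t ht⟩ = ⟨1 / 2 + t, hmem t ht⟩ :=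
        foldMap_of_le (by change (1 / 2 : ℝ) ≤ 1 / 2 + t; linarith [ht.1])
      have := symGreen_der_four (l • (F'.comp u * z) - η • (l • F.comp u)) ⟨1 / 2 + t, hmem t ht⟩
      rw [hf] at this
      refine Eq.trans this ?_
      change l * (F' (u ⟨_, hmem t ht⟩) * z ⟨_, hmem t ht⟩) - η * (l * F (u ⟨_, hmem t ht⟩)) = _
      ring)
    (by
      rw [CkFun.half, add_zero]
      have e3 : Z.fn 0 (1 / 2) = z midpt := by rw [hzZ]; exact Z.fn_coe 0 midpt
      rw [e3, e2]
      change l * g midpt - η * u midpt = 0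
      rw [h.midpt_eq hF hp, hl, hη]
      ring)
    (by rw [CkFun.half, add_zero]; exact (CkFun.fn_half_of_reflect (symGreen_reflect _)).1)
    (by rw [CkFun.half, add_zero]; exact (CkFun.fn_half_of_reflect (symGreen_reflect _)).2)
    (by rw [CkFun.half, add_halves]; exact (symGreen_clamped _).fn_right)
    (by rw [CkFun.half, add_halves]; exact (symGreen_clamped _).fn_right')
  rw [hzZ]
  ext x
  rw [CkFun.der_zero_eq_half_abs (symGreen_reflect _) x]
  exact hzero _ (abs_sub_half_mem x)

/-- The derivative is a nonzero multiple of the identity minus a compact operator, so by the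
Fredholm alternative injectivity is enough. -/
theorem branchDeriv_isInvertible {F F' : C(ℝ, ℝ)} {R p : ℝ} {u : C(unitInterval, ℝ)}
    (hF : IsGlobalSource R F) (hd : ∀ x, HasDerivAt F (F' x) x) (h : IsBranchPoint F p u)
    (hp : p ≤ R) : (branchDeriv F F' p u).IsInvertible := by
  have hm := h.midGreen_pos hF hp
  set M := ContinuousLinearMap.mul ℝ C(unitInterval, ℝ) (F'.comp u) with hM
  set T : C(unitInterval, ℝ) →L[ℝ] C(unitInterval, ℝ) :=
    (midGreen F u)⁻¹ • (p • (greenOp ∘L M) -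
      ((ContinuousMap.evalCLM ℝ midpt ∘L greenOp) ∘L M).smulRight u) with hT
  have hdec : branchDeriv F F' p u =
      midGreen F u • (algebraMap ℝ (C(unitInterval, ℝ) →L[ℝ] C(unitInterval, ℝ)) 1 - T) := by
    ext1 z
    rw [hT, map_one]
    simp only [branchDeriv, sub_apply, add_apply, smul_apply, one_apply_eq_self, smul_sub, smul_smul,
      mul_inv_cancel₀ hm.ne', mul_inv_cancel_left₀ hm.ne', one_smul, ContinuousLinearMap.id_apply,
      ← hM]
    abel
  have hcT : IsCompactOperator T := by
    refine IsCompactOperator.smul ?_ (midGreen F u)⁻¹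
    refine IsCompactOperator.sub ?_ ?_
    · exact IsCompactOperator.smul (isCompactOperator_greenOp.comp_clm M) p
    · have h1 : IsCompactOperator ((ContinuousMap.evalCLM ℝ midpt ∘L greenOp) ∘L M) :=
        isCompactOperator_greenOp.clm_comp (ContinuousMap.evalCLM ℝ midpt) |>.comp_clm M
      exact h1.clm_comp ((ContinuousLinearMap.id ℝ ℝ).smulRight u)
  rcases hcT.hasEigenvalue_or_mem_resolventSet one_ne_zero with he | he
  · exfalso
    obtain ⟨z, hz⟩ := he.exists_hasEigenvector
    refine hz.2 (branchDeriv_injective hF hd h hp ?_)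
    have hTz : T z = z := by simpa using hz.apply_eq_smul
    rw [hdec, map_one]
    simp [hTz]
  · have hU : IsUnit (branchDeriv F F' p u) := by
      rw [hdec]
      have h1 : IsUnit (algebraMap ℝ (C(unitInterval, ℝ) →L[ℝ] C(unitInterval, ℝ)) 1 - T) := he
      rw [ContinuousLinearMap.isUnit_iff_bijective] at h1 ⊢
      exact (MulAction.bijective₀ hm.ne').comp h1
    obtain ⟨e, he⟩ := hU
    exact ⟨ContinuousLinearEquiv.ofUnit e, he⟩

/-- The bounds 0 ≤ u ≤ p come for free: u is a nonnegative multiple of G applied to a positive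
function, which lies between 0 and its midpoint value. Hence admissibility survives small
perturbations. -/
theorem isBranchPoint_of_branchEq {F : C(ℝ, ℝ)} {p : ℝ} {u : C(unitInterval, ℝ)} (hp : 0 ≤ p)
    (hpos : ∀ x, 0 < F.comp u x) (h : branchEq F (p, u) = 0) : IsBranchPoint F p u := by
  have hm : 0 < midGreen F u := symGreen_midpt_pos (fun x _ => (hpos x).le) (hpos midpt)
  have hu := eq_smul_of_branchEq h hm.ne'
  have key : ∀ x, u x = p / midGreen F u * greenOp (F.comp u) x := fun x =>
    congrArg (fun g => g x) hu
  have hl : 0 ≤ p / midGreen F u := div_nonneg hp hm.le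
  refine ⟨fun x => ?_, fun x => ?_, h⟩
  · rw [key]
    exact mul_nonneg hl (symGreen_bounds (fun x _ => (hpos x).le) x).1
  · rw [key]
    calc p / midGreen F u * greenOp (F.comp u) x ≤ p / midGreen F u * midGreen F u :=
          mul_le_mul_of_nonneg_left (symGreen_bounds (fun x _ => (hpos x).le) x).2 hl
      _ = p := div_mul_cancel₀ _ hm.ne'

/-- Near a branch point the solutions form a `C^2` curve parametrized by the maximum. -/
theorem exists_local_branch {F : C(ℝ, ℝ)} {R p₀ : ℝ} {u₀ : C(unitInterval, ℝ)}
    (hF : IsGlobalSource R F) (h : IsBranchPoint F p₀ u₀) (hp : p₀ ≤ R) :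
    ∃ φ : ℝ → C(unitInterval, ℝ), ContDiffAt ℝ 2 φ p₀ ∧ φ p₀ = u₀ ∧
      ∀ᶠ p in 𝓝 p₀, 0 ≤ p → IsBranchPoint F p (φ p) := by
  have hc1 : ContDiff ℝ 1 (deriv F) := by
    have := hF.contDiff
    rw [show (2 : WithTop ℕ∞) = 1 + 1 from rfl, contDiff_succ_iff_deriv] at this
    exact this.2.2
  set F' : C(ℝ, ℝ) := ⟨deriv F, hc1.continuous⟩
  have hd : ∀ x, HasDerivAt F (F' x) x := fun x =>
    (hF.contDiff.differentiable (by norm_num) x).hasDerivAt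
  have cdf : ContDiffAt ℝ 2 (branchEq F) (p₀, u₀) := (contDiff_branchEq hF.contDiff).contDiffAt
  have inv : (fderiv ℝ (branchEq F) (p₀, u₀) ∘L .inr ℝ ℝ C(unitInterval, ℝ)).IsInvertible := by
    rw [fderiv_branchEq_comp_inr hF.contDiff hd]
    exact branchDeriv_isInvertible hF hd h hp
  have n2 : (2 : WithTop ℕ∞) ≠ 0 := by norm_num
  set φ := cdf.implicitFunction n2 inv with hφ
  have hφ0 : φ p₀ = u₀ := cdf.implicitFunction_apply_self n2 inv
  have hφc : ContDiffAt ℝ 2 φ p₀ := cdf.contDiffAt_implicitFunction n2 inv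
  refine ⟨φ, hφc, hφ0, ?_⟩
  have ev1 : ∀ᶠ p in 𝓝 p₀, branchEq F (p, φ p) = branchEq F (p₀, u₀) :=
    cdf.eventually_apply_implicitFunction n2 inv
  have hF0 : 0 < F 0 := hF.pos 0 ⟨le_rfl, hF.R_pos.le⟩
  -- A priori φ(p) might leave [0, R], but F(u₀) ≥ F(0) > 0 uniformly, so F ∘ φ(p) stays positive
  -- near p₀; that suffices.
  have hcont : ContinuousAt (fun p => F.comp (φ p)) p₀ :=
    (ContinuousMap.continuous_postcomp F).continuousAt.comp hφc.continuousAt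
  have ev2 := hcont (Metric.ball_mem_nhds _ hF0)
  filter_upwards [ev1, ev2] with p h1 h2 hp0
  refine isBranchPoint_of_branchEq hp0 (fun x => ?_) (h1.trans h.eqn)
  rw [hφ0] at h2
  have h3 : dist (F.comp (φ p)) (F.comp u₀) < F 0 := h2
  have h4 := (ContinuousMap.dist_apply_le_dist x).trans_lt h3
  have h5 : F 0 ≤ F.comp u₀ x := hF.monotoneOn ⟨le_rfl, hF.R_pos.le⟩
    ⟨h.nonneg x, (h.le x).trans hp⟩ (h.nonneg x)
  rw [Real.dist_eq, abs_lt] at h4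
  linarith [h4.1]

theorem isBranchPoint_zero (F : C(ℝ, ℝ)) : IsBranchPoint F 0 0 :=
  ⟨fun _ => le_rfl, fun _ => le_rfl, by simp [branchEq]⟩

/-- Since F(u) ≥ F(0), the factor p / G(F(u))(1/2) is at most R / c with c = G(F(0))(1/2). So u is
the image under the compact operator G of a function of norm at most R F(R) / c. -/
theorem IsBranchPoint.mem_compact {F : C(ℝ, ℝ)} {R : ℝ} (hF : IsGlobalSource R F) :
    ∃ K : Set C(unitInterval, ℝ), IsCompact K ∧
      ∀ p u, p ≤ R → IsBranchPoint F p u → u ∈ K := by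
  have hF0 : 0 < F 0 := hF.pos 0 ⟨le_rfl, hF.R_pos.le⟩
  have h0R : (0 : ℝ) ∈ Icc 0 R := ⟨le_rfl, hF.R_pos.le⟩
  set c := greenOp (ContinuousMap.const unitInterval (F 0)) midpt with hc
  have hcp : 0 < c := symGreen_midpt_pos (fun _ _ => hF0.le) hF0
  obtain ⟨K, hK, hsub⟩ := isCompactOperator_greenOp.image_closedBall_subset_compact
    (f := greenOp.toLinearMap) (R / c * F R)
  refine ⟨K, hK, fun p u hp h => hsub ?_⟩
  have hm := h.midGreen_pos hF hp
  refine ⟨(p / midGreen F u) • F.comp u, ?_, ?_⟩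
  · have hcm : c ≤ midGreen F u := by
      have := (symGreen_bounds (h := F.comp u - ContinuousMap.const unitInterval (F 0))
        (fun x _ => sub_nonneg.2 (hF.monotoneOn h0R ⟨h.nonneg x, (h.le x).trans hp⟩
          (h.nonneg x))) midpt).1
      rw [← greenOp_apply, map_sub] at this
      exact sub_nonneg.1 this
    rw [Metric.mem_closedBall, dist_zero_right, norm_smul]
    refine mul_le_mul ?_ ?_ (norm_nonneg _) (div_nonneg hF.R_pos.le hcp.le)
    · rw [Real.norm_of_nonneg (div_nonneg h.p_nonneg hm.le)]
      exact div_le_div₀ hF.R_pos.le hp hcp hcm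
    · have hRR : R ∈ Icc 0 R := ⟨hF.R_pos.le, le_rfl⟩
      rw [ContinuousMap.norm_le _ (hF.pos R hRR).le]
      intro x
      rw [Real.norm_of_nonneg (h.comp_pos hF hp x).le]
      exact hF.monotoneOn ⟨h.nonneg x, (h.le x).trans hp⟩ hRR ((h.le x).trans hp)
  · change greenOp _ = _
    rw [map_smul]
    exact (eq_smul_of_branchEq h.eqn hm.ne').symm

/-- For every `p ∈ [0, R]` there is a solution with maximum `p`. -/
theorem exists_isBranchPoint {F : C(ℝ, ℝ)} {R : ℝ} (hF : IsGlobalSource R F) :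
    ∀ p ∈ Icc 0 R, ∃ u, IsBranchPoint F p u := by
  -- Continuous induction: S ∩ [0, R] contains 0, is closed by compactness, and contains with each
  -- point p < R all slightly larger ones by the local branch.
  set S : Set ℝ := {p | ∃ u, IsBranchPoint F p u} with hS
  have hclosed : IsClosed (S ∩ Icc 0 R) := by
    obtain ⟨K, hK, hsub⟩ := IsBranchPoint.mem_compact hF
    have hc : IsClosed {q : ℝ × C(unitInterval, ℝ) | IsBranchPoint F q.1 q.2} := by
      have : {q : ℝ × C(unitInterval, ℝ) | IsBranchPoint F q.1 q.2} =
          (⋂ x : unitInterval, {q : ℝ × C(unitInterval, ℝ) | 0 ≤ q.2 x ∧ q.2 x ≤ q.1}) ∩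
            {q | branchEq F q = 0} := by
        ext q
        simp only [mem_ofPred_eq, mem_inter_iff, mem_iInter]
        exact ⟨fun h => ⟨fun x => ⟨h.nonneg x, h.le x⟩, h.eqn⟩,
          fun h => ⟨fun x => (h.1 x).1, fun x => (h.1 x).2, h.2⟩⟩
      rw [this]
      have hev : ∀ x : unitInterval, Continuous fun q : ℝ × C(unitInterval, ℝ) => q.2 x := fun x =>
        (ContinuousMap.evalCLM ℝ x).continuous.comp continuous_snd
      refine (isClosed_iInter fun x => ?_).inter
        (isClosed_eq (contDiff_branchEq hF.contDiff).continuous continuous_const)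
      exact (isClosed_le continuous_const (hev x)).inter (isClosed_le (hev x) continuous_fst)
    have hcomp := ((isCompact_Icc (a := (0 : ℝ)) (b := R)).prod hK).inter_right hc
    have := (hcomp.image continuous_fst).isClosed
    convert this using 1
    ext p
    constructor
    · rintro ⟨⟨u, hu⟩, hp⟩
      exact ⟨(p, u), ⟨⟨hp, hsub p u hp.2 hu⟩, hu⟩, rfl⟩
    · rintro ⟨⟨p, u⟩, ⟨⟨hp, -⟩, hu⟩, rfl⟩
      exact ⟨⟨u, hu⟩, hp⟩
  refine fun p hp => hclosed.Icc_subset_of_forall_mem_nhdsWithin (s := S)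
    ⟨0, isBranchPoint_zero F⟩ (fun p hp => ?_) hp
  obtain ⟨⟨u, hu⟩, hp0, hpR⟩ := hp
  obtain ⟨φ, -, -, hev⟩ := exists_local_branch hF hu hpR.le
  filter_upwards [hev.filter_mono nhdsWithin_le_nhds, self_mem_nhdsWithin] with q h1 h2
  exact ⟨φ q, h1 (hp0.trans (le_of_lt h2))⟩

/-! ### Positive solutions are determined by their maximum -/

theorem CkFun.continuous_fn {k : ℕ} (u : CkFun k) (i : ℕ) : Continuous (u.fn i) :=
  (u.der _).continuous.Icc_extend'

namespace IsPositiveSolution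

variable {f f' : ℝ → ℝ} {r lam lam₁ lam₂ : ℝ} {u u₁ u₂ u₃ : CkFun 4}

theorem fn_mem_Ico (h : IsPositiveSolution f r lam u) {t : ℝ} (ht : t ∈ Icc (0 : ℝ) 1) :
    u.fn 0 t ∈ Ico 0 r := by
  rw [CkFun.fn_eq_der (by norm_num) ht]
  exact ⟨h.nonneg _, h.lt _⟩

/-- The equation is postulated only in the open interval; both sides are continuous up to the ends.
-/
theorem fn_eqn (hs : IsConvexSource r f f') (h : IsPositiveSolution f r lam u) :
    ∀ t ∈ Icc (0 : ℝ) 1, u.fn 4 t = lam * f (u.fn 0 t) := by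
  have h1 : EqOn (u.fn 4) (fun t => lam * f (u.fn 0 t)) (Ioo 0 1) := fun t ht => by
    have ht' : t ∈ Icc (0 : ℝ) 1 := ⟨ht.1.le, ht.2.le⟩
    have := h.eqn ⟨t, ht'⟩ ht.1 ht.2
    beta_reduce
    rw [CkFun.fn_eq_der (by norm_num) ht', CkFun.fn_eq_der (by norm_num) ht']
    exact this
  have hfc : ContinuousOn f (Ico 0 r) := fun x hx => (hs.hasDeriv x hx).continuousWithinAt
  exact h1.of_subset_closure (u.continuous_fn 4).continuousOn
    ((hfc.comp (u.continuous_fn 0).continuousOn fun t ht => h.fn_mem_Ico ht).const_mul lam)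
    Ioo_subset_Icc_self (by rw [closure_Ioo zero_ne_one])

theorem half_profile (hs : IsConvexSource r f f') (hl : 0 < lam) (h : IsPositiveSolution f r lam u) :
    IsProfile (fun x => lam * f x) (u.der 0 midpt) (1 / 2) u.half ∧ u.half 3 0 = 0 ∧
      ∀ x, u.der 0 (unitInterval.symm x) = u.der 0 x := by
  have hc : u.Clamped := ⟨h.left, h.right, h.left', h.right'⟩
  have hsl := hs.const_mul hl
  obtain ⟨x, hx⟩ := h.nontrivial
  obtain ⟨h1, h2, h3⟩ := clamped_solution_symmetric (r := r) (f := fun x => lam * f x) (v := u.fn)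
    hsl.pos hsl.strictMonoOn.monotoneOn hsl.lipschitz u.derivChain (fun t ht => (h.fn_mem_Ico ht).1)
    (fun t ht => (h.fn_mem_Ico ht).2)
    ⟨x, x.2, by have := u.fn_coe 0 x; simp only [Fin.val_zero] at this; rwa [this]⟩
    (h.fn_eqn hs) hc.fn_left hc.fn_right hc.fn_left' hc.fn_right'
  have hm : u.fn 0 (1 / 2) = u.der 0 midpt := u.fn_coe 0 midpt
  rw [hm] at h1
  refine ⟨h1, by rw [CkFun.half, add_zero]; exact h2, fun x => ?_⟩
  have e1 := u.fn_coe 0 x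
  have e2 := u.fn_coe 0 (unitInterval.symm x)
  simp only [Fin.val_zero] at e1 e2
  rw [← e1, ← e2]
  exact h3 x x.2

theorem midpt_mem (hs : IsConvexSource r f f') (hl : 0 < lam) (h : IsPositiveSolution f r lam u) :
    u.der 0 midpt ∈ Ioo 0 r := ⟨(h.half_profile hs hl).1.p_pos, h.lt _⟩

theorem der_zero_eq_half (hs : IsConvexSource r f f') (hl : 0 < lam)
    (h : IsPositiveSolution f r lam u) (x : unitInterval) :
    u.der 0 x = u.half 0 |(x : ℝ) - 1 / 2| := by
  rcases le_total (1 / 2) (x : ℝ) with hx | hx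
  · rw [abs_of_nonneg (by linarith)]
    exact (CkFun.half_eq_der 0).symm
  · rw [abs_of_nonpos (by linarith), ← (h.half_profile hs hl).2.2 x]
    have := CkFun.half_eq_der (u := u) 0 (x := unitInterval.symm x)
    rw [← this, unitInterval.coe_symm_eq]
    congr 1
    ring

theorem le_midpt (hs : IsConvexSource r f f') (hl : 0 < lam)
    (h : IsPositiveSolution f r lam u) (x : unitInterval) : u.der 0 x ≤ u.der 0 midpt := by
  rw [h.der_zero_eq_half hs hl x]
  exact (h.half_profile hs hl).1.le _ (abs_sub_half_mem x)

/-- A positive solution is determined by its maximum. -/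
theorem unique_of_midpt_eq (hs : IsConvexSource r f f') (hl₁ : 0 < lam₁) (hl₂ : 0 < lam₂)
    (h₁ : IsPositiveSolution f r lam₁ u₁) (h₂ : IsPositiveSolution f r lam₂ u₂)
    (hp : u₁.der 0 midpt = u₂.der 0 midpt) : lam₁ = lam₂ ∧ u₁ = u₂ := by
  obtain ⟨p1, z1, -⟩ := h₁.half_profile hs hl₁
  obtain ⟨p2, z2, -⟩ := h₂.half_profile hs hl₂
  rw [← hp] at p2
  have hpr := (h₁.midpt_mem hs hl₁).2
  obtain ⟨L, hL, hlip⟩ := hs.lipschitz _ hpr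
  have hsub : Icc 0 (u₁.der 0 midpt) ⊆ Ico 0 r := fun x hx => ⟨hx.1, hx.2.trans_lt hpr⟩
  obtain ⟨e1, e2⟩ := p1.unique_of_scaled hl₁ hl₂ p2 (fun x hx => hs.pos x (hsub hx))
    (hs.strictMonoOn.monotoneOn.mono hsub) hL hlip z1 z2
  refine ⟨e1, CkFun.ext_der_zero fun x => ?_⟩
  rw [h₁.der_zero_eq_half hs hl₁, h₂.der_zero_eq_half hs hl₂]
  exact e2 _ (abs_sub_half_mem x)

/-- No three positive solutions share the parameter. -/
theorem not_three (hs : IsConvexSource r f f') (hl : 0 < lam)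
    (h₁ : IsPositiveSolution f r lam u₁) (h₂ : IsPositiveSolution f r lam u₂)
    (h₃ : IsPositiveSolution f r lam u₃) (h12 : u₁.der 0 midpt < u₂.der 0 midpt)
    (h23 : u₂.der 0 midpt < u₃.der 0 midpt) : False := by
  obtain ⟨p1, z1, -⟩ := h₁.half_profile hs hl
  obtain ⟨p2, z2, -⟩ := h₂.half_profile hs hl
  obtain ⟨p3, z3, -⟩ := h₃.half_profile hs hl
  exact IsProfile.not_three (hs.const_mul hl) p1 p2 p3 z1 z2 z3 h12 h23 (h₃.midpt_mem hs hl).2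

end IsPositiveSolution

/-! ### The global C² solution curve -/

theorem exists_isGlobalSource {f f' : ℝ → ℝ} {r R : ℝ} (hs : IsConvexSource r f f')
    (hf : ContDiffOn ℝ 2 f (Ico 0 r)) (hR : 0 < R) (hRr : R < r) :
    ∃ F : C(ℝ, ℝ), IsGlobalSource R F ∧ EqOn F f (Icc 0 R) := by
  have hsub : Icc 0 R ⊆ Ico 0 r := fun x hx => ⟨hx.1, hx.2.trans_lt hRr⟩
  obtain ⟨F, hF, he⟩ := exists_contDiff_two_extension hR (hf.mono hsub)
  have hm : MonotoneOn F (Icc 0 R) :=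
    (hs.strictMonoOn.monotoneOn.mono hsub).congr he.symm
  refine ⟨⟨F, hF.continuous⟩, ⟨hR, hF, fun x hx => ?_, hm, fun x hx => ?_⟩, he⟩
  · change 0 < F x
    rw [he hx]
    exact hs.pos x (hsub hx)
  · change 0 ≤ deriv F x
    have hd : DifferentiableAt ℝ F x := hF.differentiable (by norm_num) x
    rw [← hd.derivWithin (uniqueDiffOn_Icc hR x hx)]
    exact hm.derivWithin_nonneg

/-- The point of the solution set that belongs to a branch point. -/
noncomputable def branchPair (F : C(ℝ, ℝ)) (p : ℝ) (u : C(unitInterval, ℝ)) : ℝ × CkFun 4 :=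
  (p / midGreen F u, (p / midGreen F u) • symGreen (F.comp u))

theorem IsBranchPoint.mem_solutionSet {f : ℝ → ℝ} {F : C(ℝ, ℝ)} {r R p : ℝ}
    {u : C(unitInterval, ℝ)} (hF : IsGlobalSource R F) (he : EqOn F f (Icc 0 R))
    (hRr : R < r) (h : IsBranchPoint F p u) (hp : p ≤ R) (hp0 : 0 < p) :
    branchPair F p u ∈ solutionSet f r ∧ (branchPair F p u).2.der 0 midpt = p := by
  have hm := h.midGreen_pos hF hp
  set l := p / midGreen F u with hl
  have hU : (branchPair F p u).2 = symGreen (l • F.comp u) := by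
    rw [map_smul]; rfl
  have hu : u = (branchPair F p u).2.der 0 := by rw [hU]; exact h.eq_symGreen hF hp
  have hmid : (branchPair F p u).2.der 0 midpt = p := by
    rw [← hu]; exact h.midpt_eq hF hp
  have hc : (branchPair F p u).2.Clamped := by rw [hU]; exact symGreen_clamped _
  have hsym : ∀ x, u (unitInterval.symm x) = u x := fun x => by
    rw [hu, hU]
    have := CkFun.der_symm_of_reflect (symGreen_reflect (l • F.comp u)) 0 x
    simpa using this
  refine ⟨⟨div_pos hp0 hm, ?_⟩, hmid⟩
  exact
  { nonneg := fun x => by rw [← hu]; exact h.nonneg x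
    lt := fun x => by rw [← hu]; exact (h.le x).trans_lt (hp.trans_lt hRr)
    nontrivial := ⟨midpt, by rw [hmid]; exact hp0.ne'⟩
    eqn := fun x _ _ => by
      rw [← hu, hU, symGreen_der_four]
      change l * F (u (foldMap x)) = l * f (u x)
      have h1 : u (foldMap x) = u x := by
        rcases le_total x (unitInterval.symm x) with hc | hc
        · rw [show foldMap x = unitInterval.symm x from max_eq_right hc, hsym]
        · rw [show foldMap x = x from max_eq_left hc]
      rw [h1, he ⟨h.nonneg x, (h.le x).trans hp⟩]
    left := hc.left
    right := hc.right
    left' := hc.left'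
    right' := hc.right' }

open Classical in
/-- The positive solution with maximum `p` together with its parameter. -/
noncomputable def solutionCurve (f : ℝ → ℝ) (r p : ℝ) : ℝ × CkFun 4 :=
  -- The default 0 is the intended value at p = 0, where there is no positive solution.
  if h : ∃ q ∈ solutionSet f r, q.2.der 0 midpt = p then h.choose else 0

section Curve

variable {f f' : ℝ → ℝ} {r : ℝ}

theorem solutionCurve_of_mem (hs : IsConvexSource r f f') {q : ℝ × CkFun 4}
    (hq : q ∈ solutionSet f r) : solutionCurve f r (q.2.der 0 midpt) = q := by
  have h : ∃ q' ∈ solutionSet f r, q'.2.der 0 midpt = q.2.der 0 midpt := ⟨q, hq, rfl⟩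
  rw [solutionCurve, dif_pos h]
  obtain ⟨h1, h2⟩ := h.choose_spec
  obtain ⟨e1, e2⟩ := h1.2.unique_of_midpt_eq hs h1.1 hq.1 hq.2 h2
  exact Prod.ext e1 e2

theorem solutionCurve_zero (hs : IsConvexSource r f f') : solutionCurve f r 0 = 0 := by
  rw [solutionCurve, dif_neg]
  rintro ⟨q, hq, h0⟩
  exact (hq.2.midpt_mem hs hq.1).1.ne' h0

theorem solutionCurve_spec (hs : IsConvexSource r f f') (hf : ContDiffOn ℝ 2 f (Ico 0 r)) {p : ℝ}
    (hp : p ∈ Ioo 0 r) :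
    solutionCurve f r p ∈ solutionSet f r ∧ (solutionCurve f r p).2.der 0 midpt = p := by
  obtain ⟨F, hF, he⟩ := exists_isGlobalSource hs hf hp.1 hp.2
  obtain ⟨u, hu⟩ := exists_isBranchPoint hF p ⟨hp.1.le, le_rfl⟩
  obtain ⟨h1, h2⟩ := hu.mem_solutionSet hF he hp.2 le_rfl hp.1
  have := solutionCurve_of_mem hs h1
  rw [h2] at this
  rw [this]
  exact ⟨h1, h2⟩

theorem solutionSet_eq_image (hs : IsConvexSource r f f') (hf : ContDiffOn ℝ 2 f (Ico 0 r)) :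
    solutionSet f r = solutionCurve f r '' Ioo 0 r := by
  ext q
  constructor
  · intro hq
    exact ⟨_, hq.2.midpt_mem hs hq.1, solutionCurve_of_mem hs hq⟩
  · rintro ⟨p, hp, rfl⟩
    exact (solutionCurve_spec hs hf hp).1

/-- By uniqueness for a given maximum, the chosen solutions must agree near each p₀ with the branch
of the implicit function theorem. At p = 0 that branch gives λ = 0 and u = 0, the default value. -/
theorem contDiffOn_solutionCurve (hs : IsConvexSource r f f') (hf : ContDiffOn ℝ 2 f (Ico 0 r)) :
    ContDiffOn ℝ 2 (solutionCurve f r) (Ico 0 r) := by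
  intro p₀ hp₀
  obtain ⟨R, hR, hRr⟩ := exists_between hp₀.2
  obtain ⟨F, hF, he⟩ := exists_isGlobalSource hs hf (hp₀.1.trans_lt hR) hRr
  obtain ⟨u, hu⟩ := exists_isBranchPoint hF p₀ ⟨hp₀.1, hR.le⟩
  obtain ⟨φ, hφ, hφ0, hev⟩ := exists_local_branch hF hu hR.le
  have hm : ContDiffAt ℝ 2 (fun p => p / midGreen F (φ p)) p₀ := by
    refine contDiffAt_id.div ((contDiff_midGreen hF.contDiff).contDiffAt.comp p₀ hφ) ?_
    rw [hφ0]
    exact (hu.midGreen_pos hF hR.le).ne'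
  have hG : ContDiff ℝ 2 (fun h => symGreen h) := by fun_prop
  have hN : ContDiffAt ℝ 2 (fun p => (p / midGreen F (φ p)) • F.comp (φ p)) p₀ :=
    hm.smul ((contDiff_comp_continuousMap 2 F hF.contDiff).contDiffAt.comp p₀ hφ)
  have hB : ContDiffAt ℝ 2 (fun p => branchPair F p (φ p)) p₀ := by
    have h1 : (fun p => branchPair F p (φ p)) = fun p =>
        (p / midGreen F (φ p), symGreen ((p / midGreen F (φ p)) • F.comp (φ p))) := by
      funext p
      rw [branchPair, map_smul]
    rw [h1]
    exact hm.prodMk (hG.contDiffAt.comp p₀ hN)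
  have heq : ∀ p, 0 ≤ p → p ≤ R → (0 ≤ p → IsBranchPoint F p (φ p)) →
      solutionCurve f r p = branchPair F p (φ p) := by
    intro p h0 hpR hb
    rcases h0.eq_or_lt with rfl | h0
    · rw [solutionCurve_zero hs, branchPair, zero_div, zero_smul]
      rfl
    · obtain ⟨h1, h2⟩ := (hb h0.le).mem_solutionSet hF he hRr hpR h0
      have := solutionCurve_of_mem hs h1
      rwa [h2] at this
  refine hB.contDiffWithinAt.congr_of_eventuallyEq ?_
    (heq p₀ hp₀.1 hR.le hev.self_of_nhds)
  filter_upwards [hev.filter_mono nhdsWithin_le_nhds, self_mem_nhdsWithin,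
    nhdsWithin_le_nhds (Iio_mem_nhds hR)] with p h1 h2 h3
  exact heq p h2.1 (le_of_lt h3) h1

end Curve

/-! ### Functions that take no value three times -/

/-- `g` takes no value three times inside `(0, r)`. -/
def AtMostTwice (g : ℝ → ℝ) (r : ℝ) : Prop :=
  ∀ a ∈ Ioo 0 r, ∀ b ∈ Ioo 0 r, ∀ c ∈ Ioo 0 r, a < b → b < c → g a = g b → g b = g c → False

/-- If g(a) ≥ g(b) with a < b < p, the value g(a) is taken at a, again in [b, p) on the way up to
the maximum, and once more in (p, r) on the way down to 0. -/
theorem strictMonoOn_of_atMostTwice {g : ℝ → ℝ} {r p : ℝ} (hc : ContinuousOn g (Icc 0 r))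
    (h0 : g 0 = 0) (hr : g r = 0) (hpos : ∀ x ∈ Ioo 0 r, 0 < g x) (h3 : AtMostTwice g r)
    (hp : p ∈ Ioo 0 r) (hmax : ∀ x ∈ Icc 0 r, g x ≤ g p) : StrictMonoOn g (Icc 0 p) := by
  have hM : 0 < g p := hpos p hp
  have ivt : ∀ a b y, a ∈ Icc 0 r → b ∈ Icc 0 r → a ≤ b → g a < y → y < g b →
      ∃ c ∈ Ioo a b, g c = y := fun a b y ha hb hab h1 h2 =>
    intermediate_value_Ioo hab (hc.mono (Icc_subset_Icc ha.1 hb.2)) ⟨h1, h2⟩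
  have ivt' : ∀ a b y, a ∈ Icc 0 r → b ∈ Icc 0 r → a ≤ b → g b < y → y < g a →
      ∃ c ∈ Ioo a b, g c = y := fun a b y ha hb hab h1 h2 =>
    intermediate_value_Ioo' hab (hc.mono (Icc_subset_Icc ha.1 hb.2)) ⟨h1, h2⟩
  have hpI : p ∈ Icc 0 r := ⟨hp.1.le, hp.2.le⟩
  have h0I : (0 : ℝ) ∈ Icc 0 r := ⟨le_rfl, hp.1.le.trans hp.2.le⟩
  have hrI : r ∈ Icc 0 r := ⟨h0I.2, le_rfl⟩
  -- If the maximum were also attained at a < p, then g would dip below it at some c between. A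
  -- level y between g(c) and g(p) would be taken in each of (0, a), (a, c) and (c, p).
  have claim : ∀ a, 0 ≤ a → a < p → g a < g p := by
    intro a ha hap
    have haI : a ∈ Icc 0 r := ⟨ha, hap.le.trans hp.2.le⟩
    refine lt_of_le_of_ne (hmax a haI) fun he => ?_
    have ha0 : 0 < a := lt_of_le_of_ne ha (by rintro rfl; linarith)
    have haO : a ∈ Ioo 0 r := ⟨ha0, hap.trans hp.2⟩
    obtain ⟨c, hac, hcp⟩ := exists_between hap
    have hcO : c ∈ Ioo 0 r := ⟨ha0.trans hac, hcp.trans hp.2⟩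
    have hcI : c ∈ Icc 0 r := ⟨hcO.1.le, hcO.2.le⟩
    have hcM : g c < g p := lt_of_le_of_ne (hmax c hcI) fun hc' =>
      h3 a haO c hcO p hp hac hcp (he.trans hc'.symm) hc'
    obtain ⟨y, hy1, hy2⟩ := exists_between hcM
    have hy0 : 0 < y := (hpos c hcO).trans hy1
    obtain ⟨x₁, hx₁, e₁⟩ := ivt 0 a y h0I haI ha (by linarith) (by linarith)
    obtain ⟨x₂, hx₂, e₂⟩ := ivt' a c y haI hcI hac.le hy1 (by linarith)
    obtain ⟨x₃, hx₃, e₃⟩ := ivt c p y hcI hpI hcp.le hy1 hy2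
    exact h3 x₁ ⟨hx₁.1, hx₁.2.trans haO.2⟩ x₂ ⟨ha0.trans hx₂.1, hx₂.2.trans hcO.2⟩
      x₃ ⟨hcO.1.trans hx₃.1, hx₃.2.trans hp.2⟩ (hx₁.2.trans hx₂.1) (hx₂.2.trans hx₃.1)
      (e₁.trans e₂.symm) (e₂.trans e₃.symm)
  intro a ha b hb hab
  have hap : a < p := hab.trans_le hb.2
  rcases hb.2.eq_or_lt with rfl | hbp
  · exact claim a ha.1 hap
  by_contra! hle
  have hbO : b ∈ Ioo 0 r := ⟨ha.1.trans_lt hab, hbp.trans hp.2⟩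
  have hga : 0 < g a := (hpos b hbO).trans_le hle
  have ha0 : 0 < a := lt_of_le_of_ne ha.1 (by rintro rfl; linarith)
  have haO : a ∈ Ioo 0 r := ⟨ha0, hap.trans hp.2⟩
  have hac := claim a ha.1 hap
  obtain ⟨d, hd, ed⟩ := ivt' p r (g a) hpI hrI hp.2.le (by linarith) hac
  rcases hle.eq_or_lt with he | hlt
  · exact h3 a haO b hbO d ⟨hp.1.trans hd.1, hd.2⟩ hab (hbp.trans hd.1) he.symm (he.trans ed.symm)
  · obtain ⟨c, hc1, ec⟩ := ivt b p (g a) ⟨hbO.1.le, hbO.2.le⟩ hpI hbp.le hlt hac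
    exact h3 a haO c ⟨hbO.1.trans hc1.1, hc1.2.trans hp.2⟩ d ⟨hp.1.trans hd.1, hd.2⟩
      (hab.trans hc1.1) (hc1.2.trans hd.1) ec.symm (ec.trans ed.symm)

/-- A continuous function on `[0, r)` that is positive inside, vanishes at both ends and takes no
value three times is unimodal. -/
theorem exists_unimodal {g : ℝ → ℝ} {r : ℝ} (hr : 0 < r) (hc : ContinuousOn g (Ico 0 r))
    (h0 : g 0 = 0) (hpos : ∀ x ∈ Ioo 0 r, 0 < g x) (h3 : AtMostTwice g r)
    (hlim : Tendsto g (𝓝[<] r) (𝓝 0)) :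
    ∃ p ∈ Ioo 0 r, StrictMonoOn g (Icc 0 p) ∧ StrictAntiOn g (Ico p r) := by
  classical
  -- The limit 0 at r closes the function up to a continuous one on [0, r], which then attains its
  -- maximum inside.
  set G : ℝ → ℝ := Function.update g r 0 with hG
  have hGe : ∀ x, x < r → G x = g x := fun x hx => Function.update_of_ne hx.ne _ _
  have hGr : G r = 0 := Function.update_self _ _ _
  have hGc : ContinuousOn G (Icc 0 r) := by
    have h1 : Icc 0 r \ {r} = Ico 0 r := Icc_sdiff_right
    have h2 := (continuousOn_update_iff (f := g) (s := Icc 0 r) (x := r) (y := (0 : ℝ))).2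
    rw [h1] at h2
    exact h2 ⟨hc, fun _ => hlim.mono_left (nhdsWithin_mono _ Ico_subset_Iio_self)⟩
  have hG0 : G 0 = 0 := (hGe 0 hr).trans h0
  have hGpos : ∀ x ∈ Ioo 0 r, 0 < G x := fun x hx => by rw [hGe x hx.2]; exact hpos x hx
  have hG3 : AtMostTwice G r := fun a ha b hb c hc' hab hbc e1 e2 => by
    rw [hGe a ha.2, hGe b hb.2] at e1
    rw [hGe b hb.2, hGe c hc'.2] at e2
    exact h3 a ha b hb c hc' hab hbc e1 e2
  obtain ⟨p, hp, hmax⟩ := isCompact_Icc.exists_isMaxOn (nonempty_Icc.2 hr.le) hGc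
  have hmid : r / 2 ∈ Ioo 0 r := ⟨by linarith, by linarith⟩
  have hMp : 0 < G p := (hGpos _ hmid).trans_le (hmax ⟨hmid.1.le, hmid.2.le⟩)
  have hpO : p ∈ Ioo 0 r := ⟨lt_of_le_of_ne hp.1 (by rintro rfl; linarith),
    lt_of_le_of_ne hp.2 (by rintro rfl; linarith)⟩
  refine ⟨p, hpO, ?_, ?_⟩
  · have := strictMonoOn_of_atMostTwice hGc hG0 hGr hGpos hG3 hpO (fun x hx => hmax hx)
    exact this.congr fun x hx => hGe x (hx.2.trans_lt hpO.2)
  · have hmap : MapsTo (fun x => r - x) (Icc 0 r) (Icc 0 r) := fun x hx =>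
      ⟨by linarith [hx.2], by linarith [hx.1]⟩
    have hmapo : ∀ x ∈ Ioo 0 r, r - x ∈ Ioo 0 r := fun x hx =>
      ⟨by linarith [hx.2], by linarith [hx.1]⟩
    -- The decreasing half is the increasing half of the reflected function.
    have := strictMonoOn_of_atMostTwice (g := fun x => G (r - x)) (r := r) (p := r - p)
      (hGc.comp (by fun_prop) hmap) (by simpa using hGr) (by simpa using hG0)
      (fun x hx => hGpos _ (hmapo x hx))
      (fun a ha b hb c hc' hab hbc e1 e2 => hG3 _ (hmapo c hc') _ (hmapo b hb) _ (hmapo a ha)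
        (by linarith) (by linarith) e2.symm e1.symm)
      (hmapo p hpO) (fun x hx => by simpa using hmax (hmap hx))
    intro a ha b hb hab
    have := this (a := r - b) ⟨by linarith [hb.2], by linarith [hb.1]⟩ (b := r - a)
      ⟨by linarith [ha.2], by linarith [ha.1]⟩ (by linarith)
    simp only [sub_sub_cancel] at this
    rwa [hGe a ha.2, hGe b hb.2] at this

/-! ### A priori estimates near the singular value -/

theorem sub_le_of_deriv_le {a b C : ℝ} {g g' : ℝ → ℝ} (hab : a ≤ b)
    (h : ∀ t ∈ Icc a b, HasDerivWithinAt g (g' t) (Icc a b) t) (hC : ∀ t ∈ Icc a b, g' t ≤ C) :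
    g b - g a ≤ C * (b - a) := by
  have hm := monotoneOn_of_hasDerivWithinAt_Icc (g := fun t => C * t - g t)
    (g' := fun t => C * 1 - g' t)
    (fun t ht => ((hasDerivWithinAt_id t _).const_mul C).sub (h t ht))
    (fun t ht => by have := hC t ht; linarith) (left_mem_Icc.2 hab) (right_mem_Icc.2 hab) hab
  simp only at hm
  linarith

theorem le_sub_of_le_deriv {a b C : ℝ} {g g' : ℝ → ℝ} (hab : a ≤ b)
    (h : ∀ t ∈ Icc a b, HasDerivWithinAt g (g' t) (Icc a b) t) (hC : ∀ t ∈ Icc a b, C ≤ g' t) :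
    C * (b - a) ≤ g b - g a := by
  have := sub_le_of_deriv_le (C := -C) hab (fun t ht => (h t ht).neg)
    (fun t ht => neg_le_neg (hC t ht))
  simp only [Pi.neg_apply] at this
  linarith

theorem hasDerivWithinAt_half_sub (t : ℝ) (s : Set ℝ) :
    HasDerivWithinAt (fun t : ℝ => 1 / 2 - t) (-1) s t := (hasDerivWithinAt_id t s).const_sub _

/-- If the third derivative is almost constant away from `0`, then the chain is close to a cubic. -/
theorem DerivChain.near_cubic {v : ℕ → ℝ → ℝ} {η ε : ℝ} (ch : DerivChain 0 (1 / 2) v)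
    (h1 : v 1 0 = 0) (hf : v 0 (1 / 2) = 0) (hf' : v 1 (1 / 2) = 0)
    (h3 : ∀ t ∈ Icc (0 : ℝ) (1 / 2), 0 ≤ v 3 t) (hm : MonotoneOn (v 3) (Icc 0 (1 / 2)))
    (hη : η ∈ Icc (0 : ℝ) (1 / 2)) (hε : v 3 (1 / 2) - v 3 η ≤ ε) :
    (∀ t ∈ Icc (0 : ℝ) (1 / 2), 0 ≤ v 2 t - v 2 (1 / 2) + v 3 (1 / 2) * (1 / 2 - t) ∧
      v 2 t - v 2 (1 / 2) + v 3 (1 / 2) * (1 / 2 - t) ≤ v 3 (1 / 2) * η + ε) ∧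
    |v 2 (1 / 2) - v 3 (1 / 2) / 4| ≤ v 3 (1 / 2) * η + ε ∧
    |v 3 (1 / 2) - 96 * v 0 0| ≤ 12 * (v 3 (1 / 2) * η + ε) := by
  set m := v 3 (1 / 2) with hmdef
  set A := v 2 (1 / 2) with hA
  -- A bound for the integral of m - v''' over [0, 1/2]: the integrand is at most m on [0, η] and at
  -- most ε beyond.
  set ω := m * η + ε with hω
  have hr : (1 / 2 : ℝ) ∈ Icc (0 : ℝ) (1 / 2) := by norm_num
  have hl : (0 : ℝ) ∈ Icc (0 : ℝ) (1 / 2) := by norm_num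
  have hle : ∀ t ∈ Icc (0 : ℝ) (1 / 2), v 3 t ≤ m := fun t ht => hm ht hr ht.2
  have hm0 : 0 ≤ m := h3 _ hr
  have hε0 : 0 ≤ ε := by have := hle η hη; linarith
  have hω0 : 0 ≤ ω := add_nonneg (mul_nonneg hm0 hη.1) hε0
  have d2 : ∀ a b, 0 ≤ a → b ≤ 1 / 2 → ∀ t ∈ Icc a b,
      HasDerivWithinAt (fun t => v 2 t - A + m * (1 / 2 - t)) (v 3 t - m) (Icc a b) t := by
    intro a b ha hb t ht
    have := (((ch.mono ha hb) 2 (by norm_num) t ht).sub_const A).add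
      ((hasDerivWithinAt_half_sub t (Icc a b)).const_mul m)
    refine this.congr_deriv ?_
    ring
  have E2 : ∀ t ∈ Icc (0 : ℝ) (1 / 2), 0 ≤ v 2 t - A + m * (1 / 2 - t) ∧
      v 2 t - A + m * (1 / 2 - t) ≤ ω := by
    intro t ht
    constructor
    · have := sub_le_of_deriv_le (C := 0) ht.2 (d2 t (1 / 2) ht.1 le_rfl)
        (fun s hs => by have := hle s ⟨ht.1.trans hs.1, hs.2⟩; linarith)
      simp only [hA] at this ⊢
      linarith
    · have hfar : ∀ s ∈ Icc η (1 / 2), v 2 s - A + m * (1 / 2 - s) ≤ ε := fun s hs => by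
        have := le_sub_of_le_deriv (C := -ε) hs.2 (d2 s (1 / 2) (hη.1.trans hs.1) le_rfl)
          (fun s' hs' => by
            have h5 : s' ∈ Icc (0 : ℝ) (1 / 2) := ⟨hη.1.trans (hs.1.trans hs'.1), hs'.2⟩
            have := hm hη h5 (hs.1.trans hs'.1)
            linarith)
        have h6 : ε * (1 / 2 - s) ≤ ε * 1 :=
          mul_le_mul_of_nonneg_left (by linarith [hη.1, hs.1]) hε0
        simp only [hA] at this ⊢
        linarith
      rcases le_total η t with hc | hc
      · have := hfar t ⟨hc, ht.2⟩
        have := mul_nonneg hm0 hη.1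
        linarith
      · have h5 := hfar η ⟨le_rfl, hη.2⟩
        have := le_sub_of_le_deriv (C := -m) hc (d2 t η ht.1 hη.2)
          (fun s hs => by have := h3 s ⟨ht.1.trans hs.1, hs.2.trans hη.2⟩; linarith)
        have h6 : m * (η - t) ≤ m * η := mul_le_mul_of_nonneg_left (by linarith [ht.1]) hm0
        linarith
  have d1 : ∀ a b, 0 ≤ a → b ≤ 1 / 2 → ∀ t ∈ Icc a b,
      HasDerivWithinAt (fun t => v 1 t + A * (1 / 2 - t) - m / 2 * (1 / 2 - t) ^ 2)
        (v 2 t - A + m * (1 / 2 - t)) (Icc a b) t := by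
    intro a b ha hb t ht
    have hs := hasDerivWithinAt_half_sub t (Icc a b)
    have := (((ch.mono ha hb) 1 (by norm_num) t ht).add (hs.const_mul A)).sub
      ((hs.pow 2).const_mul (m / 2))
    refine this.congr_deriv ?_
    push_cast
    ring
  have E1 : ∀ t ∈ Icc (0 : ℝ) (1 / 2),
      -(ω * (1 / 2 - t)) ≤ v 1 t + A * (1 / 2 - t) - m / 2 * (1 / 2 - t) ^ 2 ∧
      v 1 t + A * (1 / 2 - t) - m / 2 * (1 / 2 - t) ^ 2 ≤ 0 := by
    intro t ht
    have a1 := sub_le_of_deriv_le (C := ω) ht.2 (d1 t (1 / 2) ht.1 le_rfl)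
      (fun s hs => (E2 s ⟨ht.1.trans hs.1, hs.2⟩).2)
    have a2 := le_sub_of_le_deriv (C := 0) ht.2 (d1 t (1 / 2) ht.1 le_rfl)
      (fun s hs => (E2 s ⟨ht.1.trans hs.1, hs.2⟩).1)
    simp only [hf', sub_self] at a1 a2
    constructor <;> linarith
  have d0 : ∀ t ∈ Icc (0 : ℝ) (1 / 2),
      HasDerivWithinAt (fun t => v 0 t - A / 2 * (1 / 2 - t) ^ 2 + m / 6 * (1 / 2 - t) ^ 3)
        (v 1 t + A * (1 / 2 - t) - m / 2 * (1 / 2 - t) ^ 2) (Icc 0 (1 / 2)) t := by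
    intro t ht
    have hs := hasDerivWithinAt_half_sub t (Icc 0 (1 / 2))
    have := ((ch 0 (by norm_num) t ht).sub ((hs.pow 2).const_mul (A / 2))).add
      ((hs.pow 3).const_mul (m / 6))
    refine this.congr_deriv ?_
    push_cast
    ring
  have a1 := sub_le_of_deriv_le (C := 0) hr.1 d0 (fun s hs => (E1 s hs).2)
  have d0' : ∀ t ∈ Icc (0 : ℝ) (1 / 2),
      HasDerivWithinAt (fun t => v 0 t - A / 2 * (1 / 2 - t) ^ 2 + m / 6 * (1 / 2 - t) ^ 3
        - ω / 2 * (1 / 2 - t) ^ 2)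
        (v 1 t + A * (1 / 2 - t) - m / 2 * (1 / 2 - t) ^ 2 + ω * (1 / 2 - t)) (Icc 0 (1 / 2)) t := by
    intro t ht
    have hs := hasDerivWithinAt_half_sub t (Icc 0 (1 / 2))
    refine ((d0 t ht).sub ((hs.pow 2).const_mul (ω / 2))).congr_deriv ?_
    push_cast
    ring
  have a2 := le_sub_of_le_deriv (C := 0) hr.1 d0' (fun s hs => by linarith [(E1 s hs).1])
  -- At t = 0, v'(0) = 0 yields -ω ≤ A - m/4 ≤ 0. Together with 0 ≤ v(0) - A/8 + m/48 ≤ ω/8 this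
  -- gives |m - 96 v(0)| ≤ 12 ω.
  have b1 := (E1 0 hl).1
  have b2 := (E1 0 hl).2
  simp only [hf, h1] at a1 a2 b1 b2
  norm_num at a1 a2 b1 b2
  refine ⟨E2, abs_le.2 ⟨by linarith, by linarith⟩, abs_le.2 ⟨by linarith, by linarith⟩⟩

namespace IsProfile

variable {f f' : ℝ → ℝ} {r p lam c η : ℝ} {v : ℕ → ℝ → ℝ}

/-- A priori bound of the parameter. -/
theorem lam_le (hs : IsConvexSource r f f') (hl : 0 < lam) (hp : p < r)
    (h : IsProfile (fun x => lam * f x) p (1 / 2) v) (h3 : v 3 0 = 0) : lam * f 0 ≤ 384 * p := by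
  -- The polynomial k (t² - 1/4)² solves the clamped problem with the constant right-hand side 24 k
  -- = λ f(0). It lies below v, and its value at 0 is k / 16.
  set k := lam * f 0 / 24 with hk
  have hr : (1 / 2 : ℝ) ∈ Icc (0 : ℝ) (1 / 2) := by norm_num
  have hl0 : (0 : ℝ) ∈ Icc (0 : ℝ) (1 / 2) := by norm_num
  have hsl := hs.const_mul hl
  have d0 : ∀ t ∈ Icc (0 : ℝ) (1 / 2), HasDerivWithinAt
      (fun t => v 0 t - k * (t ^ 4 - t ^ 2 / 2 + 1 / 16)) (v 1 t - k * (4 * t ^ 3 - t))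
      (Icc 0 (1 / 2)) t := fun t ht => by
    refine ((h.chain 0 (by norm_num) t ht).sub ((((hasDerivAt_pow 4 t).sub
      ((hasDerivAt_pow 2 t).div_const 2)).add_const (1 / 16)).const_mul k).hasDerivWithinAt).congr_deriv ?_
    push_cast; ring
  have d1 : ∀ t ∈ Icc (0 : ℝ) (1 / 2), HasDerivWithinAt
      (fun t => v 1 t - k * (4 * t ^ 3 - t)) (v 2 t - k * (12 * t ^ 2 - 1))
      (Icc 0 (1 / 2)) t := fun t ht => by
    refine ((h.chain 1 (by norm_num) t ht).sub ((((hasDerivAt_pow 3 t).const_mul 4).sub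
      (hasDerivAt_id t)).const_mul k).hasDerivWithinAt).congr_deriv ?_
    push_cast; ring
  have d2 : ∀ t ∈ Icc (0 : ℝ) (1 / 2), HasDerivWithinAt
      (fun t => v 2 t - k * (12 * t ^ 2 - 1)) (v 3 t - k * (24 * t))
      (Icc 0 (1 / 2)) t := fun t ht => by
    refine ((h.chain 2 (by norm_num) t ht).sub ((((hasDerivAt_pow 2 t).const_mul 12).sub_const
      1).const_mul k).hasDerivWithinAt).congr_deriv ?_
    push_cast; ring
  have d3 : ∀ t ∈ Icc (0 : ℝ) (1 / 2), HasDerivWithinAt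
      (fun t => v 3 t - k * (24 * t)) (v 4 t - k * (24 * 1))
      (Icc 0 (1 / 2)) t := fun t ht => (h.chain 3 (by norm_num) t ht).sub
    (((hasDerivAt_id t).const_mul 24).const_mul k).hasDerivWithinAt
  have h0r : (0 : ℝ) ∈ Ico 0 r := ⟨le_rfl, h.p_pos.trans hp⟩
  have e4 : ∀ t ∈ Icc (0 : ℝ) (1 / 2), 0 ≤ v 4 t - k * (24 * 1) := fun t ht => by
    have := hsl.strictMonoOn.monotoneOn h0r (h.mem_Ico hp ht) (h.nonneg t ht)
    rw [h.eqn t ht, hk]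
    linarith
  have m3 := monotoneOn_of_hasDerivWithinAt_Icc d3 e4
  have e3 : ∀ t ∈ Icc (0 : ℝ) (1 / 2), 0 ≤ v 3 t - k * (24 * t) := fun t ht => by
    have := m3 hl0 ht ht.1
    simp only [h3] at this
    linarith
  have e1 := nonpos_of_second_deriv_nonneg d1 d2 e3 (by simp [h.init']) (by
    rw [h.fin']; norm_num)
  have := antitoneOn_of_hasDerivWithinAt_Icc d0 e1 hl0 hr hr.1
  simp only [h.init, h.fin] at this
  norm_num at this
  rw [hk] at this
  linarith

theorem antitoneOn_zero (hs : IsConvexSource r f f') (hl : 0 < lam) (hp : p < r)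
    (h : IsProfile (fun x => lam * f x) p (1 / 2) v) (h3 : v 3 0 = 0) :
    AntitoneOn (v 0) (Icc 0 (1 / 2)) :=
  h.chain.antitoneOn (i := 0) (by norm_num) (h.deriv_nonpos (fun x hx =>
    (hs.const_mul hl).pos x ⟨hx.1, hx.2.trans_lt hp⟩) h3)

/-- For T = 1/2, `deriv_le` reads v' ≤ -4 p t on [0, 1/4], so v drops by at least 2 p η² up to η.
This keeps f(v) bounded beyond η, independently of p. -/
theorem le_away (hs : IsConvexSource r f f') (hl : 0 < lam) (hp : p < r)
    (h : IsProfile (fun x => lam * f x) p (1 / 2) v) (h3 : v 3 0 = 0) (hη : η ∈ Icc (0 : ℝ) (1 / 4)) :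
    ∀ t ∈ Icc η (1 / 2), v 0 t ≤ p * (1 - 2 * η ^ 2) := by
  have hd := h.deriv_le (fun x hx => (hs.const_mul hl).pos x ⟨hx.1, hx.2.trans_lt hp⟩) h3
  have ch := h.chain.mono (a' := 0) (b' := η) le_rfl (by linarith [hη.2])
  have hm := antitoneOn_of_hasDerivWithinAt_Icc (a := 0) (b := η)
    (g := fun t => v 0 t + 2 * p * t ^ 2) (g' := fun t => v 1 t + 2 * p * (((2 : ℕ) : ℝ) * t ^ (2 - 1)))
    (fun t ht => (ch 0 (by norm_num) t ht).add ((hasDerivAt_pow 2 t).const_mul _).hasDerivWithinAt)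
    (fun t ht => by
      have := hd t ⟨ht.1, by linarith [ht.2, hη.2]⟩
      rw [min_eq_left (by linarith [ht.2, hη.2])] at this
      norm_num at this ⊢
      linarith)
  have h5 := hm (left_mem_Icc.2 hη.1) (right_mem_Icc.2 hη.1) hη.1
  simp only [h.init] at h5
  intro t ht
  have := h.antitoneOn_zero hs hl hp h3 ⟨hη.1, by linarith [hη.2]⟩ ⟨hη.1.trans ht.1, ht.2⟩ ht.1
  norm_num at h5
  linarith

theorem third_deriv_sub_le (hs : IsConvexSource r f f') (hl : 0 < lam) (hp : p < r)
    (h : IsProfile (fun x => lam * f x) p (1 / 2) v) (h3 : v 3 0 = 0) (hη0 : 0 < η)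
    (hη : η ≤ 1 / 4) : v 3 (1 / 2) - v 3 η ≤ lam * f (r * (1 - 2 * η ^ 2)) := by
  have hηI : η ∈ Icc (0 : ℝ) (1 / 4) := ⟨hη0.le, hη⟩
  have hsl := hs.const_mul hl
  have hr : 0 < r := h.p_pos.trans hp
  have hq : 0 < 1 - 2 * η ^ 2 := by nlinarith
  have hrm : r * (1 - 2 * η ^ 2) ∈ Ico 0 r := ⟨by positivity, by nlinarith [mul_pos hr (pow_pos hη0 2)]⟩
  have h5 := sub_le_of_deriv_le (C := lam * f (r * (1 - 2 * η ^ 2))) (a := η) (b := 1 / 2)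
    (by linarith) (h.chain.mono hη0.le le_rfl 3 (by norm_num)) (fun t ht => by
      have ht' : t ∈ Icc (0 : ℝ) (1 / 2) := ⟨hη0.le.trans ht.1, ht.2⟩
      simp only [Nat.reduceAdd]
      rw [h.eqn t ht']
      refine hsl.strictMonoOn.monotoneOn (h.mem_Ico hp ht') hrm
        ((h.le_away hs hl hp h3 hηI t ht).trans ?_)
      exact mul_le_mul_of_nonneg_right hp.le hq.le)
  have h6 : 0 < lam * f (r * (1 - 2 * η ^ 2)) := hsl.pos _ hrm
  nlinarith

/-- The third derivative is bounded independently of the maximum. -/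
theorem exists_third_deriv_bound (hs : IsConvexSource r f f') (hr : 0 < r) :
    ∃ M > 0, ∀ (p lam : ℝ) (v : ℕ → ℝ → ℝ), 0 < lam → p < r →
      IsProfile (fun x => lam * f x) p (1 / 2) v → v 3 0 = 0 → v 3 (1 / 2) ≤ M := by
  -- With η = 1/24, the estimate |m - 96 p| ≤ 12 (m η + ε) has only m/2 on the right, which can be
  -- absorbed: m ≤ 192 p + 24 ε.
  set Q := f (r * (1 - 2 * (1 / 24) ^ 2)) with hQ
  have hf0 : 0 < f 0 := hs.pos 0 ⟨le_rfl, hr⟩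
  have hQ0 : 0 < Q := hs.pos _ ⟨by positivity, by nlinarith⟩
  refine ⟨192 * r + 24 * (384 * r / f 0 * Q), by positivity, fun p lam v hl hp h h3 => ?_⟩
  have hpos : ∀ x ∈ Icc 0 p, 0 < lam * f x := fun x hx =>
    mul_pos hl (hs.pos x ⟨hx.1, hx.2.trans_lt hp⟩)
  have hm3 : MonotoneOn (v 3) (Icc 0 (1 / 2)) := h.chain.monotoneOn (by norm_num) fun t ht => by
    rw [h.eqn t ht]; exact (hpos _ ⟨h.nonneg t ht, h.le t ht⟩).le
  have hsub := h.third_deriv_sub_le hs hl hp h3 (η := 1 / 24) (by norm_num) (by norm_num)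
  have hlam : lam ≤ 384 * r / f 0 := by
    rw [le_div_iff₀ hf0]
    have := h.lam_le hs hl hp h3
    linarith
  have h6 : lam * Q ≤ 384 * r / f 0 * Q := mul_le_mul_of_nonneg_right hlam hQ0.le
  have h7 := (h.chain.near_cubic h.init' h.fin h.fin' (h.third_deriv_nonneg hpos h3) hm3
    (by norm_num) (hsub.trans h6)).2.2
  have h8 := (abs_le.1 h7).2
  rw [h.init] at h8
  linarith

/-- Near the singular value the parameter is small. -/
theorem lam_le_sqrt {M : ℝ} (hs : IsConvexSource r f f') (hl : 0 < lam) (hp : p < r) (hc : 0 < c)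
    (hsing : ∀ x ∈ Ico 0 r, c ≤ (r - x) * f x)
    (h : IsProfile (fun x => lam * f x) p (1 / 2) v) (h3 : v 3 0 = 0) (hM : v 3 (1 / 2) ≤ M)
    (hpr : r - p ≤ 1 / 4) : lam ≤ M * (1 + M) / c * √(r - p) := by
  have hpos : ∀ x ∈ Icc 0 p, 0 < lam * f x := fun x hx =>
    mul_pos hl (hs.pos x ⟨hx.1, hx.2.trans_lt hp⟩)
  have hn3 := h.third_deriv_nonneg hpos h3
  have hr : (1 / 2 : ℝ) ∈ Icc (0 : ℝ) (1 / 2) := by norm_num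
  have hm3 : MonotoneOn (v 3) (Icc 0 (1 / 2)) := h.chain.monotoneOn (by norm_num) fun t ht => by
    rw [h.eqn t ht]; exact (hpos _ ⟨h.nonneg t ht, h.le t ht⟩).le
  have hM0 : 0 ≤ M := (hn3 _ hr).trans hM
  have e2 : ∀ t ∈ Icc (0 : ℝ) (1 / 2), -M ≤ v 2 t := fun t ht => by
    have h5 := sub_le_of_deriv_le (C := M) ht.2 (h.chain.mono ht.1 le_rfl 2 (by norm_num))
      (fun s hs' => (hm3 ⟨ht.1.trans hs'.1, hs'.2⟩ hr hs'.2).trans hM)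
    have := h.second_deriv_nonneg
    nlinarith [ht.1]
  have e1 : ∀ t ∈ Icc (0 : ℝ) (1 / 2), -(M * t) ≤ v 1 t := fun t ht => by
    have h5 := le_sub_of_le_deriv (C := -M) ht.1 (h.chain.mono le_rfl ht.2 1 (by norm_num))
      (fun s hs' => e2 s ⟨hs'.1, hs'.2.trans ht.2⟩)
    rw [h.init'] at h5
    linarith
  -- From v'' ≥ -M, r - v ≤ (1 + M) s² on [0, s], so v'''' ≥ λ c / ((1 + M) s²) there. Integrating
  -- over the length s gives M ≥ v'''(s) ≥ λ c / ((1 + M) s).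
  set s := √(r - p) with hs'
  have hδ : 0 < r - p := by linarith
  have hs0 : 0 < s := Real.sqrt_pos.2 hδ
  have hss : s * s = r - p := Real.mul_self_sqrt hδ.le
  have hsh : s ≤ 1 / 2 := by
    rw [hs']
    refine (Real.sqrt_le_sqrt hpr).trans ?_
    rw [show (1 / 4 : ℝ) = (1 / 2) ^ 2 by norm_num, Real.sqrt_sq (by norm_num)]
  have e0 : ∀ t ∈ Icc 0 s, p - M * (s * s) ≤ v 0 t := fun t ht => by
    have h5 := le_sub_of_le_deriv (C := -(M * s)) ht.1
      (h.chain.mono le_rfl (ht.2.trans hsh) 0 (by norm_num))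
      (fun x hx => by
        have h6 := e1 x ⟨hx.1, hx.2.trans (ht.2.trans hsh)⟩
        have h7 : M * x ≤ M * s := mul_le_mul_of_nonneg_left (hx.2.trans ht.2) hM0
        simp only [Nat.reduceAdd]
        linarith)
    have h6 : M * s * t ≤ M * s * s := mul_le_mul_of_nonneg_left ht.2 (mul_nonneg hM0 hs0.le)
    rw [h.init] at h5
    linarith
  have hD : 0 < (1 + M) * (s * s) := by positivity
  have h4 : ∀ t ∈ Icc 0 s, lam * (c / ((1 + M) * (s * s))) ≤ v 4 t := fun t ht => by
    have ht' : t ∈ Icc (0 : ℝ) (1 / 2) := ⟨ht.1, ht.2.trans hsh⟩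
    rw [h.eqn t ht']
    refine mul_le_mul_of_nonneg_left ?_ hl.le
    rw [div_le_iff₀ hD]
    have hm := h.mem_Ico hp ht'
    have h5 := hsing _ hm
    have h6 : r - v 0 t ≤ (1 + M) * (s * s) := by have := e0 t ht; linarith
    have h7 := mul_le_mul_of_nonneg_right h6 (hs.pos _ hm).le
    linarith
  have h5 := le_sub_of_le_deriv hs0.le (h.chain.mono le_rfl hsh 3 (by norm_num)) h4
  rw [h3, sub_zero, sub_zero] at h5
  have h6 := (hm3 ⟨hs0.le, hsh⟩ hr hsh).trans hM
  have h7 : lam * (c / ((1 + M) * (s * s))) * s = lam * c / ((1 + M) * s) := by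
    field_simp
  rw [h7] at h5
  have h8 : lam * c ≤ M * ((1 + M) * s) := (div_le_iff₀ (by positivity)).1 (h5.trans h6)
  rw [div_mul_eq_mul_div, le_div_iff₀ hc]
  linarith

/-- Distance of the second derivative from its limit. -/
theorem second_deriv_sub_le {M : ℝ} (hs : IsConvexSource r f f') (hl : 0 < lam) (hp : p < r)
    (h : IsProfile (fun x => lam * f x) p (1 / 2) v) (h3 : v 3 0 = 0) (hM : v 3 (1 / 2) ≤ M)
    (hη0 : 0 < η) (hη : η ≤ 1 / 4) : ∀ t ∈ Icc (0 : ℝ) (1 / 2),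
    |v 2 t - (-24 * r + 96 * r * t)| ≤
      11 * (M * η + lam * f (r * (1 - 2 * η ^ 2))) + 72 * (r - p) := by
  have hpos : ∀ x ∈ Icc 0 p, 0 < lam * f x := fun x hx =>
    mul_pos hl (hs.pos x ⟨hx.1, hx.2.trans_lt hp⟩)
  have hm3 : MonotoneOn (v 3) (Icc 0 (1 / 2)) := h.chain.monotoneOn (by norm_num) fun t ht => by
    rw [h.eqn t ht]; exact (hpos _ ⟨h.nonneg t ht, h.le t ht⟩).le
  obtain ⟨E2, hA, hm⟩ := h.chain.near_cubic h.init' h.fin h.fin' (h.third_deriv_nonneg hpos h3) hm3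
    ⟨hη0.le, by linarith⟩ (h.third_deriv_sub_le hs hl hp h3 hη0 hη)
  set ω' := v 3 (1 / 2) * η + lam * f (r * (1 - 2 * η ^ 2)) with hω'
  have hω : ω' ≤ M * η + lam * f (r * (1 - 2 * η ^ 2)) := by
    have := mul_le_mul_of_nonneg_right hM hη0.le
    linarith
  set ω := M * η + lam * f (r * (1 - 2 * η ^ 2))
  rw [h.init] at hm
  intro t ht
  obtain ⟨l1, l2⟩ := E2 t ht
  rw [abs_le] at hA hm
  -- Write the limit as 24 r - 96 r (1/2 - t). The errors are ω from v'' itself, ω + 3 ω + 24 (r -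
  -- p) from v''(1/2) against 24 r, and 6 ω + 48 (r - p) from this product: 11 ω + 72 (r - p) in
  -- all.
  have hk : |(v 3 (1 / 2) - 96 * r) * (1 / 2 - t)| ≤ (12 * ω + 96 * (r - p)) * (1 / 2) := by
    rw [abs_mul, abs_of_nonneg (by linarith [ht.2] : 0 ≤ 1 / 2 - t)]
    refine mul_le_mul (abs_le.2 ⟨by linarith, by linarith⟩) (by linarith [ht.1])
      (by linarith [ht.2]) (by linarith)
  rw [abs_le] at hk ⊢
  constructor <;> linarith
end IsProfile

/-! ### The limit profile w -/

theorem hasDerivAt_mul_abs (t : ℝ) : HasDerivAt (fun t : ℝ => t * |t|) (2 * |t|) t := by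
  rcases eq_or_ne t 0 with rfl | ht
  · rw [hasDerivAt_iff_tendsto_slope_zero]
    have h : Tendsto (fun t : ℝ => |t|) (𝓝[≠] 0) (𝓝 (2 * |0|)) := by
      have := (continuous_abs (G := ℝ)).tendsto 0
      simp only [abs_zero, mul_zero] at this ⊢
      exact this.mono_left nhdsWithin_le_nhds
    refine h.congr' ?_
    filter_upwards [self_mem_nhdsWithin] with t ht
    have ht' : t ≠ 0 := ht
    simp [ht']
  · refine ((hasDerivAt_id t).mul (hasDerivAt_abs ht)).congr_deriv ?_
    have := self_mul_sign t
    simp only [id_eq, one_mul]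
    rw [this]
    ring

theorem hasDerivAt_sq_mul_abs (t : ℝ) :
    HasDerivAt (fun t : ℝ => t * (t * |t|)) (3 * (t * |t|)) t := by
  refine ((hasDerivAt_id t).mul (hasDerivAt_mul_abs t)).congr_deriv ?_
  simp only [id_eq]
  ring

/-- The functions `w`, `w'`, `w''` of the limit profile `w`. -/
noncomputable def limitDer (r : ℝ) : ℕ → ℝ → ℝ
  | 0, x => r * (1 - 12 * (x - 1 / 2) ^ 2 + 16 * ((x - 1 / 2) * ((x - 1 / 2) * |x - 1 / 2|)))
  | 1, x => r * (-24 * (x - 1 / 2) + 48 * ((x - 1 / 2) * |x - 1 / 2|))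
  | _, x => r * (-24 + 96 * |x - 1 / 2|)

theorem hasDerivAt_limitDer (r x : ℝ) {i : ℕ} (hi : i < 2) :
    HasDerivAt (limitDer r i) (limitDer r (i + 1) x) x := by
  have h0 : HasDerivAt (fun x : ℝ => x - 1 / 2) 1 x := (hasDerivAt_id x).sub_const _
  have h1 := (hasDerivAt_mul_abs (x - 1 / 2)).comp x h0
  have h2 := (hasDerivAt_sq_mul_abs (x - 1 / 2)).comp x h0
  interval_cases i
  · refine (((((h0.pow 2).const_mul 12).const_sub 1).add (h2.const_mul 16)).const_mul r).congr_deriv ?_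
    simp only [limitDer]
    push_cast
    ring
  · refine (((h0.const_mul (-24)).add (h1.const_mul 48)).const_mul r).congr_deriv ?_
    simp only [limitDer]
    ring

theorem continuous_limitDer (r : ℝ) (i : ℕ) : Continuous (limitDer r i) := by
  match i with
  | 0 => unfold limitDer; fun_prop
  | 1 => unfold limitDer; fun_prop
  | n + 2 => unfold limitDer; fun_prop

/-- The limit profile as an element of `C^2[0,1]`. -/
noncomputable def limitFun (r : ℝ) : CkFun 2 :=
  ⟨fun j => ⟨fun x => limitDer r j x, (continuous_limitDer r j).comp continuous_subtype_val⟩,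
    fun i x => hasDerivWithinAt_IccExtend (hasDerivAt_limitDer r x i.2).hasDerivWithinAt
      fun _ => rfl⟩

theorem limitFun_der (r : ℝ) (j : Fin 3) (x : unitInterval) :
    (limitFun r).der j x = limitDer r j x := rfl

theorem limitFun_der_two (r : ℝ) (x : unitInterval) :
    (limitFun r).der 2 x = r * (-24 + 96 * |(x : ℝ) - 1 / 2|) := rfl

theorem limitDer_zero (r x : ℝ) : limitDer r 0 x = limitProfile r x := by
  rw [limitDer, limitProfile]
  split_ifs with h
  · rw [abs_of_nonpos (by linarith)]; ring
  · rw [abs_of_pos (by linarith)]; ring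

theorem limitFun_symm (r : ℝ) (x : unitInterval) :
    (limitFun r).der 0 (unitInterval.symm x) = (limitFun r).der 0 x := by
  rw [limitFun_der, limitFun_der, unitInterval.coe_symm_eq]
  have : 1 - (x : ℝ) - 1 / 2 = -((x : ℝ) - 1 / 2) := by ring
  simp only [Fin.val_zero, limitDer, this, abs_neg]
  ring

theorem limitFun_midpt (r : ℝ) : (limitFun r).der 0 midpt = r := by
  rw [limitFun_der]
  simp [limitDer, midpt]

theorem limitFun_le {r : ℝ} (hr : 0 ≤ r) (x : unitInterval) : (limitFun r).der 0 x ≤ r := by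
  rw [limitFun_der]
  simp only [Fin.val_zero, limitDer]
  have h1 := (abs_sub_half_mem x).2
  have h2 : ((x : ℝ) - 1 / 2) * (((x : ℝ) - 1 / 2) * |(x : ℝ) - 1 / 2|) =
      ((x : ℝ) - 1 / 2) ^ 2 * |(x : ℝ) - 1 / 2| := by ring
  rw [h2]
  have h3 := mul_le_mul_of_nonneg_left h1 (sq_nonneg ((x : ℝ) - 1 / 2))
  have h4 := sq_nonneg ((x : ℝ) - 1 / 2)
  exact mul_le_of_le_one_right hr (by linarith)

theorem limitFun_der_zero_left (r : ℝ) : (limitFun r).der 0 0 = 0 := by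
  rw [limitFun_der]
  simp only [Fin.val_zero, limitDer, Set.Icc.coe_zero]
  norm_num [abs_of_nonneg]

theorem limitFun_der_one_left (r : ℝ) : (limitFun r).der 1 0 = 0 := by
  rw [limitFun_der]
  simp only [Fin.val_one, limitDer, Set.Icc.coe_zero]
  norm_num [abs_of_nonneg]

theorem lipschitzWith_limitFun_der_two {r : ℝ} (hr : 0 ≤ r) :
    LipschitzWith (Real.toNNReal (96 * r)) ((limitFun r).der 2) := by
  refine LipschitzWith.of_dist_le_mul fun x y => ?_
  rw [Real.coe_toNNReal _ (by positivity), limitFun_der_two, limitFun_der_two, Real.dist_eq,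
    Subtype.dist_eq, Real.dist_eq]
  have h := abs_abs_sub_abs_le_abs_sub ((x : ℝ) - 1 / 2) ((y : ℝ) - 1 / 2)
  have e : r * (-24 + 96 * |(x : ℝ) - 1 / 2|) - r * (-24 + 96 * |(y : ℝ) - 1 / 2|) =
    96 * r * (|(x : ℝ) - 1 / 2| - |(y : ℝ) - 1 / 2|) := by ring
  rw [e, abs_mul, abs_of_nonneg (show 0 ≤ 96 * r by positivity)]
  refine mul_le_mul_of_nonneg_left (h.trans_eq ?_) (by positivity)
  congr 1; ring

theorem holderNorm_limitFun_lt_top {r : ℝ} (hr : 0 ≤ r) {α : NNReal} (hα : α ≤ 1) :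
    holderNorm α (limitFun r) < ⊤ := by
  refine ENNReal.add_lt_top.2 ⟨enorm_lt_top, ?_⟩
  have h : MemHolder 1 ((limitFun r).der 2) := ⟨_, (lipschitzWith_limitFun_der_two hr).holderWith⟩
  exact (h.of_le hα).eHolderNorm_lt_top

/-- A C³ function with the values of w would have w'' = r (-24 + 96 |x - 1/2|) as its second
derivative, and this has a corner at 1/2. -/
theorem limitFun_not_three {r : ℝ} (hr : r ≠ 0) :
    ¬ ∃ v : CkFun 3, v.der 0 = (limitFun r).der 0 := by
  rintro ⟨v, hv⟩
  have h : CkFun.incl (show 2 ≤ 3 by norm_num) v = limitFun r :=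
    CkFun.ext_der_zero fun x => by rw [← hv]; rfl
  have h2 : ∀ x, v.der 2 x = r * (-24 + 96 * |(x : ℝ) - 1 / 2|) := fun x => by
    rw [← limitFun_der_two, ← h]; rfl
  have h3 := v.hasDerivWithinAt_fn (i := 2) (by norm_num) (x := 1 / 2) (by norm_num)
  have h4 : DifferentiableAt ℝ (v.fn 2) (1 / 2) :=
    (h3.hasDerivAt (Icc_mem_nhds (by norm_num) (by norm_num))).differentiableAt
  have h5 : (fun x : ℝ => r * (-24 + 96 * |x - 1 / 2|)) =ᶠ[𝓝 (1 / 2)] v.fn 2 := by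
    filter_upwards [Icc_mem_nhds (show (0 : ℝ) < 1 / 2 by norm_num) (show (1 / 2 : ℝ) < 1 by norm_num)]
      with x hx
    have := v.fn_coe 2 ⟨x, hx⟩
    rw [h2] at this
    exact this.symm
  have h6 := h5.differentiableAt_iff.2 h4
  have h7 : DifferentiableAt ℝ (fun t : ℝ => r * (-24 + 96 * |(t + 1 / 2) - 1 / 2|)) 0 := by
    refine DifferentiableAt.comp (g := fun x : ℝ => r * (-24 + 96 * |x - 1 / 2|))
      (f := fun t : ℝ => t + 1 / 2) 0 ?_ (by fun_prop)
    simpa using h6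
  refine not_differentiableAt_abs_zero (((h7.const_mul (1 / (96 * r))).add_const (1 / 4)).congr_of_eventuallyEq
    (Eventually.of_forall fun t => ?_))
  simp only [add_sub_cancel_right]
  field_simp
  ring

theorem contDiffOn_limitProfile (r : ℝ) (s : Set ℝ) :
    ContDiffOn ℝ 4 (limitProfile r) (s \ {1 / 2}) := by
  intro x hx
  refine ContDiffAt.contDiffWithinAt ?_
  rcases lt_or_gt_of_ne (show x ≠ 1 / 2 from hx.2) with h | h
  · refine ContDiffAt.congr_of_eventuallyEq
      (f := fun x => -16 * r * x ^ 3 + 12 * r * x ^ 2) (by fun_prop) ?_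
    filter_upwards [Iio_mem_nhds h] with y hy
    exact if_pos (le_of_lt hy)
  · refine ContDiffAt.congr_of_eventuallyEq
      (f := fun x => -16 * r * (1 - x) ^ 3 + 12 * r * (1 - x) ^ 2) (by fun_prop) ?_
    filter_upwards [Ioi_mem_nhds h] with y hy
    exact if_neg (not_le_of_gt hy)

/-! ### Convergence to w at the end of the branch -/

theorem CkFun.abs_der_le_of_succ {k : ℕ} (u : CkFun k) (i : Fin k) (h0 : u.der i.castSucc 0 = 0)
    {ε : ℝ} (h : ∀ x, |u.der i.succ x| ≤ ε) (x : unitInterval) : |u.der i.castSucc x| ≤ ε := by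
  have hε : 0 ≤ ε := (abs_nonneg _).trans (h 0)
  have h1 := (convex_Icc (0 : ℝ) 1).norm_image_sub_le_of_norm_hasDerivWithin_le
    (f := u.fn i) (f' := fun t => u.fn (i + 1) t) (C := ε)
    (fun t ht => u.hasDerivWithinAt_fn i.2 ht)
    (fun t ht => by
      rw [Real.norm_eq_abs, show u.fn (i + 1) t = u.der i.succ ⟨t, ht⟩ from u.fn_coe i.succ ⟨t, ht⟩]
      exact h _)
    (left_mem_Icc.2 zero_le_one) x.2
  have e0 : u.fn i (0 : ℝ) = 0 := (u.fn_coe i.castSucc 0).trans h0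
  have e1 : u.fn i x = u.der i.castSucc x := u.fn_coe i.castSucc x
  rw [e0, e1, sub_zero, sub_zero, Real.norm_eq_abs, Real.norm_eq_abs, abs_of_nonneg x.2.1] at h1
  exact h1.trans (mul_le_of_le_one_right hε x.2.2)

theorem CkFun.norm_le_of_der_two {e : CkFun 2} (h0 : e.der 0 0 = 0) (h1 : e.der 1 0 = 0) {ε : ℝ}
    (h : ∀ x, |e.der 2 x| ≤ ε) : ‖e‖ ≤ ε := by
  have hε : 0 ≤ ε := (abs_nonneg _).trans (h 0)
  have e1 : ∀ x, |e.der 1 x| ≤ ε := e.abs_der_le_of_succ 1 h1 h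
  have e0 : ∀ x, |e.der 0 x| ≤ ε := e.abs_der_le_of_succ 0 h0 e1
  refine (pi_norm_le_iff_of_nonneg hε).2 fun j => (ContinuousMap.norm_le _ hε).2 fun x => ?_
  fin_cases j
  · exact e0 x
  · exact e1 x
  · exact h x

/-- Interpolation between the sup norm and the Lipschitz norm of the second derivative. -/
theorem holderNorm_le {e : CkFun 2} (h0 : e.der 0 0 = 0) (h1 : e.der 1 0 = 0) {ε K α : NNReal}
    (h : ∀ x, |e.der 2 x| ≤ ε) (hK : LipschitzWith K (e.der 2)) (hα : α ≤ 1) :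
    holderNorm α e ≤ ((ε + (2 * ε) ^ (1 - α : ℝ) * K ^ (α : ℝ) : NNReal) : ENNReal) := by
  rw [ENNReal.coe_add]
  refine add_le_add ?_ ?_
  · rw [enorm_le_coe]
    exact CkFun.norm_le_of_der_two h0 h1 h
  · have hz : HolderWith (2 * ε) 0 (e.der 2) := fun x y => by
      rw [NNReal.coe_zero, ENNReal.rpow_zero, mul_one, edist_nndist, ENNReal.coe_le_coe,
        ← NNReal.coe_le_coe, coe_nndist, Real.dist_eq]
      push_cast
      linarith [abs_sub (e.der 2 x) (e.der 2 y), h x, h y]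
    have := hz.interpolate hK.holderWith (t₁ := 1 - α) (t₂ := α) (tsub_add_cancel_of_le hα)
    rw [zero_mul, one_mul, zero_add, NNReal.coe_sub hα, NNReal.coe_one] at this
    exact this.eHolderNorm_le

theorem CkFun.der_eq_half_abs {u : CkFun 4} (hu : u.reflect = u) (j : Fin 5) (x : unitInterval) :
    |u.der j x| = |u.half j (|(x : ℝ) - 1 / 2|)| ∧
      (Even (j : ℕ) → u.der j x = u.half j |(x : ℝ) - 1 / 2|) := by
  rcases le_total (1 / 2) (x : ℝ) with hx | hx
  · rw [abs_of_nonneg (show 0 ≤ (x : ℝ) - 1 / 2 by linarith), CkFun.half_eq_der]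
    exact ⟨rfl, fun _ => rfl⟩
  · have e : u.half j |(x : ℝ) - 1 / 2| = u.der j (unitInterval.symm x) := by
      rw [abs_of_nonpos (by linarith), ← CkFun.half_eq_der, unitInterval.coe_symm_eq]
      congr 1; ring
    rw [e, ← CkFun.der_symm_of_reflect hu j x]
    refine ⟨by rw [abs_mul, abs_pow, abs_neg, abs_one, one_pow, one_mul], fun hj => ?_⟩
    rw [hj.neg_one_pow, one_mul]

theorem CkFun.lipschitzWith_der {k : ℕ} (u : CkFun k) (i : Fin k) {K : NNReal}
    (h : ∀ x, |u.der i.succ x| ≤ K) : LipschitzWith K (u.der i.castSucc) := by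
  refine LipschitzWith.of_dist_le_mul fun x y => ?_
  have h1 := (convex_Icc (0 : ℝ) 1).norm_image_sub_le_of_norm_hasDerivWithin_le
    (f := u.fn i) (f' := fun t => u.fn (i + 1) t) (C := K)
    (fun t ht => u.hasDerivWithinAt_fn i.2 ht)
    (fun t ht => by
      rw [Real.norm_eq_abs, show u.fn (i + 1) t = u.der i.succ ⟨t, ht⟩ from u.fn_coe i.succ ⟨t, ht⟩]
      exact h _)
    y.2 x.2
  have e0 : u.fn i y = u.der i.castSucc y := u.fn_coe i.castSucc y
  have e1 : u.fn i x = u.der i.castSucc x := u.fn_coe i.castSucc x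
  rw [e0, e1, Real.norm_eq_abs, Real.norm_eq_abs] at h1
  exact h1

section Limit

variable {f f' : ℝ → ℝ} {r : ℝ}

theorem IsPositiveSolution.reflect_eq {lam : ℝ} {u : CkFun 4} (hs : IsConvexSource r f f')
    (hl : 0 < lam) (h : IsPositiveSolution f r lam u) : u.reflect = u :=
  CkFun.ext_der_zero fun x => by
    rw [CkFun.der_reflect, Fin.val_zero, pow_zero, one_mul, (h.half_profile hs hl).2.2 x]

/-- On the right half u''' is nonnegative and increasing, and |u'''| is even about 1/2, so u'''(1)
bounds it everywhere. -/
theorem IsPositiveSolution.lipschitzWith_der_two {lam : ℝ} {u : CkFun 4} {M : NNReal}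
    (hs : IsConvexSource r f f') (hl : 0 < lam) (h : IsPositiveSolution f r lam u)
    (hM : u.half 3 (1 / 2) ≤ M) : LipschitzWith M (u.der 2) := by
  obtain ⟨hp, h3, -⟩ := h.half_profile hs hl
  have hpos : ∀ x ∈ Icc 0 (u.der 0 midpt), 0 < lam * f x := fun x hx =>
    mul_pos hl (hs.pos x ⟨hx.1, hx.2.trans_lt (h.lt _)⟩)
  have hm3 : MonotoneOn (u.half 3) (Icc 0 (1 / 2)) :=
    hp.chain.monotoneOn (by norm_num) fun t ht => by
      rw [hp.eqn t ht]; exact (hpos _ ⟨hp.nonneg t ht, hp.le t ht⟩).le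
  refine u.lipschitzWith_der 2 fun x => ?_
  have hx := abs_sub_half_mem x
  have e := (CkFun.der_eq_half_abs (h.reflect_eq hs hl) 3 x).1
  refine (e.trans_le ?_ : |u.der 3 x| ≤ M)
  change |u.half 3 (|(x : ℝ) - 1 / 2|)| ≤ M
  rw [abs_of_nonneg (hp.third_deriv_nonneg hpos h3 _ hx)]
  exact (hm3 hx (by norm_num) hx.2).trans hM

/-- A positive lower bound for `(r - u) f(u)` near `r` gives one on all of `[0,r)`. -/
theorem IsConvexSource.exists_singular_bound (hs : IsConvexSource r f f') (hr : 0 < r)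
    (hsing : 0 < liminf (fun u : ℝ => (((r - u) * f u : ℝ) : EReal)) (𝓝[<] r)) :
    ∃ c > 0, ∀ x ∈ Ico 0 r, c ≤ (r - x) * f x := by
  obtain ⟨c, hc0, hc⟩ := EReal.lt_iff_exists_real_btwn.1 hsing
  have hc0' : 0 < c := by exact_mod_cast hc0
  have hev := eventually_lt_of_lt_liminf hc
  obtain ⟨a, ha, hsub⟩ := (mem_nhdsLT_iff_exists_Ioo_subset' hr).1 hev
  have ha' : max a 0 < r := max_lt ha hr
  have hf0 : 0 < f 0 := hs.pos 0 ⟨le_rfl, hr⟩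
  refine ⟨min c ((r - max a 0) * f 0), lt_min hc0' (mul_pos (by linarith) hf0), fun x hx => ?_⟩
  rcases lt_or_ge a x with h | h
  · have : (c : EReal) < (((r - x) * f x : ℝ) : EReal) := hsub ⟨h, hx.2⟩
    exact (min_le_left _ _).trans (EReal.coe_lt_coe_iff.1 this).le
  · refine (min_le_right _ _).trans (mul_le_mul ?_ ?_ hf0.le (by linarith [hx.2]))
    · linarith [le_max_left a 0]
    · exact hs.strictMonoOn.monotoneOn ⟨le_rfl, hr⟩ hx hx.1

theorem eventually_mem_Ioo_left (hr : 0 < r) : ∀ᶠ p in 𝓝[<] r, p ∈ Ioo 0 r :=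
  Ioo_mem_nhdsLT hr

theorem tendsto_solutionCurve_fst (hs : IsConvexSource r f f') (hf : ContDiffOn ℝ 2 f (Ico 0 r))
    (hr : 0 < r)
    (hsing : 0 < liminf (fun u : ℝ => (((r - u) * f u : ℝ) : EReal)) (𝓝[<] r)) :
    Tendsto (fun p => (solutionCurve f r p).1) (𝓝[<] r) (𝓝 0) := by
  obtain ⟨c, hc0, hc⟩ := hs.exists_singular_bound hr hsing
  obtain ⟨M, hM0, hM⟩ := IsProfile.exists_third_deriv_bound hs hr
  have hlim : Tendsto (fun p => M * (1 + M) / c * √(r - p)) (𝓝[<] r) (𝓝 0) := by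
    have : Continuous fun p => M * (1 + M) / c * √(r - p) := by fun_prop
    have h := this.tendsto r
    rw [sub_self, Real.sqrt_zero, mul_zero] at h
    exact h.mono_left nhdsWithin_le_nhds
  refine tendsto_of_tendsto_of_tendsto_of_le_of_le' tendsto_const_nhds hlim ?_ ?_
  · filter_upwards [eventually_mem_Ioo_left hr] with p hp
    exact (solutionCurve_spec hs hf hp).1.1.le
  · filter_upwards [eventually_mem_Ioo_left hr, Ioo_mem_nhdsLT (show r - 1 / 4 < r by linarith)]
      with p hp hp4
    obtain ⟨⟨hl, hsol⟩, hmid⟩ := solutionCurve_spec hs hf hp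
    obtain ⟨hpr, h3, -⟩ := hsol.half_profile hs hl
    rw [hmid] at hpr
    exact hpr.lam_le_sqrt hs hl hp.2 hc0 hc h3 (hM _ _ _ hl hp.2 hpr h3) (by linarith [hp4.1])

theorem eventually_der_two_sub_le (hs : IsConvexSource r f f') (hf : ContDiffOn ℝ 2 f (Ico 0 r))
    (hr : 0 < r)
    (hsing : 0 < liminf (fun u : ℝ => (((r - u) * f u : ℝ) : EReal)) (𝓝[<] r)) {ε : ℝ}
    (hε : 0 < ε) :
    ∀ᶠ p in 𝓝[<] r, ∀ x, |(solutionCurve f r p).2.der 2 x - (limitFun r).der 2 x| ≤ ε := by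
  obtain ⟨M, hM0, hM⟩ := IsProfile.exists_third_deriv_bound hs hr
  -- First η is fixed so that the term M η costs at most ε / 2. Then f(r (1 - 2 η²)) is a constant,
  -- and λ → 0, p → r dispose of the rest.
  obtain ⟨η, hη0, hη4, hηε⟩ : ∃ η > 0, η ≤ 1 / 4 ∧ 11 * (M * η) ≤ ε / 2 := by
    refine ⟨min (1 / 4) (ε / (22 * M)), by positivity, min_le_left _ _, ?_⟩
    have := min_le_right (1 / 4) (ε / (22 * M))
    rw [le_div_iff₀ (by positivity)] at this
    linarith
  have hlim : Tendsto (fun p => 11 * ((solutionCurve f r p).1 * f (r * (1 - 2 * η ^ 2))) +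
      72 * (r - p)) (𝓝[<] r) (𝓝 0) := by
    have h1 := ((tendsto_solutionCurve_fst hs hf hr hsing).mul_const
      (f (r * (1 - 2 * η ^ 2)))).const_mul 11
    have h2 : Tendsto (fun p => 72 * (r - p)) (𝓝[<] r) (𝓝 (72 * (r - r))) :=
      (Continuous.tendsto (by fun_prop) r).mono_left nhdsWithin_le_nhds
    have h3 := h1.add h2
    simpa using h3
  filter_upwards [eventually_mem_Ioo_left hr, hlim.eventually_lt_const (half_pos hε)] with p hp he x
  obtain ⟨⟨hl, hsol⟩, hmid⟩ := solutionCurve_spec hs hf hp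
  obtain ⟨hpr, h3, -⟩ := hsol.half_profile hs hl
  rw [hmid] at hpr
  have h := hpr.second_deriv_sub_le hs hl hp.2 h3 (hM _ _ _ hl hp.2 hpr h3) hη0 hη4 _
    (abs_sub_half_mem x)
  have e : (solutionCurve f r p).2.der 2 x = (solutionCurve f r p).2.half 2 |(x : ℝ) - 1 / 2| :=
    (CkFun.der_eq_half_abs (hsol.reflect_eq hs hl) 2 x).2 (by decide)
  rw [e, limitFun_der_two]
  have e2 : r * (-24 + 96 * |(x : ℝ) - 1 / 2|) = -24 * r + 96 * r * |(x : ℝ) - 1 / 2| := by ring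
  rw [e2]
  linarith

theorem tendsto_holderNorm_solutionCurve (hs : IsConvexSource r f f')
    (hf : ContDiffOn ℝ 2 f (Ico 0 r)) (hr : 0 < r)
    (hsing : 0 < liminf (fun u : ℝ => (((r - u) * f u : ℝ) : EReal)) (𝓝[<] r)) {α : NNReal}
    (hα : α < 1) (h24 : 2 ≤ 4) :
    Tendsto (fun p => holderNorm α (CkFun.incl h24 (solutionCurve f r p).2 - limitFun r))
      (𝓝[<] r) (𝓝 0) := by
  obtain ⟨M, hM0, hM⟩ := IsProfile.exists_third_deriv_bound hs hr
  -- A Lipschitz constant of u'' - w'' that does not depend on p: M for u'' and 96 r for w''.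
  set K : NNReal := ⟨M, hM0.le⟩ + Real.toNNReal (96 * r) with hK
  have hlim : Tendsto (fun ε : NNReal => ((ε + (2 * ε) ^ (1 - α : ℝ) * K ^ (α : ℝ) : NNReal) : ENNReal))
      (𝓝[>] 0) (𝓝 0) := by
    have hα' : (0 : ℝ) < 1 - α := by have : (α : ℝ) < 1 := hα; linarith
    have : Continuous fun ε : NNReal => ε + (2 * ε) ^ (1 - α : ℝ) * K ^ (α : ℝ) :=
      continuous_id.add (((NNReal.continuous_rpow_const hα'.le).comp
        (continuous_const.mul continuous_id)).mul continuous_const)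
    have h := this.tendsto 0
    simp only [mul_zero, NNReal.zero_rpow hα'.ne', zero_mul, add_zero] at h
    exact (ENNReal.tendsto_coe.2 h).mono_left nhdsWithin_le_nhds
  rw [ENNReal.tendsto_nhds_zero]
  intro δ hδ
  obtain ⟨ε, hεδ, hε⟩ := ((ENNReal.tendsto_nhds_zero.1 hlim δ hδ).and self_mem_nhdsWithin).exists
  have hε' : (0 : ℝ) < ε := hε
  filter_upwards [eventually_mem_Ioo_left hr, eventually_der_two_sub_le hs hf hr hsing hε'] with p hp he
  obtain ⟨⟨hl, hsol⟩, hmid⟩ := solutionCurve_spec hs hf hp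
  obtain ⟨hpr, h3, -⟩ := hsol.half_profile hs hl
  rw [hmid] at hpr
  set u := (solutionCurve f r p).2
  have hd : ∀ (j : Fin 3) x, (CkFun.incl h24 u - limitFun r).der j x =
      (CkFun.incl h24 u).der j x - (limitFun r).der j x := fun _ _ => rfl
  refine (holderNorm_le (ε := ε) (K := K) ?_ ?_ ?_ ?_ hα.le).trans hεδ
  · rw [hd, limitFun_der_zero_left, sub_zero]
    exact hsol.left
  · rw [hd, limitFun_der_one_left, sub_zero]
    exact hsol.left'
  · exact he
  · exact (hsol.lipschitzWith_der_two (M := ⟨M, hM0.le⟩) hs hl (hM _ _ _ hl hp.2 hpr h3)).sub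
      (lipschitzWith_limitFun_der_two hr.le)

end Limit

/-! ### Counting solutions -/

section Multiplicity

variable {f f' : ℝ → ℝ} {r : ℝ}

theorem atMostTwice_solutionCurve (hs : IsConvexSource r f f') (hf : ContDiffOn ℝ 2 f (Ico 0 r)) :
    AtMostTwice (fun p => (solutionCurve f r p).1) r := by
  intro a ha b hb c hc hab hbc e1 e2
  obtain ⟨⟨la, sa⟩, ma⟩ := solutionCurve_spec hs hf ha
  obtain ⟨⟨-, sb⟩, mb⟩ := solutionCurve_spec hs hf hb
  obtain ⟨⟨-, sc⟩, mc⟩ := solutionCurve_spec hs hf hc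
  simp only at e1 e2
  rw [← e1] at sb
  rw [← e2, ← e1] at sc
  exact sa.not_three hs la sb sc (by rwa [ma, mb]) (by rwa [mb, mc])

/-- The positive solutions with parameter `lam` are the points of the curve at height `lam`. -/
theorem setOf_isPositiveSolution_eq (hs : IsConvexSource r f f') (hf : ContDiffOn ℝ 2 f (Ico 0 r))
    {lam : ℝ} (hl : 0 < lam) :
    {u | IsPositiveSolution f r lam u} =
      (fun p => (solutionCurve f r p).2) '' {p ∈ Ioo 0 r | (solutionCurve f r p).1 = lam} := by
  ext u
  constructor
  · intro h
    have h' : IsPositiveSolution f r lam u := h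
    have e := solutionCurve_of_mem hs (q := (lam, u)) ⟨hl, h'⟩
    exact ⟨u.der 0 midpt, ⟨h'.midpt_mem hs hl, congrArg Prod.fst e⟩, congrArg Prod.snd e⟩
  · rintro ⟨p, ⟨hp, rfl⟩, rfl⟩
    exact (solutionCurve_spec hs hf hp).1.2

/-- The curve is injective because p is read off as u(1/2), so counting solutions amounts to
counting points of a level set of λ(p). -/
theorem encard_isPositiveSolution (hs : IsConvexSource r f f') (hf : ContDiffOn ℝ 2 f (Ico 0 r))
    {lam : ℝ} (hl : 0 < lam) :
    {u | IsPositiveSolution f r lam u}.encard =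
      {p ∈ Ioo 0 r | (solutionCurve f r p).1 = lam}.encard := by
  rw [setOf_isPositiveSolution_eq hs hf hl]
  refine InjOn.encard_image fun a ha b hb hab => ?_
  rw [← (solutionCurve_spec hs hf ha.1).2, ← (solutionCurve_spec hs hf hb.1).2]
  exact congrArg (fun u : CkFun 4 => u.der 0 midpt) hab

end Multiplicity

section Unimodal

variable {g : ℝ → ℝ} {r p₀ y : ℝ}

theorem lt_of_unimodal (hmono : StrictMonoOn g (Icc 0 p₀)) (hanti : StrictAntiOn g (Ico p₀ r))
    (hp₀ : p₀ ∈ Ioo 0 r) {p : ℝ} (hp : p ∈ Ico 0 r) (hne : p ≠ p₀) : g p < g p₀ := by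
  rcases lt_or_gt_of_ne hne with h | h
  · exact hmono ⟨hp.1, h.le⟩ ⟨hp₀.1.le, le_rfl⟩ h
  · exact hanti ⟨le_rfl, hp₀.2⟩ ⟨h.le, hp.2⟩ h

theorem encard_level_of_unimodal (hc : ContinuousOn g (Ico 0 r)) (h0 : g 0 = 0)
    (hlim : Tendsto g (𝓝[<] r) (𝓝 0)) (hmono : StrictMonoOn g (Icc 0 p₀))
    (hanti : StrictAntiOn g (Ico p₀ r)) (hp₀ : p₀ ∈ Ioo 0 r) (hy : 0 < y) (hy₀ : y < g p₀) :
    {p ∈ Ioo 0 r | g p = y}.encard = 2 := by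
  obtain ⟨a, ha, hga⟩ := intermediate_value_Ioo hp₀.1.le
    (hc.mono fun x hx => ⟨hx.1, hx.2.trans_lt hp₀.2⟩) (show y ∈ Ioo (g 0) (g p₀) by rw [h0]; exact ⟨hy, hy₀⟩)
  obtain ⟨q, hqy, hq⟩ := ((hlim.eventually_lt_const hy).and (Ioo_mem_nhdsLT hp₀.2)).exists
  obtain ⟨b, hb, hgb⟩ := intermediate_value_Ioo' hq.1.le
    (hc.mono fun x hx => ⟨hp₀.1.le.trans hx.1, hx.2.trans_lt hq.2⟩) ⟨hqy, hy₀⟩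
  have hbr : b < r := hb.2.trans hq.2
  have hset : {p ∈ Ioo 0 r | g p = y} = {a, b} := by
    ext p
    constructor
    · rintro ⟨hp, hgp⟩
      rcases le_total p p₀ with h | h
      · exact Or.inl (hmono.injOn ⟨hp.1.le, h⟩ ⟨ha.1.le, ha.2.le⟩ (hgp.trans hga.symm))
      · exact Or.inr (hanti.injOn ⟨h, hp.2⟩ ⟨hb.1.le, hbr⟩ (hgp.trans hgb.symm))
    · rintro (rfl | rfl)
      · exact ⟨⟨ha.1, ha.2.trans hp₀.2⟩, hga⟩
      · exact ⟨⟨hp₀.1.trans hb.1, hbr⟩, hgb⟩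
  rw [hset]
  exact encard_pair (ha.2.trans hb.1).ne

end Unimodal

theorem theorem1p2 (r : ℝ) (hr : 0 < r) (f : ℝ → ℝ)
    (hf : ContDiffOn ℝ 2 f (Set.Ico 0 r))
    (hpos : ∀ u ∈ Set.Ico 0 r, 0 < f u)
    (hinc : ∀ u ∈ Set.Ioo 0 r, 0 < deriv f u)
    (hconv : ∀ u ∈ Set.Ioo 0 r, 0 < deriv (deriv f) u)
    (hsing : 0 < Filter.liminf (fun u : ℝ => (((r - u) * f u : ℝ) : EReal))
      (nhdsWithin r (Set.Iio r))) :
    -- the solution curve `Γ`, with the maximum value `p = u(1/2)` as its parameter,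
    -- its turning point `Γ p₀ = (lam₀, u₀)`, and its end point `w`
    ∃ (Γ : ℝ → ℝ × CkFun 4) (p₀ lam₀ : ℝ) (w : CkFun 2),
      -- all positive solutions lie on one smooth curve, which starts at `(0,0)`
      ContDiffOn ℝ 2 Γ (Set.Ico 0 r) ∧
      Γ 0 = 0 ∧
      solutionSet f r = Γ '' Set.Ioo 0 r ∧
      -- `u(1/2)` is strictly monotone along the curve
      (∀ p ∈ Set.Ico 0 r, (Γ p).2.der 0 midpt = p) ∧
      -- the curve turns exactly once, at `lam₀`
      p₀ ∈ Set.Ioo 0 r ∧ (Γ p₀).1 = lam₀ ∧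
      StrictMonoOn (fun p => (Γ p).1) (Set.Icc 0 p₀) ∧
      StrictAntiOn (fun p => (Γ p).1) (Set.Ico p₀ r) ∧
      -- exact multiplicity
      (∀ lam : ℝ, 0 < lam → lam < lam₀ → {u | IsPositiveSolution f r lam u}.encard = 2) ∧
      {u | IsPositiveSolution f r lam₀ u}.encard = 1 ∧
      (∀ lam : ℝ, lam₀ < lam → {u | IsPositiveSolution f r lam u} = ∅) ∧
      -- symmetry, and `u(1/2)` is the maximum value
      (∀ q ∈ solutionSet f r, ∀ x : unitInterval,
        q.2.der 0 (unitInterval.symm x) = q.2.der 0 x ∧ q.2.der 0 x ≤ q.2.der 0 midpt) ∧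
      -- the end of the upper branch: `lam` tends to `0` and `u` to `w` in every `C^{2+α}[0,1]`
      Filter.Tendsto (fun p => (Γ p).1) (nhdsWithin r (Set.Iio r)) (nhds 0) ∧
      (∀ α : NNReal, 0 < α → α < 1 →
        Filter.Tendsto (fun p => holderNorm α (CkFun.incl (by norm_num) (Γ p).2 - w))
          (nhdsWithin r (Set.Iio r)) (nhds 0)) ∧
      -- the function `w`
      (∀ x : unitInterval, w.der 0 x = limitProfile r x) ∧
      (∀ x : unitInterval, w.der 0 (unitInterval.symm x) = w.der 0 x) ∧
      w.der 0 midpt = r ∧ (∀ x : unitInterval, w.der 0 x ≤ r) ∧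
      (∀ α : NNReal, 0 < α → α < 1 → holderNorm α w < ⊤) ∧
      (¬ ∃ v : CkFun 3, v.der 0 = w.der 0) ∧
      ContDiffOn ℝ 4 (limitProfile r) (Set.Icc 0 1 \ {1 / 2}) := by
  have hs := isConvexSource_of_contDiffOn hf hpos hinc hconv
  have hmem : ∀ p ∈ Set.Ioo 0 r, 0 < (solutionCurve f r p).1 := fun p hp =>
    (solutionCurve_spec hs hf hp).1.1
  have hsmooth := contDiffOn_solutionCurve hs hf
  have hcont : ContinuousOn (fun p => (solutionCurve f r p).1) (Set.Ico 0 r) :=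
    continuous_fst.comp_continuousOn hsmooth.continuousOn
  have hzero := solutionCurve_zero hs
  have hzero' : (solutionCurve f r 0).1 = 0 := by rw [hzero]; rfl
  have hlim := tendsto_solutionCurve_fst hs hf hr hsing
  obtain ⟨p₀, hp₀, hmono, hanti⟩ := exists_unimodal hr hcont hzero' hmem
    (atMostTwice_solutionCurve hs hf) hlim
  have hmax : ∀ p ∈ Set.Ioo 0 r, p ≠ p₀ → (solutionCurve f r p).1 < (solutionCurve f r p₀).1 :=
    fun p hp => lt_of_unimodal (g := fun p => (solutionCurve f r p).1) hmono hanti hp₀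
      ⟨hp.1.le, hp.2⟩
  refine ⟨solutionCurve f r, p₀, (solutionCurve f r p₀).1, limitFun r, hsmooth, hzero,
    solutionSet_eq_image hs hf, ?_, hp₀, rfl, hmono, hanti, ?_, ?_, ?_, ?_, hlim, ?_,
    fun x => limitDer_zero r x, limitFun_symm r, limitFun_midpt r, limitFun_le hr.le, ?_,
    limitFun_not_three hr.ne', contDiffOn_limitProfile r _⟩
  · intro p hp
    rcases hp.1.eq_or_lt with rfl | h
    · rw [hzero]; rfl
    · exact (solutionCurve_spec hs hf ⟨h, hp.2⟩).2
  · intro lam hl hl₀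
    rw [encard_isPositiveSolution hs hf hl]
    exact encard_level_of_unimodal hcont hzero' hlim hmono hanti hp₀ hl hl₀
  · rw [encard_isPositiveSolution hs hf (hmem p₀ hp₀), Set.encard_eq_one]
    refine ⟨p₀, Set.eq_singleton_iff_unique_mem.2 ⟨⟨hp₀, rfl⟩, fun p hp => ?_⟩⟩
    by_contra hne
    exact (hmax p hp.1 hne).ne hp.2
  · intro lam hl₀
    rw [setOf_isPositiveSolution_eq hs hf ((hmem p₀ hp₀).trans hl₀), Set.image_eq_empty,
      Set.eq_empty_iff_forall_notMem]
    rintro p ⟨hp, rfl⟩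
    rcases eq_or_ne p p₀ with rfl | hne
    · exact lt_irrefl _ hl₀
    · exact lt_asymm hl₀ (hmax p hp hne)
  · exact fun q hq x => ⟨(hq.2.half_profile hs hq.1).2.2 x, hq.2.le_midpt hs hq.1 x⟩
  · exact fun α _ hα => tendsto_holderNorm_solutionCurve hs hf hr hsing hα _
  · exact fun α _ hα => holderNorm_limitFun_lt_top hr.le hα.le
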